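/- **Theorem 3.1.** Let $n\ge 1$ and let $p(\cdot):\mathbb R^n\to(0,\infty)$ be measurable with $p_+=\operatorname{ess\,sup}p<\infty$ and $p_-=\operatorname{ess\,inf}p>0$. For a finite exponent $q(\cdot)>0$ and a measurable function $g$, $|g|\le\infty$, put $\rho_{q(\cdot)}(g)=\int_{\mathbb R^n}|g(x)|^{q(x)}\,dx$ and $\|g\|_{q(\cdot)}=\inf\{\lambda>0:\rho_{q(\cdot)}(g/\lambda)\le 1\}$ (with $\inf\emptyset=\infty$), and let $L^{q(\cdot)}$ be the set of measurable $g$ with $\rho_{q(\cdot)}(g/\lambda)<\infty$ for some $\lambda>0$. Assume $p(\cdot)\in M\mathcal P_0$ with witness $p_0$: $0<p_0<p_-$, and there is a constant $C$ with $\|Mg\|_{p(\cdot)/p_0}\le C\|g\|_{p(\cdot)/p_0}$ for all $g\in L^{p(\cdot)/p_0}$, where $Mg(x)=\sup_{Q\ni x}|Q|^{-1}\int_Q|g|$, the supremum being over all cubes $Q\ni x$ with sides parallel to the axes. For $\Phi\in\mathcal S$ (complex-valued Schwartz functions on $\mathbb R^n$), $t>0$ and $f\in\mathcal S'$ (tempered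 distributions), let $\Phi_t(x)=t^{-n}\Phi(x/t)$ and $$M_{\Phi,0}f(x)=\sup_{t>0}|f*\Phi_t(x)|,\qquad \mathcal M_Nf(x)=\sup_{\Phi\in\mathcal S_N}M_{\Phi,0}f(x),$$ where $\mathcal S_N$ is the set of $\Phi\in\mathcal S$ with $\sup_x|x^\alpha D^\beta\Phi(x)|\le1$ for all multi-indices with $|\alpha|,|\beta|\le N$. Call $f$ bounded if $f*\Phi\in L^\infty$ for every $\Phi\in\mathcal S$. For bounded $f$ let $$\mathcal Nf(x)=\sup_{|x-y|<t}|P_t*f(y)|,\qquad P(x)=\frac{\Gamma(\frac{n+1}2)}{\pi^{(n+1)/2}}\frac1{(1+|x|^2)^{(n+1)/2}},\quad P_t(x)=t^{-n}P(x/t),$$ where $P_t*f$ is the bounded continuous function determined by $\int (P_t*f)\,\varphi\,dx=\int (f*\tilde\varphi)(z)P_t(-z)\,dz$ for all $\varphi\in\mathcal S$, with $\tilde\varphi(y)=\varphi(-y)$. Then for every $f\in\mathcal S'$ the following are equivalent: 1. there is $\Phi\in\mathcal S$ with $\int\Phi\,dx\ne0$ and $M_{\Phi,0}f\in L^{p(\cdot)}$;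 2. $\mathcal M_Nf\in L^{p(\cdot)}$ for every integer $N>n/p_0+n+1$; 3. $f$ is a bounded distribution and $\mathcal Nf\in L^{p(\cdot)}$. Moreover, for every $\Phi\in\mathcal S$ with $\int\Phi\,dx\ne0$ and every integer $N>n/p_0+n+1$ there is a finite constant $C$, depending on $n$, $p(\cdot)$, $\Phi$ and $N$ but not on $f$, such that for all $f\in\mathcal S'$ each of $\|M_{\Phi,0}f\|_{p(\cdot)}$ and $\|\mathcal M_Nf\|_{p(\cdot)}$ (values in $[0,\infty]$) is at most $C$ times the other, and for all bounded $f$ any one of $\|M_{\Phi,0}f\|_{p(\cdot)}$, $\|\mathcal M_Nf\|_{p(\cdot)}$, $\|\mathcal Nf\|_{p(\cdot)}$ is at most $C$ times any other. -/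

import Mathlib

open MeasureTheory Set Filter
open scoped ENNReal NNReal SchwartzMap

noncomputable section

namespace VarHardy

/-- Euclidean space of dimension `n`. -/
abbrev Rn (n : ℕ) : Type := EuclideanSpace ℝ (Fin n)

/-! ### Variable Lebesgue spaces

Since membership and the quasi-norm depend only on `|g|`, they are defined for functions with values
in `[0, ∞]` (maximal functions take values there). -/

/-- The modular `ρ(F) = ∫ F(x) ^ p(x) dx` of a finite exponent `p`. -/
def modular {n : ℕ} (p : Rn n → ℝ) (F : Rn n → ℝ≥0∞) : ℝ≥0∞ :=
  ∫⁻ x, F x ^ p x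

/-- The Luxemburg quasi-norm `inf {c > 0 : ρ(F / c) ≤ 1}`, equal to `∞` if there is no such `c`. -/
def varNorm {n : ℕ} (p : Rn n → ℝ) (F : Rn n → ℝ≥0∞) : ℝ≥0∞ :=
  ⨅ (c : ℝ) (_ : 0 < c ∧ modular p (fun x => F x / ENNReal.ofReal c) ≤ 1), ENNReal.ofReal c

/-- `F ∈ L^{p(·)}`: `F` is measurable and `ρ(F / c) < ∞` for some `c > 0`. -/
def MemVarLp {n : ℕ} (p : Rn n → ℝ) (F : Rn n → ℝ≥0∞) : Prop :=
  AEMeasurable F ∧ ∃ c : ℝ, 0 < c ∧ modular p (fun x => F x / ENNReal.ofReal c) < ∞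

/-- `p_-`, the essential infimum. -/
def pMinus {n : ℕ} (p : Rn n → ℝ) : EReal := essInf (fun x => (p x : EReal)) volume

/-- `p_+`, the essential supremum. -/
def pPlus {n : ℕ} (p : Rn n → ℝ) : EReal := essSup (fun x => (p x : EReal)) volume

/-- The class `𝒫₀` of measurable exponents with values in `(0, ∞)` and `p_+ < ∞`. -/
structure IsExponent {n : ℕ} (p : Rn n → ℝ) : Prop where
  aemeasurable : AEMeasurable p
  pos : ∀ x, 0 < p x
  pPlus_lt_top : pPlus p < ⊤

/-- The closed cube with sides parallel to the axes, lower corner `a` and side length `r`. -/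
def cube {n : ℕ} (a : Rn n) (r : ℝ) : Set (Rn n) := {y | ∀ i, a i ≤ y i ∧ y i ≤ a i + r}

/-- The Hardy-Littlewood maximal function: the supremum of the averages over the cubes
containing `x`. -/
def hlMaximal {n : ℕ} (F : Rn n → ℝ≥0∞) (x : Rn n) : ℝ≥0∞ :=
  ⨆ (a : Rn n) (r : ℝ) (_ : 0 < r ∧ x ∈ cube a r), (volume (cube a r))⁻¹ * ∫⁻ y in cube a r, F y

/-- `p ∈ M𝒫₀`, with witness `p₀`: `0 < p₀ < p_-` and the maximal operator is bounded on
`L^{p(·)/p₀}`. -/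
structure IsMP0 {n : ℕ} (p : Rn n → ℝ) (p₀ : ℝ) : Prop where
  isExponent : IsExponent p
  pMinus_pos : 0 < pMinus p
  p₀_pos : 0 < p₀
  p₀_lt : (p₀ : EReal) < pMinus p
  maximal_bounded : ∃ C : ℝ≥0, ∀ F : Rn n → ℝ≥0∞, MemVarLp (fun x => p x / p₀) F →
    varNorm (fun x => p x / p₀) (hlMaximal F) ≤ C * varNorm (fun x => p x / p₀) F

/-! ### Convolution of tempered distributions with Schwartz functions -/

/-- The reflection `y ↦ Φ (-y)`. -/
def reflect {n : ℕ} (Φ : 𝓢(Rn n, ℂ)) : 𝓢(Rn n, ℂ) :=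
  SchwartzMap.compCLMOfContinuousLinearEquiv ℂ (ContinuousLinearEquiv.neg ℝ) Φ

@[simp] theorem reflect_apply {n : ℕ} (Φ : 𝓢(Rn n, ℂ)) (y : Rn n) : reflect Φ y = Φ (-y) := rfl

/-- The Schwartz function `y ↦ Φ (x - y)`. -/
def reflectTranslate {n : ℕ} (x : Rn n) (Φ : 𝓢(Rn n, ℂ)) : 𝓢(Rn n, ℂ) :=
  SchwartzMap.compSubConstCLM ℂ x (reflect Φ)

@[simp] theorem reflectTranslate_apply {n : ℕ} (x : Rn n) (Φ : 𝓢(Rn n, ℂ)) (y : Rn n) :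
    reflectTranslate x Φ y = Φ (x - y) := by
  simp [reflectTranslate]

/-- The dilation `Φ_t(x) = t ^ (-n) Φ(x / t)`, `t > 0`. -/
def dilate {n : ℕ} (t : ℝ) (ht : 0 < t) (Φ : 𝓢(Rn n, ℂ)) : 𝓢(Rn n, ℂ) :=
  (((t ^ n)⁻¹ : ℝ) : ℂ) • SchwartzMap.compCLMOfContinuousLinearEquiv ℂ
    (ContinuousLinearEquiv.smulLeft (R₁ := ℝ) (M₁ := Rn n) (Units.mk0 t ht.ne')⁻¹) Φ

@[simp] theorem dilate_apply {n : ℕ} (t : ℝ) (ht : 0 < t) (Φ : 𝓢(Rn n, ℂ)) (x : Rn n) :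
    dilate t ht Φ x = (((t ^ n)⁻¹ : ℝ) : ℂ) * Φ (t⁻¹ • x) := rfl

/-- The convolution `f * Φ`, the smooth function `x ↦ ⟨f, Φ (x - ·)⟩`. -/
def conv {n : ℕ} (f : 𝓢'(Rn n, ℂ)) (Φ : 𝓢(Rn n, ℂ)) (x : Rn n) : ℂ :=
  f (reflectTranslate x Φ)

/-- `f` is a bounded distribution: `f * Φ ∈ L^∞` for every Schwartz function `Φ`. -/
def IsBoundedDistribution {n : ℕ} (f : 𝓢'(Rn n, ℂ)) : Prop :=
  ∀ Φ : 𝓢(Rn n, ℂ), MemLp (conv f Φ) ∞ volume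

/-! ### The three maximal functions -/

/-- The radial maximal function `M_{Φ,0} f(x) = sup_{t > 0} |f * Φ_t(x)|`. -/
def radialMaximal {n : ℕ} (Φ : 𝓢(Rn n, ℂ)) (f : 𝓢'(Rn n, ℂ)) (x : Rn n) : ℝ≥0∞ :=
  ⨆ (t : ℝ) (ht : 0 < t), ‖conv f (dilate t ht Φ) x‖ₑ

/-- The class `𝒮_N` of Schwartz functions with `|x^α D^β Φ(x)| ≤ 1` for all `x` and all multi-indices
`|α|, |β| ≤ N`. The derivatives `D^β` with `|β| = k` are the `k`-fold partial derivatives, listed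
here by the sequence `i` of the coordinates of differentiation. -/
def unitClass (n N : ℕ) : Set 𝓢(Rn n, ℂ) :=
  {Φ | ∀ α : Fin n → ℕ, ∑ j, α j ≤ N → ∀ k ≤ N, ∀ i : Fin k → Fin n, ∀ x : Rn n,
    |∏ j, x j ^ α j| *
      ‖iteratedFDeriv ℝ k Φ x (fun l => EuclideanSpace.single (i l) (1 : ℝ))‖ ≤ 1}

/-- The grand maximal function `𝓜_N f = sup_{Φ ∈ 𝒮_N} M_{Φ,0} f`. -/
def grandMaximal {n : ℕ} (N : ℕ) (f : 𝓢'(Rn n, ℂ)) (x : Rn n) : ℝ≥0∞ :=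
  ⨆ Φ ∈ unitClass n N, radialMaximal Φ f x

/-- The Poisson kernel `P(x) = Γ((n+1)/2) π^(-(n+1)/2) (1 + |x|²)^(-(n+1)/2)`. -/
def poisson {n : ℕ} (x : Rn n) : ℝ :=
  Real.Gamma (((n : ℝ) + 1) / 2) / Real.pi ^ (((n : ℝ) + 1) / 2) *
    (1 / (1 + ‖x‖ ^ 2) ^ (((n : ℝ) + 1) / 2))

/-- `P_t(x) = t ^ (-n) P(x / t)`. -/
def poissonDilate {n : ℕ} (t : ℝ) (x : Rn n) : ℝ := (t ^ n)⁻¹ * poisson (t⁻¹ • x)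

/-- `g` is the bounded continuous function that represents the distribution `f * P_t`. For a bounded
distribution `f` and `h ∈ L¹`, the distribution `f * h` is given by
`⟨f * h, φ⟩ = ∫ (f * φ~)(z) h(-z) dz`, where `φ~(y) = φ(-y)`. There is at most one such `g`. -/
def IsPoissonConv {n : ℕ} (f : 𝓢'(Rn n, ℂ)) (t : ℝ) (g : Rn n → ℂ) : Prop :=
  Continuous g ∧ (∃ K : ℝ, ∀ x, ‖g x‖ ≤ K) ∧
    ∀ φ : 𝓢(Rn n, ℂ),
      ∫ x, g x * φ x = ∫ z, conv f (reflect φ) z * (poissonDilate t (-z) : ℂ)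

open Classical in
/-- The function `P_t * f` for a bounded distribution `f` and `t > 0` (and the value `0` where there is
no representing function). -/
def poissonConv {n : ℕ} (f : 𝓢'(Rn n, ℂ)) (t : ℝ) : Rn n → ℂ :=
  if h : ∃ g, IsPoissonConv f t g then h.choose else 0

/-- The non-tangential maximal function `𝒩 f(x) = sup_{|x - y| < t} |P_t * f(y)|` of a bounded
distribution. -/
def nontangentialMaximal {n : ℕ} (f : 𝓢'(Rn n, ℂ)) (x : Rn n) : ℝ≥0∞ :=
  ⨆ (t : ℝ) (y : Rn n) (_ : 0 < t ∧ ‖x - y‖ < t), ‖poissonConv f t y‖ₑ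

end VarHardy

end

open MeasureTheory Set Filter
open scoped ENNReal NNReal SchwartzMap Topology

noncomputable section

namespace VarHardy

/-! Everything rests on one reproducing estimate. Let B be a continuous kernel of integral 1 with
enough moments, let T_k be averaging against B at scale 2^(-k), and put D_k = 1 - T_k. The T_k
commute and tend to the identity, so telescoping 1 - D_j^(m+1) and letting j → ∞ writes u as a
series of operators applied to the T_k u, each operator after the initial one being a sum of
products of m differences at scales 2^(-k) and 2^(-k-1). For u = f * Ψ_t, rescaled, T_k u is a
convolution F_k * Ψ with F_k = f * B_{2^(-k) t}; the differences can be moved onto Ψ, where each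
gains 2^(-k) at the price of one derivative. Hence |f * Ψ_t(x)| ≤ C ∑ 2^(-km) ∫ |F_k(x - tz)| (1 +
|z|)^(-L) dz (`AvgKernel.enorm_le`, `IsKernelFamily.enorm_conv_dilate_le`). Neither the Fourier
transform nor smoothness of B enters, so B may also be built from Poisson kernels.

With B = Ψ = Φ the estimate feeds back into itself: splitting |F| = |F|^(1-r) |F|^r and absorbing a
Peetre-type supremum gives |f * Φ_t(y)|^r ≤ C M((M_{Φ,0} f)^r)(x) on the cone |x - y| < t
(`exists_enorm_dilConv_rpow_le`). With Ψ in `unitClass n N` it bounds the grand maximal function by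
the p₀-th root of M applied to the p₀-th power of the non-tangential maximal function of the F_τ
(`exists_grandMaximal_le_hlMaximal`); this needs N > n/p₀ + n. Two uses of the boundedness of M on
L^{p(·)/p₀} lead from the radial to the grand maximal function.

On the Poisson side, P_t is a mixture of Gaussians. This yields an explicit P_t * f and the
pointwise bound of 𝒩f by the grand maximal function (`exists_nontangentialMaximal_le`). Conversely P
has too few moments to serve as B, but a binomial combination of its dilates is positive and decays
as fast as desired (`fastKernel_eq`). Finally, a finite norm of the grand maximal function forces f
to be bounded, because that function dominates |f * Φ(x)| on the whole unit ball about x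
(`IsMP0.isBoundedDistribution`). -/

section

/-! ### Schwartz seminorms and affine changes of variable -/

section SchwartzSeminorms

variable {n : ℕ}

/-- A seminorm that controls `(1 + ‖x‖) ^ k * ‖D^l Φ x‖` for all `k, l ≤ K`. -/
def schwartzNorm (K : ℕ) : Seminorm ℂ 𝓢(Rn n, ℂ) :=
  (2 ^ K : ℝ≥0) • (Finset.Iic (K, K)).sup (schwartzSeminormFamily ℂ (Rn n) ℂ)

theorem schwartzNorm_apply (K : ℕ) (Φ : 𝓢(Rn n, ℂ)) :
    schwartzNorm K Φ = 2 ^ K * (Finset.Iic (K, K)).sup (schwartzSeminormFamily ℂ (Rn n) ℂ) Φ := by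
  simp [schwartzNorm, NNReal.smul_def]

theorem le_schwartzNorm {K k l : ℕ} (hk : k ≤ K) (hl : l ≤ K) (Φ : 𝓢(Rn n, ℂ)) (x : Rn n) :
    (1 + ‖x‖) ^ k * ‖iteratedFDeriv ℝ l Φ x‖ ≤ schwartzNorm K Φ := by
  rw [schwartzNorm_apply]
  exact SchwartzMap.one_add_le_sup_seminorm_apply (𝕜 := ℂ) (m := (K, K)) hk hl Φ x

theorem schwartzNorm_le {K : ℕ} {Φ : 𝓢(Rn n, ℂ)} {A : ℝ} (hA : 0 ≤ A)
    (h : ∀ k ≤ K, ∀ l ≤ K, ∀ x, ‖x‖ ^ k * ‖iteratedFDeriv ℝ l Φ x‖ ≤ A) :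
    schwartzNorm K Φ ≤ 2 ^ K * A := by
  rw [schwartzNorm_apply]
  gcongr
  refine Seminorm.finset_sup_apply_le hA fun i hi => ?_
  obtain ⟨hk, hl⟩ := Prod.mk_le_mk.1 (Finset.mem_Iic.1 hi)
  exact SchwartzMap.seminorm_le_bound ℂ i.1 i.2 Φ hA (h _ hk _ hl)

theorem norm_le_schwartzNorm (K : ℕ) (Φ : 𝓢(Rn n, ℂ)) (x : Rn n) :
    (1 + ‖x‖) ^ K * ‖Φ x‖ ≤ schwartzNorm K Φ := by
  simpa using le_schwartzNorm (l := 0) le_rfl (Nat.zero_le K) Φ x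

theorem continuous_schwartzNorm (K : ℕ) : Continuous (schwartzNorm (n := n) K) := by
  have h : Continuous ((Finset.Iic (K, K)).sup (schwartzSeminormFamily ℂ (Rn n) ℂ) :
      Seminorm ℂ 𝓢(Rn n, ℂ)) := by
    induction Finset.Iic (K, K) using Finset.induction_on with
    | empty => exact continuous_const (y := (0 : ℝ))
    | insert i s _ ih =>
      rw [Finset.sup_insert, Seminorm.coe_sup]
      exact ((schwartz_withSeminorms ℂ (Rn n) ℂ).continuous_seminorm i).sup ih
  have := h.const_mul ((2 : ℝ) ^ K)
  simpa only [← schwartzNorm_apply] using this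

/-- Continuity involves finitely many seminorms, and any finite set of indices lies below some (K,
K). A single number K can therefore serve as the order of a distribution. -/
theorem exists_le_schwartzNorm (p : Seminorm ℂ 𝓢(Rn n, ℂ)) (hp : Continuous p) :
    ∃ K : ℕ, ∃ C : ℝ, 0 ≤ C ∧ ∀ Φ, p Φ ≤ C * schwartzNorm K Φ := by
  obtain ⟨s, C, -, hC⟩ := Seminorm.bound_of_continuous (schwartz_withSeminorms ℂ (Rn n) ℂ) p hp
  obtain ⟨K, hK⟩ : ∃ K : ℕ, s ⊆ Finset.Iic (K, K) := by
    refine ⟨s.sup Prod.fst ⊔ s.sup Prod.snd, fun i hi => Finset.mem_Iic.2 (Prod.mk_le_mk.2 ⟨?_, ?_⟩)⟩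
    · exact le_sup_of_le_left (Finset.le_sup (f := Prod.fst) hi)
    · exact le_sup_of_le_right (Finset.le_sup (f := Prod.snd) hi)
  refine ⟨K, C, C.2, fun Φ => (hC Φ).trans ?_⟩
  rw [schwartzNorm_apply]
  have h0 : s.sup (schwartzSeminormFamily ℂ (Rn n) ℂ) ≤
      (Finset.Iic (K, K)).sup (schwartzSeminormFamily ℂ (Rn n) ℂ) := Finset.sup_mono hK
  have h1 : 0 ≤ (Finset.Iic (K, K)).sup (schwartzSeminormFamily ℂ (Rn n) ℂ) Φ := apply_nonneg _ _
  change (C : ℝ) * _ ≤ _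
  gcongr
  refine (h0 Φ).trans (le_mul_of_one_le_left h1 (one_le_pow₀ (by norm_num)))

theorem exists_norm_apply_le (f : 𝓢'(Rn n, ℂ)) :
    ∃ K : ℕ, ∃ C : ℝ, 0 ≤ C ∧ ∀ Φ, ‖f Φ‖ ≤ C * schwartzNorm K Φ := by
  obtain ⟨K, C, hC, h⟩ := exists_le_schwartzNorm
    ((normSeminorm ℂ ℂ).comp (f.toLinearMap : 𝓢(Rn n, ℂ) →ₗ[ℂ] ℂ)) (continuous_norm.comp f.cont)
  exact ⟨K, C, hC, h⟩

theorem tendsto_schwartz_of_schwartzNorm {α : Type*} {l : Filter α} {u : α → 𝓢(Rn n, ℂ)}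
    {Φ : 𝓢(Rn n, ℂ)} (h : ∀ K, Tendsto (fun a => schwartzNorm K (u a - Φ)) l (𝓝 0)) :
    Tendsto u l (𝓝 Φ) := by
  rw [(schwartz_withSeminorms ℂ (Rn n) ℂ).tendsto_nhds]
  rintro ⟨k, m⟩ ε hε
  filter_upwards [(h (k ⊔ m)).eventually (gt_mem_nhds hε)] with a ha
  refine lt_of_le_of_lt (SchwartzMap.seminorm_le_bound ℂ k m _ (apply_nonneg _ _) fun x => ?_) ha
  refine le_trans ?_ (le_schwartzNorm (k := k) (l := m) le_sup_left le_sup_right (u a - Φ) x)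
  gcongr
  linarith

/-- The function `y ↦ Φ (a y + h)` (and `0` if `a = 0`). -/
def affine (a : ℝ) (h : Rn n) (Φ : 𝓢(Rn n, ℂ)) : 𝓢(Rn n, ℂ) :=
  if ha : a ≠ 0 then SchwartzMap.compCLMOfContinuousLinearEquiv ℂ
    (ContinuousLinearEquiv.smulLeft (R₁ := ℝ) (M₁ := Rn n) (Units.mk0 a ha))
    (SchwartzMap.compSubConstCLM ℂ (-h) Φ) else 0

theorem affine_apply {a : ℝ} (ha : a ≠ 0) (h : Rn n) (Φ : 𝓢(Rn n, ℂ)) (y : Rn n) :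
    affine a h Φ y = Φ (a • y + h) := by
  have : (ContinuousLinearEquiv.smulLeft (R₁ := ℝ) (M₁ := Rn n) (Units.mk0 a ha)) y = a • y := rfl
  simp [affine, ha, this]

theorem iteratedFDeriv_affine {a : ℝ} (ha : a ≠ 0) (h : Rn n) (Φ : 𝓢(Rn n, ℂ)) (l : ℕ) (y : Rn n) :
    iteratedFDeriv ℝ l (affine a h Φ) y = a ^ l • iteratedFDeriv ℝ l Φ (a • y + h) := by
  have h1 : (affine a h Φ : Rn n → ℂ) =
      (fun z => Φ (z + h)) ∘ (a • ContinuousLinearMap.id ℝ (Rn n)) := by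
    ext y; simp [affine_apply ha]
  have hs : ContDiff ℝ l (fun z => Φ (z + h)) := by
    have := Φ.smooth l
    fun_prop
  rw [h1, ContinuousLinearMap.iteratedFDeriv_comp_right _ hs _ le_rfl, iteratedFDeriv_comp_add_right]
  ext m
  simp only [ContinuousMultilinearMap.compContinuousLinearMap_apply,
    smul_apply, ContinuousLinearMap.id_apply]
  rw [ContinuousMultilinearMap.map_smul_univ]
  simp

theorem one_add_norm_le_affine {a δ H : ℝ} (hδ : 0 < δ) (ha : δ ≤ |a|) {h : Rn n} (hh : ‖h‖ ≤ H)
    (y : Rn n) : 1 + ‖y‖ ≤ (1 + δ⁻¹) * (1 + H) * (1 + ‖a • y + h‖) := by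
  have hH : 0 ≤ H := (norm_nonneg h).trans hh
  have h1 : δ * ‖y‖ ≤ ‖a • y + h‖ + H := by
    calc δ * ‖y‖ ≤ |a| * ‖y‖ := by gcongr
      _ = ‖(a • y + h) - h‖ := by simp [norm_smul]
      _ ≤ ‖a • y + h‖ + ‖h‖ := norm_sub_le _ _
      _ ≤ _ := by gcongr
  have h2 : ‖y‖ ≤ δ⁻¹ * (‖a • y + h‖ + H) := by
    rw [← div_eq_inv_mul, le_div_iff₀ hδ]; linarith
  have h3 : 0 < δ⁻¹ := inv_pos.2 hδ
  nlinarith [norm_nonneg (a • y + h), mul_nonneg hH (norm_nonneg (a • y + h)),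
    mul_nonneg h3.le (mul_nonneg hH (norm_nonneg (a • y + h)))]

/-- The dependence on δ, A and H is kept explicit: the growth of f * Φ in x, and of f * Φ_s as s →
0, is read off from it. -/
theorem schwartzNorm_affine_le {a δ A H : ℝ} (hδ : 0 < δ) (ha : δ ≤ |a|) (haA : |a| ≤ A) (hA : 1 ≤ A)
    {h : Rn n} (hh : ‖h‖ ≤ H) (K : ℕ) (Φ : 𝓢(Rn n, ℂ)) :
    schwartzNorm K (affine a h Φ) ≤
      2 ^ K * (((1 + δ⁻¹) * (1 + H)) ^ K * A ^ K * schwartzNorm K Φ) := by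
  have hH : 0 ≤ H := (norm_nonneg h).trans hh
  have h3 : 0 < δ⁻¹ := inv_pos.2 hδ
  have ha0 : a ≠ 0 := by rintro rfl; simp at ha; linarith
  have hB : 1 ≤ (1 + δ⁻¹) * (1 + H) := by nlinarith
  refine schwartzNorm_le (mul_nonneg (by positivity) (apply_nonneg _ _)) fun k hk l hl y => ?_
  rw [iteratedFDeriv_affine ha0, norm_smul, norm_pow, Real.norm_eq_abs]
  have h4 := le_schwartzNorm hk hl Φ (a • y + h)
  calc ‖y‖ ^ k * (|a| ^ l * ‖iteratedFDeriv ℝ l Φ (a • y + h)‖)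
      ≤ ((1 + δ⁻¹) * (1 + H) * (1 + ‖a • y + h‖)) ^ k *
        (A ^ K * ‖iteratedFDeriv ℝ l Φ (a • y + h)‖) := by
        have h5 : |a| ^ l ≤ A ^ K :=
          (pow_le_pow_left₀ (abs_nonneg a) haA l).trans (pow_le_pow_right₀ hA hl)
        gcongr
        linarith [one_add_norm_le_affine hδ ha hh y]
    _ = ((1 + δ⁻¹) * (1 + H)) ^ k * A ^ K *
        ((1 + ‖a • y + h‖) ^ k * ‖iteratedFDeriv ℝ l Φ (a • y + h)‖) := by rw [mul_pow]; ring
    _ ≤ ((1 + δ⁻¹) * (1 + H)) ^ K * A ^ K * schwartzNorm K Φ := by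
        gcongr

/-- The mean value inequality between the two arguments costs one derivative and one power of the
weight, whence `schwartzNorm (K + 1)`. Joint continuity in dilation and translation is what makes f
* Φ_s(x) continuous in (s, x), so that it can be integrated in s. -/
theorem continuousAt_affine (Φ : 𝓢(Rn n, ℂ)) {q₀ : ℝ × Rn n} (h₀ : q₀.1 ≠ 0) :
    ContinuousAt (fun q : ℝ × Rn n => affine q.1 q.2 Φ) q₀ := by
  obtain ⟨a₀, k₀⟩ := q₀
  simp only at h₀
  refine tendsto_schwartz_of_schwartzNorm fun K => ?_
  set δ := |a₀| / 2 with hδ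
  have hδ0 : 0 < δ := by have := abs_pos.2 h₀; positivity
  set B := (1 + δ⁻¹) * (1 + (‖k₀‖ + 1)) with hB
  have hB1 : 1 ≤ B := by
    have h3 : 0 < δ⁻¹ := inv_pos.2 hδ0
    have := norm_nonneg k₀
    nlinarith
  set A := (|a₀| + 1) with hA
  set S := schwartzNorm (K + 1) Φ with hS
  have hS0 : 0 ≤ S := apply_nonneg _ _
  have key : ∀ᶠ q : ℝ × Rn n in 𝓝 (a₀, k₀), schwartzNorm K (affine q.1 q.2 Φ - affine a₀ k₀ Φ) ≤
      2 ^ K * ∑ l ∈ Finset.range (K + 1), (|q.1 ^ l - a₀ ^ l| * (B ^ K * S) +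
        A ^ K * ((|q.1 - a₀| + ‖q.2 - k₀‖) * (B ^ (K + 1) * S))) := by
    have e1 : ∀ᶠ q : ℝ × Rn n in 𝓝 (a₀, k₀), |q.1 - a₀| < min δ 1 := by
      have : Tendsto (fun q : ℝ × Rn n => |q.1 - a₀|) (𝓝 (a₀, k₀)) (𝓝 0) := by
        have : ContinuousAt (fun q : ℝ × Rn n => |q.1 - a₀|) (a₀, k₀) := by fun_prop
        simpa [ContinuousAt] using this
      exact this.eventually (gt_mem_nhds (by positivity))
    have e2 : ∀ᶠ q : ℝ × Rn n in 𝓝 (a₀, k₀), ‖q.2 - k₀‖ < 1 := by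
      have : Tendsto (fun q : ℝ × Rn n => ‖q.2 - k₀‖) (𝓝 (a₀, k₀)) (𝓝 0) := by
        have : ContinuousAt (fun q : ℝ × Rn n => ‖q.2 - k₀‖) (a₀, k₀) := by fun_prop
        simpa [ContinuousAt] using this
      exact this.eventually (gt_mem_nhds (by positivity))
    filter_upwards [e1, e2] with q hq1 hq2
    obtain ⟨a, k⟩ := q
    simp only at hq1 hq2 ⊢
    -- All dilation factors between a₀ and a stay away from 0, so the weight comparison holds at
    -- every intermediate point of the mean value argument.
    have hseg : ∀ c ∈ segment ℝ a₀ a, δ ≤ |c| := by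
      intro c hc
      have h1 : |c - a₀| ≤ |a - a₀| := by
        have := norm_sub_le_of_mem_segment hc
        rw [abs_sub_comm a a₀]
        simpa [abs_sub_comm] using this
      have h2 : |a₀| - |c| ≤ |c - a₀| := by rw [abs_sub_comm]; exact abs_sub_abs_le_abs_sub _ _
      have h3 := hq1.trans_le (min_le_left _ _)
      rw [hδ] at h3 ⊢; linarith
    have ha1 : δ ≤ |a| := hseg a (right_mem_segment _ _ _)
    have ha0 : a ≠ 0 := by rintro rfl; simp at ha1; linarith
    have haA : |a| ≤ A := by
      have := abs_sub_abs_le_abs_sub a a₀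
      have h3 := hq1.trans_le (min_le_right _ _)
      rw [hA]; linarith
    have hkn : ‖k‖ ≤ ‖k₀‖ + 1 := by
      have := norm_sub_norm_le k k₀
      linarith
    refine schwartzNorm_le (Finset.sum_nonneg fun _ _ => by positivity) fun m hm l hl y => ?_
    refine le_trans ?_ (Finset.single_le_sum (f := fun l => |a ^ l - a₀ ^ l| * (B ^ K * S) +
        A ^ K * ((|a - a₀| + ‖k - k₀‖) * (B ^ (K + 1) * S))) (fun _ _ => by positivity)
        (Finset.mem_range_succ_iff.2 hl))
    have e3 : iteratedFDeriv ℝ l (affine a k Φ - affine a₀ k₀ Φ : 𝓢(Rn n, ℂ)) y =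
        (a ^ l - a₀ ^ l) • iteratedFDeriv ℝ l Φ (a • y + k) +
          a₀ ^ l • (iteratedFDeriv ℝ l Φ (a • y + k) - iteratedFDeriv ℝ l Φ (a₀ • y + k₀)) := by
      have : ((affine a k Φ - affine a₀ k₀ Φ : 𝓢(Rn n, ℂ)) : Rn n → ℂ) =
        (affine a k Φ : Rn n → ℂ) - (affine a₀ k₀ Φ : Rn n → ℂ) := rfl
      rw [this, iteratedFDeriv_sub_apply ((affine a k Φ).contDiffAt l)
        ((affine a₀ k₀ Φ).contDiffAt l), iteratedFDeriv_affine ha0, iteratedFDeriv_affine h₀,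
        sub_smul, smul_sub]
      abel
    -- The extra decay, m + 1 instead of m, is spent in `e5`, where the displacement grows like 1 +
    -- ‖y‖.
    have e4 : ‖iteratedFDeriv ℝ l Φ (a • y + k) - iteratedFDeriv ℝ l Φ (a₀ • y + k₀)‖ ≤
        (B ^ (K + 1) * S / (1 + ‖y‖) ^ (m + 1)) * ‖(a • y + k) - (a₀ • y + k₀)‖ := by
      refine Convex.norm_image_sub_le_of_norm_fderiv_le (𝕜 := ℝ) (f := iteratedFDeriv ℝ l Φ)
        (s := segment ℝ (a₀ • y + k₀) (a • y + k)) (fun z _ => ?_) (fun z hz => ?_)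
        (convex_segment _ _) (left_mem_segment _ _ _) (right_mem_segment _ _ _)
      · exact ((Φ.smooth ⊤).differentiable_iteratedFDeriv (mod_cast ENat.natCast_lt_top l)) z
      · rw [norm_fderiv_iteratedFDeriv, le_div_iff₀ (by positivity)]
        obtain ⟨s, t, hs, ht, hst, rfl⟩ := hz
        have hz : s • (a₀ • y + k₀) + t • (a • y + k) =
            (s * a₀ + t * a) • y + (s • k₀ + t • k) := by
          simp only [smul_add, add_smul, smul_smul]; abel
        rw [hz]
        have h5 := hseg (s * a₀ + t * a) ⟨s, t, hs, ht, hst, rfl⟩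
        have h6 : ‖s • k₀ + t • k‖ ≤ ‖k₀‖ + 1 := by
          have : s • k₀ + t • k = k₀ + t • (k - k₀) := by
            have : s = 1 - t := by linarith
            rw [this, smul_sub, sub_smul, one_smul]; abel
          rw [this]
          refine (norm_add_le _ _).trans ?_
          rw [norm_smul, Real.norm_of_nonneg ht]
          have : t ≤ 1 := by linarith
          nlinarith [norm_nonneg (k - k₀)]
        have h7 := one_add_norm_le_affine hδ0 h5 h6 y
        have h8 := le_schwartzNorm (K := K + 1) (k := m + 1) (l := l + 1) (by omega) (by omega) Φ
          ((s * a₀ + t * a) • y + (s • k₀ + t • k))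
        calc _ ≤ ‖iteratedFDeriv ℝ (l + 1) Φ ((s * a₀ + t * a) • y + (s • k₀ + t • k))‖ *
              (B * (1 + ‖(s * a₀ + t * a) • y + (s • k₀ + t • k)‖)) ^ (m + 1) := by
              gcongr
          _ = B ^ (m + 1) * ((1 + ‖(s * a₀ + t * a) • y + (s • k₀ + t • k)‖) ^ (m + 1) *
              ‖iteratedFDeriv ℝ (l + 1) Φ ((s * a₀ + t * a) • y + (s • k₀ + t • k))‖) := by
              rw [mul_pow]; ring
          _ ≤ _ := by gcongr
    have e5 : ‖(a • y + k) - (a₀ • y + k₀)‖ ≤ (|a - a₀| + ‖k - k₀‖) * (1 + ‖y‖) := by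
      have : (a • y + k) - (a₀ • y + k₀) = (a - a₀) • y + (k - k₀) := by rw [sub_smul]; abel
      rw [this]
      refine (norm_add_le _ _).trans ?_
      rw [norm_smul, Real.norm_eq_abs]
      nlinarith [norm_nonneg y, abs_nonneg (a - a₀), norm_nonneg (k - k₀),
        mul_nonneg (norm_nonneg (k - k₀)) (norm_nonneg y)]
    have e6 : ‖y‖ ^ m * ‖iteratedFDeriv ℝ l Φ (a • y + k)‖ ≤ B ^ K * S := by
      have h7 := one_add_norm_le_affine hδ0 ha1 hkn y
      have h8 := le_schwartzNorm (K := K + 1) (k := m) (l := l) (by omega) (by omega) Φ (a • y + k)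
      calc _ ≤ (B * (1 + ‖a • y + k‖)) ^ m * ‖iteratedFDeriv ℝ l Φ (a • y + k)‖ := by
            gcongr; linarith
        _ = B ^ m * ((1 + ‖a • y + k‖) ^ m * ‖iteratedFDeriv ℝ l Φ (a • y + k)‖) := by
            rw [mul_pow]; ring
        _ ≤ _ := by gcongr
    have e7 : ‖y‖ ^ m * ‖iteratedFDeriv ℝ l Φ (a • y + k) - iteratedFDeriv ℝ l Φ (a₀ • y + k₀)‖ ≤
        (|a - a₀| + ‖k - k₀‖) * (B ^ (K + 1) * S) := by
      calc _ ≤ (1 + ‖y‖) ^ m * ((B ^ (K + 1) * S / (1 + ‖y‖) ^ (m + 1)) *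
            ((|a - a₀| + ‖k - k₀‖) * (1 + ‖y‖))) := by
            gcongr
            · linarith
            · exact e4.trans (by gcongr)
        _ = _ := by
            have : (1 + ‖y‖) ≠ 0 := by positivity
            field_simp
            ring
    rw [e3]
    have hAl : |a₀| ^ l ≤ A ^ K :=
      (pow_le_pow_left₀ (abs_nonneg _) (by rw [hA]; linarith) l).trans
        (pow_le_pow_right₀ (by rw [hA]; linarith [abs_nonneg a₀]) hl)
    calc _ ≤ ‖y‖ ^ m * (|a ^ l - a₀ ^ l| * ‖iteratedFDeriv ℝ l Φ (a • y + k)‖ + A ^ K *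
          ‖iteratedFDeriv ℝ l Φ (a • y + k) - iteratedFDeriv ℝ l Φ (a₀ • y + k₀)‖) := by
          gcongr
          refine (norm_add_le _ _).trans ?_
          rw [norm_smul, norm_smul, norm_pow, Real.norm_eq_abs, Real.norm_eq_abs]
          gcongr
      _ = |a ^ l - a₀ ^ l| * (‖y‖ ^ m * ‖iteratedFDeriv ℝ l Φ (a • y + k)‖) + A ^ K *
          (‖y‖ ^ m * ‖iteratedFDeriv ℝ l Φ (a • y + k) - iteratedFDeriv ℝ l Φ (a₀ • y + k₀)‖) := by
          ring
      _ ≤ _ := by gcongr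
  refine squeeze_zero' (Eventually.of_forall fun _ => apply_nonneg _ _) key ?_
  have : ContinuousAt (fun q : ℝ × Rn n =>
      2 ^ K * ∑ l ∈ Finset.range (K + 1), (|q.1 ^ l - a₀ ^ l| * (B ^ K * S) +
        A ^ K * ((|q.1 - a₀| + ‖q.2 - k₀‖) * (B ^ (K + 1) * S)))) (a₀, k₀) := by fun_prop
  simpa [ContinuousAt] using this

end SchwartzSeminorms

end

section

/-! ### Distributions and integrals of families of Schwartz functions -/

section WeakIntegral

open LineDeriv

variable {n : ℕ} {α : Type*} [TopologicalSpace α] [MeasurableSpace α]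
  [BorelSpace α] {μ : Measure α}

/-- `Θ` is the integral of the continuous family `H` of Schwartz functions. -/
structure IsSchwartzIntegral (μ : Measure α) (H : α → 𝓢(Rn n, ℂ)) (Θ : 𝓢(Rn n, ℂ)) : Prop where
  continuous : Continuous H
  integrable : ∀ K, Integrable (fun y => schwartzNorm K (H y)) μ
  eq : ∀ x, Θ x = ∫ y, H y x ∂μ

theorem continuous_schwartz_eval (x : Rn n) : Continuous fun Φ : 𝓢(Rn n, ℂ) => Φ x :=
  (BoundedContinuousFunction.evalCLM ℂ x).continuous.comp
    (SchwartzMap.toBoundedContinuousFunctionCLM ℂ (Rn n) ℂ).continuous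

/-- Differentiation under the integral sign, dominated by `schwartzNorm 1`. Iterating it shows that
every norming functional sees Θ as the integral of the H y, although only pointwise values are
assumed. -/
theorem IsSchwartzIntegral.lineDeriv {H : α → 𝓢(Rn n, ℂ)} {Θ : 𝓢(Rn n, ℂ)}
    (h : IsSchwartzIntegral μ H Θ) (v : Rn n) :
    IsSchwartzIntegral μ (fun y => ∂_{v} (H y)) (∂_{v} Θ) where
  continuous := (lineDerivOpCLM ℂ 𝓢(Rn n, ℂ) v).continuous.comp h.continuous
  integrable K := by
    obtain ⟨K', C, hC, hK'⟩ := exists_le_schwartzNorm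
      ((schwartzNorm K).comp (lineDerivOpCLM ℂ 𝓢(Rn n, ℂ) v).toLinearMap)
      ((continuous_schwartzNorm K).comp (lineDerivOpCLM ℂ 𝓢(Rn n, ℂ) v).continuous)
    refine ((h.integrable K').const_mul C).mono' ?_ (Eventually.of_forall fun y => ?_)
    · exact (((continuous_schwartzNorm K).comp (lineDerivOpCLM ℂ 𝓢(Rn n, ℂ) v).continuous).comp
        h.continuous).aestronglyMeasurable
    · rw [Real.norm_of_nonneg (apply_nonneg _ _)]
      exact hK' (H y)
  eq x := by
    have key := hasDerivAt_integral_of_dominated_loc_of_deriv_le (μ := μ) (𝕜 := ℝ) (s := univ)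
      (F := fun τ y => H y (x + τ • v)) (F' := fun τ y => (∂_{v} (H y)) (x + τ • v)) (x₀ := 0)
      (bound := fun y => schwartzNorm 1 (H y) * ‖v‖) univ_mem ?_ ?_ ?_ ?_ ?_ ?_
    · have h1 := key.2
      simp only [← h.eq, zero_smul, add_zero] at h1
      have h2 : HasDerivAt (fun τ : ℝ => Θ (x + τ • v)) ((∂_{v} Θ) x) 0 := by
        rw [SchwartzMap.lineDerivOp_apply_eq_fderiv]
        have := (Θ.hasFDerivAt x).hasLineDerivAt v
        exact this
      exact h2.unique h1
    · exact Eventually.of_forall fun τ =>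
        ((continuous_schwartz_eval (x + τ • v)).comp h.continuous).aestronglyMeasurable
    · refine (h.integrable 0).mono' ?_ (Eventually.of_forall fun y => ?_)
      · exact ((continuous_schwartz_eval _).comp h.continuous).aestronglyMeasurable
      · simpa using norm_le_schwartzNorm 0 (H y) (x + (0 : ℝ) • v)
    · exact ((continuous_schwartz_eval _).comp
        ((lineDerivOpCLM ℂ 𝓢(Rn n, ℂ) v).continuous.comp h.continuous)).aestronglyMeasurable
    · refine Eventually.of_forall fun y τ _ => ?_
      rw [SchwartzMap.lineDerivOp_apply_eq_fderiv]
      refine (ContinuousLinearMap.le_opNorm _ _).trans ?_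
      gcongr
      have := le_schwartzNorm (K := 1) (k := 0) (l := 1) (by simp) le_rfl (H y) (x + τ • v)
      rw [norm_iteratedFDeriv_one] at this
      simpa using this
    · exact (h.integrable 1).mul_const _
    · refine Eventually.of_forall fun y τ _ => ?_
      rw [SchwartzMap.lineDerivOp_apply_eq_fderiv]
      have h1 : HasDerivAt (fun τ : ℝ => x + τ • v) v τ := by
        simpa using ((hasDerivAt_id τ).smul_const v).const_add x
      exact ((H y).hasFDerivAt (x + τ • v)).comp_hasDerivAt τ h1

theorem IsSchwartzIntegral.iteratedLineDeriv {H : α → 𝓢(Rn n, ℂ)} {Θ : 𝓢(Rn n, ℂ)}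
    (h : IsSchwartzIntegral μ H Θ) {l : ℕ} (m : Fin l → Rn n) :
    IsSchwartzIntegral μ (fun y => ∂^{m} (H y)) (∂^{m} Θ) := by
  induction l with
  | zero => simpa using h
  | succ l ih =>
    simp only [iteratedLineDerivOp_succ_left]
    exact (ih (Fin.tail m)).lineDeriv (m 0)

/-- The indices of a norming family of functionals for `schwartzNorm K`. -/
def NormingIndex (n K : ℕ) : Type := Fin (K + 1) × Fin (K + 1) × Rn n × (ℕ → Rn n)

/-- With the discrete topology the bounded continuous functions on the index set are all bounded
functions, a Banach space in which Bochner integrals are available. -/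
instance (n K : ℕ) : TopologicalSpace (NormingIndex n K) := ⊥

instance (n K : ℕ) : DiscreteTopology (NormingIndex n K) := ⟨rfl⟩

/-- The norming functionals for `schwartzNorm K`. -/
def normingEval (K : ℕ) (i : NormingIndex n K) (Φ : 𝓢(Rn n, ℂ)) : ℂ :=
  ((‖i.2.2.1‖ ^ (i.1 : ℕ) / ∏ j : Fin i.2.1, ‖i.2.2.2 j‖ : ℝ) : ℂ) *
    (∂^{fun j : Fin i.2.1 => i.2.2.2 j} Φ) i.2.2.1

theorem norm_normingEval_le (K : ℕ) (i : NormingIndex n K) (Φ : 𝓢(Rn n, ℂ)) :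
    ‖normingEval K i Φ‖ ≤ schwartzNorm K Φ := by
  obtain ⟨k, l, x, m⟩ := i
  simp only [normingEval]
  rw [SchwartzMap.iteratedLineDerivOp_eq_iteratedFDeriv, norm_mul, Complex.norm_real,
    Real.norm_of_nonneg (by positivity)]
  set P := ∏ j : Fin (l : ℕ), ‖m j‖ with hP
  have hP0 : 0 ≤ P := by positivity
  have h1 : ‖iteratedFDeriv ℝ l Φ x fun j => m j‖ ≤ ‖iteratedFDeriv ℝ l Φ x‖ * P :=
    ContinuousMultilinearMap.le_opNorm _ _
  -- If some direction vanishes then P = 0 and division by zero makes the functional 0, which is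
  -- harmless.
  have h2 : P / P ≤ 1 := div_self_le_one P
  calc _ ≤ ‖x‖ ^ (k : ℕ) / P * (‖iteratedFDeriv ℝ l Φ x‖ * P) := by gcongr
    _ = ‖x‖ ^ (k : ℕ) * ‖iteratedFDeriv ℝ l Φ x‖ * (P / P) := by ring
    _ ≤ ‖x‖ ^ (k : ℕ) * ‖iteratedFDeriv ℝ l Φ x‖ * 1 := by gcongr
    _ ≤ (1 + ‖x‖) ^ (k : ℕ) * ‖iteratedFDeriv ℝ l Φ x‖ := by
      rw [mul_one]; gcongr; linarith
    _ ≤ _ := le_schwartzNorm (Fin.is_le k) (Fin.is_le l) Φ x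

/-- The norming functionals, as a map to the space of bounded functions. -/
def normingMap (K : ℕ) : 𝓢(Rn n, ℂ) →ₗ[ℂ] BoundedContinuousFunction (NormingIndex n K) ℂ where
  toFun Φ := BoundedContinuousFunction.ofNormedAddCommGroupDiscrete (fun i => normingEval K i Φ)
    (schwartzNorm K Φ) fun i => norm_normingEval_le K i Φ
  map_add' Φ Ψ := by
    ext i
    simp [normingEval, iteratedLineDerivOp_add, mul_add]
  map_smul' c Φ := by
    ext i
    simp [normingEval, iteratedLineDerivOp_smul, mul_left_comm]

theorem norm_normingMap_le (K : ℕ) (Φ : 𝓢(Rn n, ℂ)) : ‖normingMap K Φ‖ ≤ schwartzNorm K Φ :=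
  (BoundedContinuousFunction.norm_le (apply_nonneg _ _)).2 fun i => norm_normingEval_le K i Φ

/-- Taking suprema over points and directions recovers the operator norms of the derivatives. A
functional bounded by `schwartzNorm K` thus factors boundedly through the Banach space of values. -/
theorem schwartzNorm_le_normingMap (K : ℕ) (Φ : 𝓢(Rn n, ℂ)) :
    schwartzNorm K Φ ≤ 2 ^ K * ‖normingMap K Φ‖ := by
  have hA0 : 0 ≤ ‖normingMap K Φ‖ := norm_nonneg _
  have hA : ∀ i, ‖normingEval K i Φ‖ ≤ ‖normingMap K Φ‖ := (normingMap K Φ).norm_coe_le_norm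
  generalize ‖normingMap K Φ‖ = A at hA0 hA
  refine schwartzNorm_le hA0 fun k hk l hl x => ?_
  by_cases hx : ‖x‖ ^ k = 0
  · rw [hx, zero_mul]; exact hA0
  have hx' : 0 < ‖x‖ ^ k := lt_of_le_of_ne (by positivity) (Ne.symm hx)
  rw [mul_comm, ← le_div_iff₀ hx']
  refine ContinuousMultilinearMap.opNorm_le_bound (div_nonneg hA0 hx'.le) fun m => ?_
  by_cases hm : ∏ j, ‖m j‖ = 0
  · obtain ⟨j, -, hj⟩ := Finset.prod_eq_zero_iff.1 hm
    rw [ContinuousMultilinearMap.map_coord_zero _ j (norm_eq_zero.1 hj), norm_zero]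
    exact mul_nonneg (div_nonneg hA0 hx'.le) (Finset.prod_nonneg fun _ _ => norm_nonneg _)
  have hm' : 0 < ∏ j, ‖m j‖ :=
    lt_of_le_of_ne (Finset.prod_nonneg fun _ _ => norm_nonneg _) (Ne.symm hm)
  -- The index stores an infinite sequence so that its type does not depend on l; the padding is
  -- never read.
  let m' : ℕ → Rn n := fun j => if h : j < l then m ⟨j, h⟩ else 0
  have hm''' : ∀ j : Fin l, m' j = m j := fun j => by simp [m']
  have hm'' : (fun j : Fin l => m' j) = m := funext hm'''
  have h1 : ‖normingEval K (⟨k, by omega⟩, ⟨l, by omega⟩, x, m') Φ‖ ≤ A := hA _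
  have h2 : normingEval K (⟨k, by omega⟩, ⟨l, by omega⟩, x, m') Φ =
      ((‖x‖ ^ k / ∏ j : Fin l, ‖m' j‖ : ℝ) : ℂ) * (∂^{fun j : Fin l => m' j} Φ) x := rfl
  rw [SchwartzMap.iteratedLineDerivOp_eq_iteratedFDeriv, hm''] at h2
  simp only [hm'''] at h2
  rw [h2, norm_mul, Complex.norm_real, Real.norm_of_nonneg (div_nonneg hx'.le hm'.le)] at h1
  rw [div_mul_eq_mul_div, le_div_iff₀ hx']
  rw [div_mul_eq_mul_div, div_le_iff₀ hm'] at h1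
  linarith

/-- A tempered distribution commutes with the integral of a continuous family of Schwartz
functions. -/
theorem IsSchwartzIntegral.apply_eq [SecondCountableTopology α] {H : α → 𝓢(Rn n, ℂ)} {Θ : 𝓢(Rn n, ℂ)}
    (h : IsSchwartzIntegral μ H Θ) (f : 𝓢'(Rn n, ℂ)) : f Θ = ∫ y, f (H y) ∂μ := by
  obtain ⟨K, C, hC, hf⟩ := exists_norm_apply_le f
  -- Being of order K, f descends to a bounded functional on the range of `normingMap K`;
  -- Hahn–Banach extends it to the whole Banach space, where it commutes with the Bochner integral.
  -- That the integral is the image of Θ is checked coordinate by coordinate.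
  have hker : LinearMap.ker (normingMap (n := n) K) ≤ LinearMap.ker f.toLinearMap := by
    intro Φ hΦ
    have h1 := schwartzNorm_le_normingMap K Φ
    rw [LinearMap.mem_ker.1 hΦ, norm_zero, mul_zero] at h1
    have h2 := (hf Φ).trans (mul_nonpos_of_nonneg_of_nonpos hC h1)
    exact norm_le_zero_iff.1 h2
  let g : LinearMap.range (normingMap (n := n) K) →ₗ[ℂ] ℂ :=
    (LinearMap.ker (normingMap (n := n) K)).liftQ f.toLinearMap hker ∘ₗ
      (normingMap (n := n) K).quotKerEquivRange.symm.toLinearMap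
  have hg : ∀ Φ, g ⟨normingMap K Φ, LinearMap.mem_range_self _ Φ⟩ = f Φ := by
    intro Φ
    have : (normingMap (n := n) K).quotKerEquivRange.symm
        ⟨normingMap K Φ, LinearMap.mem_range_self _ Φ⟩ = Submodule.Quotient.mk Φ := by
      rw [LinearEquiv.symm_apply_eq]; rfl
    simp only [g, LinearMap.comp_apply, LinearEquiv.coe_coe, this]
    rfl
  have hgb : ∀ w, ‖g w‖ ≤ C * 2 ^ K * ‖w‖ := by
    rintro ⟨_, Φ, rfl⟩
    rw [hg]
    calc ‖f Φ‖ ≤ C * schwartzNorm K Φ := hf Φ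
      _ ≤ C * (2 ^ K * ‖normingMap K Φ‖) := by gcongr; exact schwartzNorm_le_normingMap K Φ
      _ = _ := by rw [mul_assoc]; rfl
  obtain ⟨G, hG, -⟩ := exists_extension_norm_eq _ (g.mkContinuous _ hgb)
  have hGf : ∀ Φ, G (normingMap K Φ) = f Φ := fun Φ => by
    rw [← hg Φ]; exact hG ⟨normingMap K Φ, LinearMap.mem_range_self _ Φ⟩
  have hcont : Continuous fun y => normingMap K (H y) := by
    have : Continuous (normingMap (n := n) K) := by
      refine continuous_iff_continuousAt.2 fun Φ => ?_
      rw [ContinuousAt, tendsto_iff_norm_sub_tendsto_zero]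
      have h1 : Tendsto (fun Ψ => schwartzNorm K (Ψ - Φ)) (𝓝 Φ) (𝓝 0) := by
        have := ((continuous_schwartzNorm (n := n) K).comp (continuous_sub_right Φ)).tendsto Φ
        rwa [Function.comp_apply, sub_self, map_zero] at this
      refine squeeze_zero (fun _ => norm_nonneg _) (fun Ψ => ?_) h1
      rw [← map_sub]
      exact norm_normingMap_le K _
    exact this.comp h.continuous
  have hint : Integrable (fun y => normingMap K (H y)) μ :=
    (h.integrable K).mono' hcont.aestronglyMeasurable
      (Eventually.of_forall fun y => norm_normingMap_le K (H y))
  have hΘ : normingMap K Θ = ∫ y, normingMap K (H y) ∂μ := by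
    ext i
    have h1 := (BoundedContinuousFunction.evalCLM ℂ i).integral_comp_comm hint
    have h2 : (∫ y, normingMap K (H y) ∂μ) i = ∫ y, normingEval K i (H y) ∂μ := h1.symm
    rw [h2]
    change normingEval K i Θ = _
    simp only [normingEval]
    rw [(h.iteratedLineDeriv fun j : Fin i.2.1 => i.2.2.2 j).eq, ← integral_const_mul]
  rw [← hGf, hΘ, ← G.integral_comp_comm hint]
  simp only [hGf]

end WeakIntegral

end

section

/-! ### Completeness of the Schwartz space -/

section Completeness

variable {n : ℕ}

/-- The j-th term is small in a seminorm of order N + j ≥ N, so all weighted derivatives up to order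
N are dominated by one geometric series and can be summed termwise. -/
theorem contDiff_tsum_schwartz {g : ℕ → 𝓢(Rn n, ℂ)} {N l : ℕ} (hl : l ≤ N)
    (hg : ∀ j, schwartzNorm (N + j) (g j) ≤ (1 / 2) ^ (N + j)) :
    ContDiff ℝ l (fun x => ∑' j, g j x) ∧ ∀ k ≤ N, ∀ x,
      ‖x‖ ^ k * ‖iteratedFDeriv ℝ l (fun x => ∑' j, g j x) x‖ ≤ 2 * (1 / 2) ^ N := by
  have hsum : HasSum (fun j : ℕ => ((1 : ℝ) / 2) ^ (N + j)) (2 * (1 / 2) ^ N) := by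
    have := (hasSum_geometric_two).mul_left (((1 : ℝ) / 2) ^ N)
    simpa [pow_add, mul_comm] using this
  have hbd : ∀ (k : ℕ), k ≤ N → ∀ m ≤ N, ∀ j x,
      ‖x‖ ^ k * ‖iteratedFDeriv ℝ m (g j) x‖ ≤ (1 / 2) ^ (N + j) := by
    intro k hk m hm j x
    refine le_trans ?_ ((le_schwartzNorm (K := N + j) (k := k) (l := m) (by omega) (by omega)
      (g j) x).trans (hg j))
    gcongr; linarith
  have hbd0 : ∀ (m : ℕ) (j : ℕ) (x : Rn n), (m : ℕ∞) ≤ (l : ℕ∞) →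
      ‖iteratedFDeriv ℝ m (g j) x‖ ≤ (1 / 2) ^ (N + j) := by
    intro m j x hm
    simpa using hbd 0 (Nat.zero_le _) m ((Nat.cast_le.1 hm).trans hl) j x
  have hs : ∀ j, ContDiff ℝ ((l : ℕ∞) : WithTop ℕ∞) (g j) := fun j => (g j).smooth l
  refine ⟨contDiff_tsum (N := (l : ℕ∞)) hs (fun _ _ => hsum.summable) hbd0, fun k hk x => ?_⟩
  rw [iteratedFDeriv_tsum_apply (N := (l : ℕ∞)) hs (fun _ _ => hsum.summable) hbd0 le_rfl]
  have h1 : ‖∑' j, (‖x‖ ^ k) • iteratedFDeriv ℝ l (g j) x‖ ≤ 2 * (1 / 2) ^ N := by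
    refine tsum_of_norm_bounded hsum fun j => ?_
    rw [norm_smul, norm_pow, norm_norm]
    exact hbd k hk l hl j x
  have hsm : Summable fun j => iteratedFDeriv ℝ l (g j) x :=
    Summable.of_norm_bounded hsum.summable fun j => hbd0 l j x le_rfl
  rwa [hsm.tsum_const_smul, norm_smul, norm_pow, norm_norm] at h1

instance isCountablyGenerated_uniformity_schwartz : (uniformity 𝓢(Rn n, ℂ)).IsCountablyGenerated :=
  IsUniformAddGroup.uniformity_countably_generated

/-- Together with the countably generated uniformity this gives the Baire property and hence
barrelledness, needed for the uniform boundedness argument on bounded distributions. -/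
instance completeSpace_schwartz : CompleteSpace 𝓢(Rn n, ℂ) := by
  refine UniformSpace.complete_of_convergent_controlled_sequences
    (fun N => {q | schwartzNorm N (q.2 - q.1) < (1 / 2) ^ N}) (fun N => ?_) fun u hu => ?_
  · rw [uniformity_eq_comap_nhds_zero]
    refine ⟨{Φ | schwartzNorm N Φ < (1 / 2) ^ N}, ?_, fun q hq => hq⟩
    exact (continuous_schwartzNorm N).continuousAt.eventually_lt continuousAt_const (by simp)
  · set g : ℕ → 𝓢(Rn n, ℂ) := fun j => u (j + 1) - u j with hg
    have hgb : ∀ N j, schwartzNorm (N + j) (g (N + j)) ≤ (1 / 2) ^ (N + j) := fun N j =>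
      (hu (N + j) (N + j) (N + j + 1) le_rfl (Nat.le_succ _)).le
    have hsm : ∀ x, Summable fun j => g j x := fun x => by
      refine Summable.of_norm_bounded (g := fun j => ((1 : ℝ) / 2) ^ j)
        (summable_geometric_two) fun j => ?_
      have h0 := hgb 0 j
      rw [zero_add] at h0
      have := (norm_le_schwartzNorm j (g j) x).trans h0
      refine le_trans (le_mul_of_one_le_left (norm_nonneg _) ?_) this
      exact one_le_pow₀ (by linarith [norm_nonneg x])
    -- The series started at 0 is not controlled to high order; restarting it at N gives control of
    -- all derivatives up to order N.
    have htel : ∀ N x, u 0 x + ∑' j, g j x = u N x + ∑' j, g (N + j) x := by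
      intro N x
      rw [← (hsm x).sum_add_tsum_nat_add N]
      have : ∑ i ∈ Finset.range N, g i x = u N x - u 0 x :=
        Finset.sum_range_sub (fun i => u i x) N
      rw [this]
      simp only [add_comm N]
      ring
    have hR : ∀ N l, l ≤ N → _ := fun N l hl =>
      contDiff_tsum_schwartz (g := fun j => g (N + j)) hl (hgb N)
    let Φ : 𝓢(Rn n, ℂ) :=
      { toFun := fun x => u 0 x + ∑' j, g j x
        smooth' := by
          refine contDiff_infty.2 fun l => ?_
          have : (fun x => u 0 x + ∑' j, g j x) = fun x => u l x + ∑' j, g (l + j) x :=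
            funext (htel l)
          rw [this]
          exact ((u l).smooth l).add (hR l l le_rfl).1
        decay' := by
          intro k l
          obtain ⟨N, hkN, hlN⟩ : ∃ N, k ≤ N ∧ l ≤ N := ⟨max k l, le_max_left _ _, le_max_right _ _⟩
          have : (fun x => u 0 x + ∑' j, g j x) = (u N : Rn n → ℂ) + fun x => ∑' j, g (N + j) x :=
            funext (htel N)
          rw [this]
          refine ⟨schwartzNorm N (u N) + 2 * (1 / 2) ^ N, fun x => ?_⟩
          rw [iteratedFDeriv_add_apply ((u N).contDiffAt l) (hR N l hlN).1.contDiffAt]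
          have h1 := (hR N l hlN).2 k hkN x
          have h2 : ‖x‖ ^ k * ‖iteratedFDeriv ℝ l (u N) x‖ ≤ schwartzNorm N (u N) := by
            refine le_trans ?_ (le_schwartzNorm hkN hlN (u N) x)
            gcongr; linarith
          calc _ ≤ ‖x‖ ^ k * (‖iteratedFDeriv ℝ l (u N) x‖ +
                ‖iteratedFDeriv ℝ l (fun x => ∑' j, g (N + j) x) x‖) := by
                gcongr; exact norm_add_le _ _
            _ ≤ _ := by rw [mul_add]; exact add_le_add h2 h1 }
    refine ⟨Φ, tendsto_schwartz_of_schwartzNorm fun K => ?_⟩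
    have hle : ∀ᶠ N in atTop, schwartzNorm K (u N - Φ) ≤ 2 ^ K * (2 * (1 / 2) ^ N) := by
      filter_upwards [eventually_ge_atTop K] with N hN
      rw [← map_neg_eq_map, neg_sub]
      have hc : ((Φ - u N : 𝓢(Rn n, ℂ)) : Rn n → ℂ) = fun x => ∑' j, g (N + j) x := by
        ext x
        change u 0 x + ∑' j, g j x - u N x = _
        rw [htel N x]; ring
      refine schwartzNorm_le (by positivity) fun k hk l hl x => ?_
      rw [hc]
      exact (hR N l (hl.trans hN)).2 k (hk.trans hN) x
    refine squeeze_zero' (Eventually.of_forall fun _ => apply_nonneg _ _) hle ?_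
    have := ((tendsto_pow_atTop_nhds_zero_of_lt_one (r := (1 / 2 : ℝ)) (by norm_num)
      (by norm_num)).const_mul 2).const_mul ((2 : ℝ) ^ K)
    simpa using this

end Completeness

/-! ### Convolution of distributions with Schwartz functions -/

section Convolution

variable {n : ℕ}

theorem reflectTranslate_eq_affine (x : Rn n) (Φ : 𝓢(Rn n, ℂ)) :
    reflectTranslate x Φ = affine (-1) x Φ := by
  ext y
  rw [affine_apply (by norm_num), reflectTranslate_apply]
  congr 1
  rw [neg_one_smul]; abel

theorem continuous_reflectTranslate (Φ : 𝓢(Rn n, ℂ)) : Continuous fun x => reflectTranslate x Φ := by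
  simp only [reflectTranslate_eq_affine]
  refine continuous_iff_continuousAt.2 fun x => ?_
  exact (continuousAt_affine Φ (q₀ := (-1, x)) (by norm_num)).comp (f := fun x : Rn n => ((-1 : ℝ), x))
    (by fun_prop)

theorem continuous_conv (f : 𝓢'(Rn n, ℂ)) (Φ : 𝓢(Rn n, ℂ)) : Continuous (conv f Φ) :=
  f.cont.comp (continuous_reflectTranslate Φ)

theorem schwartzNorm_reflectTranslate_le (K : ℕ) (Φ : 𝓢(Rn n, ℂ)) (x : Rn n) :
    schwartzNorm K (reflectTranslate x Φ) ≤ 4 ^ K * schwartzNorm K Φ * (1 + ‖x‖) ^ K := by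
  rw [reflectTranslate_eq_affine]
  refine (schwartzNorm_affine_le (δ := 1) (A := 1) one_pos (by simp) (by simp) le_rfl (le_refl ‖x‖)
    K Φ).trans (le_of_eq ?_)
  rw [mul_pow, show (4 : ℝ) = 2 * 2 by norm_num, mul_pow]
  norm_num
  ring

/-- K is the order of f and serves all Φ at once, so that one growth space contains every f * Φ. -/
theorem exists_conv_growth (f : 𝓢'(Rn n, ℂ)) : ∃ K : ℕ, ∃ C : ℝ, 0 ≤ C ∧ ∀ Φ x,
    ‖conv f Φ x‖ ≤ C * schwartzNorm K Φ * (1 + ‖x‖) ^ K := by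
  obtain ⟨K, C, hC, h⟩ := exists_norm_apply_le f
  refine ⟨K, C * 4 ^ K, by positivity, fun Φ x => (h _).trans ?_⟩
  calc _ ≤ C * (4 ^ K * schwartzNorm K Φ * (1 + ‖x‖) ^ K) := by
        gcongr; exact schwartzNorm_reflectTranslate_le K Φ x
    _ = _ := by ring

theorem integrable_one_add_norm_rpow_neg {L : ℝ} (hL : (n : ℝ) < L) :
    Integrable fun y : Rn n => (1 + ‖y‖) ^ (-L) :=
  integrable_one_add_norm (by simpa using hL)

theorem integrable_schwartz_mul_rpow (Φ : 𝓢(Rn n, ℂ)) (R : ℝ) :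
    Integrable fun y : Rn n => ‖Φ y‖ * (1 + ‖y‖) ^ R := by
  obtain ⟨K, hK⟩ := exists_nat_ge (R + (n + 1))
  refine ((integrable_one_add_norm_rpow_neg (n := n) (L := n + 1) (by linarith)).const_mul
    (schwartzNorm K Φ)).mono' ?_ (Eventually.of_forall fun y => ?_)
  · refine Continuous.aestronglyMeasurable (Φ.continuous.norm.mul ?_)
    refine Continuous.rpow_const (by fun_prop) fun y => Or.inl ?_
    positivity
  · have h1 : (0 : ℝ) < 1 + ‖y‖ := by positivity
    rw [Real.norm_of_nonneg (by positivity)]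
    have h2 := norm_le_schwartzNorm K Φ y
    have h3 : (1 + ‖y‖) ^ R ≤ (1 + ‖y‖) ^ K * (1 + ‖y‖) ^ (-((n : ℝ) + 1)) := by
      rw [← Real.rpow_natCast, ← Real.rpow_add h1]
      exact Real.rpow_le_rpow_of_exponent_le (by linarith [norm_nonneg y]) (by linarith)
    calc _ ≤ ‖Φ y‖ * ((1 + ‖y‖) ^ K * (1 + ‖y‖) ^ (-((n : ℝ) + 1))) := by gcongr
      _ = ((1 + ‖y‖) ^ K * ‖Φ y‖) * (1 + ‖y‖) ^ (-((n : ℝ) + 1)) := by ring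
      _ ≤ _ := by gcongr

/-- The convolution Θ is left as a hypothesis so that the same exchange of f and the integral serves
both the abstract convolution of Schwartz functions and the explicit convolution of two Gaussians.
-/
theorem integral_conv_mul (f : 𝓢'(Rn n, ℂ)) (Φ Ψ Θ : 𝓢(Rn n, ℂ)) (x : Rn n)
    (hΘ : ∀ z, Θ z = ∫ y, Φ y * Ψ (x - y - z)) : ∫ y, conv f Ψ (x - y) * Φ y = f Θ := by
  have hc : Continuous fun y => Φ y • reflectTranslate (x - y) Ψ :=
    Φ.continuous.smul ((continuous_reflectTranslate Ψ).comp (by fun_prop))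
  have h : IsSchwartzIntegral volume (fun y => Φ y • reflectTranslate (x - y) Ψ) Θ := by
    refine ⟨hc, fun K => ?_, fun z => ?_⟩
    · refine ((integrable_schwartz_mul_rpow Φ K).const_mul
        (4 ^ K * schwartzNorm K Ψ * (1 + ‖x‖) ^ K)).mono'
        ((continuous_schwartzNorm K).comp hc).aestronglyMeasurable
        (Eventually.of_forall fun y => ?_)
      rw [Real.norm_of_nonneg (apply_nonneg _ _), map_smul_eq_mul, Real.rpow_natCast]
      have h1 : 1 + ‖x - y‖ ≤ (1 + ‖x‖) * (1 + ‖y‖) := by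
        have := norm_sub_le x y
        nlinarith [norm_nonneg x, norm_nonneg y, mul_nonneg (norm_nonneg x) (norm_nonneg y)]
      calc _ ≤ ‖Φ y‖ * (4 ^ K * schwartzNorm K Ψ * (1 + ‖x - y‖) ^ K) := by
            gcongr; exact schwartzNorm_reflectTranslate_le K Ψ _
        _ ≤ ‖Φ y‖ * (4 ^ K * schwartzNorm K Ψ * ((1 + ‖x‖) * (1 + ‖y‖)) ^ K) := by gcongr
        _ = _ := by rw [mul_pow]; ring
    · simpa using hΘ z
  rw [h.apply_eq f]
  simp only [map_smul, smul_eq_mul, conv, mul_comm]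

/-- `(f * Ψ) * Φ = (f * Φ) * Ψ`. -/
theorem integral_conv_comm (f : 𝓢'(Rn n, ℂ)) (Φ Ψ : 𝓢(Rn n, ℂ)) (x : Rn n) :
    ∫ y, conv f Ψ (x - y) * Φ y = ∫ y, conv f Φ (x - y) * Ψ y := by
  have h1 : ∀ z, reflectTranslate x (SchwartzMap.convolution (ContinuousLinearMap.mul ℂ ℂ) Φ Ψ) z =
      ∫ y, Φ y * Ψ (x - y - z) := by
    intro z
    rw [reflectTranslate_apply, SchwartzMap.convolution_apply]
    simp only [MeasureTheory.convolution, ContinuousLinearMap.mul_apply']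
    congr 1; ext y; congr 2; abel
  rw [integral_conv_mul f Φ Ψ _ x h1, integral_conv_mul f Ψ Φ _ x fun z => ?_]
  rw [h1, ← integral_sub_left_eq_self _ volume (x - z)]
  congr 1; ext y
  rw [mul_comm]
  congr 2 <;> abel

theorem conv_dilate_eq (f : 𝓢'(Rn n, ℂ)) {t : ℝ} (ht : 0 < t) (Φ : 𝓢(Rn n, ℂ)) (x : Rn n) :
    conv f (dilate t ht Φ) x = (((t ^ n)⁻¹ : ℝ) : ℂ) * f (affine (-t⁻¹) (t⁻¹ • x) Φ) := by
  have : reflectTranslate x (dilate t ht Φ) = (((t ^ n)⁻¹ : ℝ) : ℂ) • affine (-t⁻¹) (t⁻¹ • x) Φ := by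
    ext y
    have ht' : -t⁻¹ ≠ 0 := by simpa using ht.ne'
    rw [reflectTranslate_apply, dilate_apply, smul_apply, affine_apply ht', smul_eq_mul]
    congr 2
    rw [smul_sub, neg_smul]; abel
  rw [conv, this, map_smul, smul_eq_mul]

/-- The bound of a bounded distribution is uniform on bounded sets of Schwartz functions. -/
theorem IsBoundedDistribution.exists_bound {f : 𝓢'(Rn n, ℂ)} (hf : IsBoundedDistribution f) :
    ∃ K : ℕ, ∃ C : ℝ, 0 ≤ C ∧ ∀ Φ x, ‖conv f Φ x‖ ≤ C * schwartzNorm K Φ := by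
  let L : Rn n → 𝓢(Rn n, ℂ) →ₗ[ℂ] ℂ := fun x =>
    f.toLinearMap ∘ₗ (SchwartzMap.compSubConstCLM ℂ x).toLinearMap ∘ₗ
      (SchwartzMap.compCLMOfContinuousLinearEquiv ℂ (ContinuousLinearEquiv.neg ℝ)).toLinearMap
  have hL : ∀ x Φ, L x Φ = conv f Φ x := fun _ _ => rfl
  have hLc : ∀ x, Continuous (L x) := fun x => f.cont.comp
    ((SchwartzMap.compSubConstCLM ℂ x).continuous.comp
      (SchwartzMap.compCLMOfContinuousLinearEquiv ℂ (ContinuousLinearEquiv.neg ℝ)).continuous)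
  -- Banach–Steinhaus: these continuous seminorms are pointwise bounded in x, so on a barrelled
  -- space their supremum is continuous.
  let q : Rn n → Seminorm ℂ 𝓢(Rn n, ℂ) := fun x => (normSeminorm ℂ ℂ).comp (L x)
  have hbdd : BddAbove (range q) := by
    rw [Seminorm.bddAbove_range_iff]
    intro Φ
    have h1 := (hf Φ).2
    refine ⟨(eLpNorm (conv f Φ) ∞ volume).toReal, ?_⟩
    rintro _ ⟨x, rfl⟩
    change ‖conv f Φ x‖ ≤ _
    -- The exceptional set is open and null, hence empty: the essential bound holds at every point.
    have hopen : IsOpen {x | (eLpNorm (conv f Φ) ∞ volume).toReal < ‖conv f Φ x‖} :=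
      isOpen_lt continuous_const (continuous_conv f Φ).norm
    have hz : volume {x | (eLpNorm (conv f Φ) ∞ volume).toReal < ‖conv f Φ x‖} = 0 := by
      have := ae_le_eLpNormEssSup (f := conv f Φ) (μ := volume)
      rw [← eLpNorm_exponent_top] at this
      refine measure_mono_null (fun x hx => ?_) this
      simp only [mem_ofPred_eq, mem_compl_iff, not_le] at hx ⊢
      rw [← ofReal_norm]
      exact (ENNReal.lt_ofReal_iff_toReal_lt h1.ne).2 hx
    rw [hopen.measure_eq_zero_iff volume] at hz
    by_contra hcon
    exact (hz ▸ (not_le.1 hcon : x ∈ {x | (eLpNorm (conv f Φ) ∞ volume).toReal < ‖conv f Φ x‖}) :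
      x ∈ (∅ : Set (Rn n)))
  have hcont : Continuous (⨆ x, q x : Seminorm ℂ 𝓢(Rn n, ℂ)) := by
    rw [Seminorm.coe_iSup_eq hbdd]
    exact Seminorm.continuous_iSup q (fun x => continuous_norm.comp (hLc x)) hbdd
  obtain ⟨K, C, hC, h⟩ := exists_le_schwartzNorm _ hcont
  refine ⟨K, C, hC, fun Φ x => le_trans ?_ (h Φ)⟩
  rw [Seminorm.iSup_apply hbdd]
  exact le_ciSup (f := fun x => q x Φ) (Seminorm.bddAbove_range_iff.1 hbdd Φ) x

end Convolution

end

section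

/-! ### Averaging operators and the gain from differences -/

section Averages

variable {n : ℕ}

/-- Peetre's inequality; with |κ| on the second factor it covers both growth (κ ≥ 0) and decay (κ ≤
0). -/
theorem one_add_norm_rpow_sub_le (κ : ℝ) (x z : Rn n) :
    (1 + ‖x - z‖) ^ κ ≤ (1 + ‖x‖) ^ κ * (1 + ‖z‖) ^ |κ| := by
  have hx : 0 < 1 + ‖x‖ := by positivity
  have hz : 0 < 1 + ‖z‖ := by positivity
  have hxz : 0 < 1 + ‖x - z‖ := by positivity
  rcases le_total 0 κ with h | h
  · rw [abs_of_nonneg h, ← Real.mul_rpow hx.le hz.le]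
    refine Real.rpow_le_rpow hxz.le ?_ h
    nlinarith [norm_sub_le x z, norm_nonneg x, norm_nonneg z,
      mul_nonneg (norm_nonneg x) (norm_nonneg z)]
  · rw [abs_of_nonpos h, Real.rpow_neg hz.le, ← div_eq_mul_inv, ← Real.div_rpow hx.le hz.le]
    refine Real.rpow_le_rpow_of_nonpos (by positivity) ?_ h
    rw [div_le_iff₀ hz]
    have h1 : ‖x‖ ≤ ‖x - z‖ + ‖z‖ := by simpa using norm_add_le (x - z) z
    nlinarith [norm_nonneg (x - z), norm_nonneg z, mul_nonneg (norm_nonneg (x - z)) (norm_nonneg z)]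

theorem one_add_norm_rpow_sub_smul_le (κ : ℝ) (x w : Rn n) {s : ℝ} (hs : 0 ≤ s) (hs1 : s ≤ 1) :
    (1 + ‖x - s • w‖) ^ κ ≤ (1 + ‖x‖) ^ κ * (1 + ‖w‖) ^ |κ| := by
  refine (one_add_norm_rpow_sub_le κ x (s • w)).trans ?_
  gcongr
  rw [norm_smul, Real.norm_of_nonneg hs]
  exact mul_le_of_le_one_left (norm_nonneg _) hs1

theorem continuous_one_add_norm_rpow (κ : ℝ) : Continuous fun x : Rn n => (1 + ‖x‖) ^ κ :=
  Continuous.rpow_const (by fun_prop) fun y => Or.inl (by positivity)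

/-- An averaging kernel with moments of order `R`. -/
structure AvgKernel (n : ℕ) (R : ℝ) where
  /-- The kernel. -/
  toFun : Rn n → ℂ
  continuous : Continuous toFun
  integrable : Integrable fun w => ‖toFun w‖ * (1 + ‖w‖) ^ R
  integral_eq_one : ∫ w, toFun w = 1

/-- The average `∫ B(w) θ(x - s w) dw`. -/
def avg (B : Rn n → ℂ) (s : ℝ) (θ : Rn n → ℂ) (x : Rn n) : ℂ := ∫ w, B w * θ (x - s • w)

/-- The moment `∫ |B(w)| (1 + |w|) ^ ρ dw`. -/
def absMoment (B : Rn n → ℂ) (ρ : ℝ) : ℝ := ∫ w, ‖B w‖ * (1 + ‖w‖) ^ ρ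

theorem absMoment_nonneg (B : Rn n → ℂ) (ρ : ℝ) : 0 ≤ absMoment B ρ :=
  integral_nonneg fun w => by positivity

variable {R : ℝ}

theorem AvgKernel.integrable_mul_rpow (B : AvgKernel n R) {ρ : ℝ} (hρ : ρ ≤ R) :
    Integrable fun w => ‖B.toFun w‖ * (1 + ‖w‖) ^ ρ := by
  refine B.integrable.mono' ?_ (Eventually.of_forall fun w => ?_)
  · exact (B.continuous.norm.mul (continuous_one_add_norm_rpow ρ)).aestronglyMeasurable
  · rw [Real.norm_of_nonneg (by positivity)]
    gcongr
    linarith [norm_nonneg w]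

theorem AvgKernel.norm_mul_le (B : AvgKernel n R) {κ a s : ℝ} (hs : 0 ≤ s) (hs1 : s ≤ 1)
    {θ : Rn n → ℂ} (hθ : ∀ x, ‖θ x‖ ≤ a * (1 + ‖x‖) ^ κ) (x w : Rn n) :
    ‖B.toFun w * θ (x - s • w)‖ ≤ a * (1 + ‖x‖) ^ κ * (‖B.toFun w‖ * (1 + ‖w‖) ^ |κ|) := by
  have ha : 0 ≤ a := by
    have := (norm_nonneg _).trans (hθ 0)
    simpa using this
  rw [norm_mul]
  calc _ ≤ ‖B.toFun w‖ * (a * ((1 + ‖x‖) ^ κ * (1 + ‖w‖) ^ |κ|)) := by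
        gcongr
        refine (hθ _).trans ?_
        gcongr
        exact one_add_norm_rpow_sub_smul_le κ x w hs hs1
    _ = _ := by ring

theorem AvgKernel.integrable_mul (B : AvgKernel n R) {κ a s : ℝ} (hκ : |κ| ≤ R) (hs : 0 ≤ s)
    (hs1 : s ≤ 1) {θ : Rn n → ℂ} (hc : Continuous θ) (hθ : ∀ x, ‖θ x‖ ≤ a * (1 + ‖x‖) ^ κ)
    (x : Rn n) : Integrable fun w => B.toFun w * θ (x - s • w) :=
  ((B.integrable_mul_rpow hκ).const_mul _).mono'
    (B.continuous.mul (hc.comp (by fun_prop))).aestronglyMeasurable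
    (Eventually.of_forall fun w => B.norm_mul_le hs hs1 hθ x w)

theorem AvgKernel.norm_avg_le (B : AvgKernel n R) {κ a s : ℝ} (hκ : |κ| ≤ R) (hs : 0 ≤ s)
    (hs1 : s ≤ 1) {θ : Rn n → ℂ} (hθ : ∀ x, ‖θ x‖ ≤ a * (1 + ‖x‖) ^ κ) (x : Rn n) :
    ‖avg B.toFun s θ x‖ ≤ absMoment B.toFun |κ| * a * (1 + ‖x‖) ^ κ := by
  refine (norm_integral_le_of_norm_le ((B.integrable_mul_rpow hκ).const_mul _)
    (Eventually.of_forall fun w => B.norm_mul_le hs hs1 hθ x w)).trans (le_of_eq ?_)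
  rw [integral_const_mul, absMoment]
  ring

/-- Convergence of averages at small scales. -/
theorem AvgKernel.tendsto_avg (B : AvgKernel n R) {κ a : ℝ} (hκ : |κ| ≤ R) {v : ℕ → Rn n → ℂ}
    (hc : ∀ k, Continuous (v k)) (hv : ∀ k x, ‖v k x‖ ≤ a * (1 + ‖x‖) ^ κ) {x : Rn n} {c : ℂ}
    (h : Tendsto (fun q : ℕ × Rn n => v q.1 q.2) (atTop ×ˢ 𝓝 x) (𝓝 c)) :
    Tendsto (fun q : ℕ × Rn n => avg B.toFun ((1 / 2) ^ q.1) (v q.1) q.2) (atTop ×ˢ 𝓝 x) (𝓝 c) := by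
  have ha : 0 ≤ a := by
    have := (norm_nonneg _).trans (hv 0 0)
    simpa using this
  -- The limit is taken jointly in scale and point because the argument x - 2^(-k) w moves with k;
  -- this makes the result iterable.
  have h1 : ∫ w, B.toFun w * c = c := by rw [integral_mul_const, B.integral_eq_one, one_mul]
  have hs0 : Tendsto (fun k : ℕ => ((1 : ℝ) / 2) ^ k) atTop (𝓝 0) :=
    tendsto_pow_atTop_nhds_zero_of_lt_one (by norm_num) (by norm_num)
  rw [← h1]
  refine tendsto_integral_filter_of_dominated_convergence
    (fun w => a * ((1 + ‖x‖) ^ κ + 1) * (‖B.toFun w‖ * (1 + ‖w‖) ^ |κ|)) ?_ ?_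
    ((B.integrable_mul_rpow hκ).const_mul _) (Eventually.of_forall fun w => ?_)
  · exact Eventually.of_forall fun q =>
      (B.continuous.mul ((hc q.1).comp (by fun_prop))).aestronglyMeasurable
  · have hev : ∀ᶠ y in 𝓝 x, (1 + ‖y‖) ^ κ < (1 + ‖x‖) ^ κ + 1 :=
      (continuous_one_add_norm_rpow κ).continuousAt.eventually_lt continuousAt_const (by simp)
    filter_upwards [hev.prod_inr atTop] with q hq
    refine Eventually.of_forall fun w => (B.norm_mul_le (by positivity)
      (pow_le_one₀ (by norm_num) (by norm_num)) (hv q.1) q.2 w).trans ?_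
    gcongr
  · refine Tendsto.const_mul _ ?_
    have h2 : Tendsto (fun q : ℕ × Rn n => (q.1, q.2 - ((1 : ℝ) / 2) ^ q.1 • w)) (atTop ×ˢ 𝓝 x)
        (atTop ×ˢ 𝓝 x) := by
      refine tendsto_fst.prodMk ?_
      have := tendsto_snd.sub ((hs0.comp (tendsto_fst (f := atTop) (g := 𝓝 x))).smul_const w)
      simpa using this
    exact h.comp h2

theorem AvgKernel.continuous_avg (B : AvgKernel n R) {κ a s : ℝ} (hκ : |κ| ≤ R) (hs : 0 ≤ s)
    (hs1 : s ≤ 1) {θ : Rn n → ℂ} (hc : Continuous θ) (hθ : ∀ x, ‖θ x‖ ≤ a * (1 + ‖x‖) ^ κ) :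
    Continuous (avg B.toFun s θ) := by
  have ha : 0 ≤ a := by
    have := (norm_nonneg _).trans (hθ 0)
    simpa using this
  refine continuous_iff_continuousAt.2 fun x => ?_
  refine continuousAt_of_dominated
    (bound := fun w => a * ((1 + ‖x‖) ^ κ + 1) * (‖B.toFun w‖ * (1 + ‖w‖) ^ |κ|)) ?_ ?_
    ((B.integrable_mul_rpow hκ).const_mul _) (Eventually.of_forall fun w => ?_)
  · exact Eventually.of_forall fun y =>
      (B.continuous.mul (hc.comp (by fun_prop))).aestronglyMeasurable
  · have hev : ∀ᶠ y in 𝓝 x, (1 + ‖y‖) ^ κ < (1 + ‖x‖) ^ κ + 1 :=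
      (continuous_one_add_norm_rpow κ).continuousAt.eventually_lt continuousAt_const (by simp)
    filter_upwards [hev] with y hy
    refine Eventually.of_forall fun w => (B.norm_mul_le hs hs1 hθ y w).trans ?_
    gcongr
  · exact (continuous_const.mul (hc.comp (by fun_prop))).continuousAt

/-- Functions of weighted growth `κ` together with their derivatives up to order `m`. -/
def SmoothGrowth (κ : ℝ) : ℕ → ℝ → (Rn n → ℂ) → Prop
  | 0, a, θ => Continuous θ ∧ ∀ x, ‖θ x‖ ≤ a * (1 + ‖x‖) ^ κ
  | m + 1, a, θ => (Continuous θ ∧ ∀ x, ‖θ x‖ ≤ a * (1 + ‖x‖) ^ κ) ∧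
    ∃ θ' : Rn n → Rn n → ℂ, ∀ v, SmoothGrowth κ m (a * ‖v‖) (θ' v) ∧
      ∀ x, HasDerivAt (fun τ : ℝ => θ (x + τ • v)) (θ' v x) 0

variable {κ a : ℝ} {m : ℕ} {θ : Rn n → ℂ}

theorem SmoothGrowth.base (h : SmoothGrowth κ m a θ) :
    Continuous θ ∧ ∀ x, ‖θ x‖ ≤ a * (1 + ‖x‖) ^ κ := by
  cases m with
  | zero => exact h
  | succ m => exact h.1

theorem SmoothGrowth.nonneg (h : SmoothGrowth κ m a θ) : 0 ≤ a := by
  have := (norm_nonneg _).trans (h.base.2 0)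
  simpa using this

theorem hasDerivAt_line {g g' : Rn n → ℂ} {v : Rn n}
    (h : ∀ x, HasDerivAt (fun τ : ℝ => g (x + τ • v)) (g' x) 0) (x : Rn n) (τ : ℝ) :
    HasDerivAt (fun τ : ℝ => g (x + τ • v)) (g' (x + τ • v)) τ := by
  have h1 := h (x + τ • v)
  rw [← sub_self τ] at h1
  have := h1.comp_sub_const τ τ
  refine this.congr_of_eventuallyEq (Eventually.of_forall fun σ => ?_)
  simp only [sub_smul]
  congr 1; abel

/-- Averaging commutes with directional derivatives, so estimates for θ - avg θ pass to derivatives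
without further work. -/
theorem AvgKernel.hasDerivAt_avg (B : AvgKernel n R) {s b : ℝ} {θ' : Rn n → ℂ} {v : Rn n}
    (hκ : |κ| ≤ R) (hs : 0 ≤ s) (hs1 : s ≤ 1) (h0 : Continuous θ ∧ ∀ x, ‖θ x‖ ≤ a * (1 + ‖x‖) ^ κ)
    (hb : Continuous θ' ∧ ∀ x, ‖θ' x‖ ≤ b * (1 + ‖x‖) ^ κ)
    (h : ∀ x, HasDerivAt (fun τ : ℝ => θ (x + τ • v)) (θ' x) 0) (x : Rn n) :
    HasDerivAt (fun τ : ℝ => VarHardy.avg B.toFun s θ (x + τ • v))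
      (VarHardy.avg B.toFun s θ' x) 0 := by
  have hb0 : 0 ≤ b := by
    have := (norm_nonneg _).trans (hb.2 0)
    simpa using this
  obtain ⟨ε, hε, hball⟩ := Metric.eventually_nhds_iff_ball.1
    ((((continuous_one_add_norm_rpow (n := n) κ).comp
      (show Continuous fun τ : ℝ => x + τ • v by fun_prop)).continuousAt (x := 0)).eventually_lt
      (continuousAt_const (y := (1 + ‖x‖) ^ κ + 1)) (by simp))
  have key := hasDerivAt_integral_of_dominated_loc_of_deriv_le (μ := volume) (𝕜 := ℝ)
    (s := Metric.ball 0 ε) (F := fun τ w => B.toFun w * θ (x + τ • v - s • w))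
    (F' := fun τ w => B.toFun w * θ' (x + τ • v - s • w)) (x₀ := 0)
    (bound := fun w => b * ((1 + ‖x‖) ^ κ + 1) * (‖B.toFun w‖ * (1 + ‖w‖) ^ |κ|))
    (Metric.ball_mem_nhds _ hε) ?_ ?_ ?_ ?_ ?_ ?_
  · have := key.2
    simp only [zero_smul, add_zero] at this
    exact this
  · exact Eventually.of_forall fun τ =>
      (B.continuous.mul (h0.1.comp (by fun_prop))).aestronglyMeasurable
  · exact B.integrable_mul hκ hs hs1 h0.1 h0.2 _
  · exact (B.continuous.mul (hb.1.comp (by fun_prop))).aestronglyMeasurable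
  · refine Eventually.of_forall fun w τ hτ => (B.norm_mul_le hs hs1 hb.2 _ w).trans ?_
    gcongr
    exact (hball τ hτ).le
  · exact (B.integrable_mul_rpow hκ).const_mul _
  · refine Eventually.of_forall fun w τ _ => HasDerivAt.const_mul _ ?_
    have := hasDerivAt_line h (x - s • w) τ
    simpa only [add_sub_right_comm] using this

/-- `θ - avg B s θ` gains a factor `s` at the cost of one derivative. -/
theorem SmoothGrowth.sub_avg (B : AvgKernel n R) {s : ℝ} (hκ : |κ| + 1 ≤ R) (hs : 0 ≤ s)
    (hs1 : s ≤ 1) (h : SmoothGrowth κ (m + 1) a θ) :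
    SmoothGrowth κ m (absMoment B.toFun (|κ| + 1) * s * a)
      (fun x => θ x - VarHardy.avg B.toFun s θ x) := by
  have hκ' : |κ| ≤ R := by linarith
  have hbase : ∀ {a : ℝ} {θ : Rn n → ℂ}, SmoothGrowth κ 1 a θ →
      (Continuous (fun x => θ x - VarHardy.avg B.toFun s θ x) ∧
        ∀ x, ‖θ x - VarHardy.avg B.toFun s θ x‖ ≤
          absMoment B.toFun (|κ| + 1) * s * a * (1 + ‖x‖) ^ κ) := by
    intro a θ h
    obtain ⟨h0, θ', hθ'⟩ := h
    refine ⟨h0.1.sub (B.continuous_avg hκ' hs hs1 h0.1 h0.2), fun x => ?_⟩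
    have ha : 0 ≤ a := by
      have := (norm_nonneg _).trans (h0.2 0)
      simpa using this
    have hi : Integrable B.toFun := by
      have := B.integrable_mul_rpow (ρ := 0) (by linarith [abs_nonneg κ])
      simp only [Real.rpow_zero, mul_one] at this
      exact (integrable_norm_iff B.continuous.aestronglyMeasurable).1 this
    have h1 : θ x - VarHardy.avg B.toFun s θ x =
        ∫ w, B.toFun w * (θ x - θ (x - s • w)) := by
      simp only [mul_sub]
      rw [integral_sub (hi.mul_const _) (B.integrable_mul hκ' hs hs1 h0.1 h0.2 x),
        integral_mul_const, B.integral_eq_one, one_mul]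
      rfl
    rw [h1]
    refine (norm_integral_le_of_norm_le ((B.integrable_mul_rpow hκ).const_mul
      (a * s * (1 + ‖x‖) ^ κ)) (Eventually.of_forall fun w => ?_)).trans (le_of_eq ?_)
    -- The mean value inequality on the segment from x to x - s w produces s ‖w‖; the additional
    -- factor ‖w‖ is why the moment of order |κ| + 1 appears.
    · have hmv : ‖θ (x + (1 : ℝ) • (-(s • w))) - θ (x + (0 : ℝ) • (-(s • w)))‖ ≤
          a * (s * ‖w‖) * ((1 + ‖x‖) ^ κ * (1 + ‖w‖) ^ |κ|) := by
        refine norm_image_sub_le_of_norm_deriv_le_segment_01'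
          (f := fun τ : ℝ => θ (x + τ • (-(s • w))))
          (f' := fun τ => θ' (-(s • w)) (x + τ • (-(s • w))))
          (fun τ _ => (hasDerivAt_line (hθ' _).2 x τ).hasDerivWithinAt) fun τ hτ => ?_
        have h2 := (hθ' (-(s • w))).1.base.2 (x + τ • (-(s • w)))
        rw [norm_neg, norm_smul, Real.norm_of_nonneg hs] at h2
        refine h2.trans ?_
        gcongr
        have h3 : x + τ • (-(s • w)) = x - (τ * s) • w := by
          rw [smul_neg, smul_smul, sub_eq_add_neg]
        rw [h3]
        exact one_add_norm_rpow_sub_smul_le κ x w (mul_nonneg hτ.1 hs)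
          (mul_le_one₀ hτ.2.le hs hs1)
      simp only [one_smul, zero_smul, add_zero, ← sub_eq_add_neg] at hmv
      rw [norm_sub_rev] at hmv
      have h4 : ‖w‖ * (1 + ‖w‖) ^ |κ| ≤ (1 + ‖w‖) ^ (|κ| + 1) := by
        rw [Real.rpow_add (by positivity), Real.rpow_one, mul_comm]
        gcongr
        linarith
      rw [norm_mul]
      calc _ ≤ ‖B.toFun w‖ * (a * (s * ‖w‖) * ((1 + ‖x‖) ^ κ * (1 + ‖w‖) ^ |κ|)) := by gcongr
        _ = ‖B.toFun w‖ * (a * s * (1 + ‖x‖) ^ κ) * (‖w‖ * (1 + ‖w‖) ^ |κ|) := by ring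
        _ ≤ ‖B.toFun w‖ * (a * s * (1 + ‖x‖) ^ κ) * (1 + ‖w‖) ^ (|κ| + 1) := by gcongr
        _ = _ := by ring
    · rw [integral_const_mul, absMoment]; ring
  induction m generalizing a θ with
  | zero => exact hbase h
  | succ m ih =>
    have h' : SmoothGrowth κ 1 a θ := by
      obtain ⟨h0, θ', hθ'⟩ := h
      exact ⟨h0, θ', fun v => ⟨(hθ' v).1.base, (hθ' v).2⟩⟩
    refine ⟨hbase h', ?_⟩
    obtain ⟨h0, θ', hθ'⟩ := h
    refine ⟨fun v x => θ' v x - VarHardy.avg B.toFun s (θ' v) x, fun v => ⟨?_, fun x => ?_⟩⟩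
    · rw [mul_assoc]; exact ih (hθ' v).1
    · exact ((hθ' v).2 x).sub
        (B.hasDerivAt_avg hκ' hs hs1 h0 (hθ' v).1.base (hθ' v).2 x)

end Averages

end

section

/-! ### The reproducing estimate -/

section Reproducing

/-- The telescoping identity for `1 - (1 - T_j) ^ (m + 1)`. -/
theorem one_sub_one_sub_pow_eq {A : Type*} [Ring A] (T : ℕ → A) (h : ∀ j k, T j * T k = T k * T j)
    (m j : ℕ) : 1 - (1 - T j) ^ (m + 1) =
      (∑ i ∈ Finset.range (m + 1), (1 - T 0) ^ i) * T 0 + ∑ k ∈ Finset.range j,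
        (∑ i ∈ Finset.range (m + 1), (1 - T k) ^ i * (1 - T (k + 1)) ^ (m + 1 - 1 - i)) *
          (T (k + 1) - T k) := by
  -- Each summand is a factored difference of (m + 1)-st powers: of 1 and 1 - T 0 here, of 1 - T k
  -- and 1 - T (k + 1) below, where commutativity enters.
  have h0 : (∑ i ∈ Finset.range (m + 1), (1 - T 0) ^ i) * T 0 = 1 - (1 - T 0) ^ (m + 1) := by
    rw [← geom_sum_mul_neg, sub_sub_cancel]
  have hk : ∀ k, (∑ i ∈ Finset.range (m + 1), (1 - T k) ^ i * (1 - T (k + 1)) ^ (m + 1 - 1 - i)) *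
      (T (k + 1) - T k) = (1 - T k) ^ (m + 1) - (1 - T (k + 1)) ^ (m + 1) := by
    intro k
    have hc : Commute (1 - T k) (1 - T (k + 1)) :=
      ((Commute.one_left _).sub_left ((Commute.one_right _).sub_right (h k (k + 1))))
    rw [← hc.geom_sum₂_mul, sub_sub_sub_cancel_left]
  rw [h0, Finset.sum_congr rfl fun k _ => hk k,
    Finset.sum_range_sub' (fun k => (1 - T k) ^ (m + 1))]
  abel

variable {n : ℕ} {R : ℝ}

/-- Continuous functions of growth `κ`. -/
def growthSpace (n : ℕ) (κ : ℝ) : Submodule ℂ (Rn n → ℂ) where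
  carrier := {θ | Continuous θ ∧ ∃ a, ∀ x, ‖θ x‖ ≤ a * (1 + ‖x‖) ^ κ}
  zero_mem' := ⟨continuous_const, 0, by simp⟩
  add_mem' := by
    rintro θ η ⟨h1, a, ha⟩ ⟨h2, b, hb⟩
    exact ⟨h1.add h2, a + b, fun x => (norm_add_le _ _).trans
      ((add_le_add (ha x) (hb x)).trans (by rw [add_mul]))⟩
  smul_mem' := by
    rintro c θ ⟨h1, a, ha⟩
    refine ⟨h1.const_smul c, ‖c‖ * a, fun x => ?_⟩
    simp only [Pi.smul_apply, norm_smul]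
    rw [mul_assoc]
    exact mul_le_mul_of_nonneg_left (ha x) (norm_nonneg c)

/-- The averaging operator at scale `2 ^ (-k)`. -/
def AvgKernel.T (B : AvgKernel n R) {κ : ℝ} (hκ : |κ| ≤ R) (k : ℕ) :
    Module.End ℂ (growthSpace n κ) where
  toFun v := ⟨avg B.toFun ((1 / 2) ^ k) v, by
    obtain ⟨v, hc, a, ha⟩ := v
    exact ⟨B.continuous_avg hκ (by positivity) (pow_le_one₀ (by norm_num) (by norm_num)) hc ha,
      _, B.norm_avg_le hκ (by positivity) (pow_le_one₀ (by norm_num) (by norm_num)) ha⟩⟩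
  map_add' := by
    rintro ⟨v, hc, a, ha⟩ ⟨w, hc', b, hb⟩
    ext x
    have h0 : (0 : ℝ) ≤ (1 / 2) ^ k := by positivity
    have h1 : ((1 : ℝ) / 2) ^ k ≤ 1 := pow_le_one₀ (by norm_num) (by norm_num)
    change ∫ y, B.toFun y * (v (x - _) + w (x - _)) = _
    simp only [mul_add]
    exact integral_add (B.integrable_mul hκ h0 h1 hc ha x) (B.integrable_mul hκ h0 h1 hc' hb x)
  map_smul' := by
    rintro c ⟨v, hc, a, ha⟩
    ext x
    change ∫ y, B.toFun y * (c * v (x - _)) = c * ∫ y, B.toFun y * v (x - _)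
    simp only [mul_left_comm _ c]
    exact integral_const_mul _ _

theorem AvgKernel.T_apply (B : AvgKernel n R) {κ : ℝ} (hκ : |κ| ≤ R) (k : ℕ) (v : growthSpace n κ)
    (x : Rn n) : (B.T hκ k v : Rn n → ℂ) x = ∫ w, B.toFun w * (v : Rn n → ℂ) (x - (1 / 2 : ℝ) ^ k • w) :=
  rfl

/-- Fubini, since translations commute. The factorization of differences of powers in `Module.End`
depends on it. -/
theorem AvgKernel.commute_T (B : AvgKernel n R) {κ : ℝ} (hκ : |κ| ≤ R) (j k : ℕ) :
    B.T hκ j * B.T hκ k = B.T hκ k * B.T hκ j := by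
  refine LinearMap.ext fun v => Subtype.ext (funext fun x => ?_)
  obtain ⟨v, hc, a, ha⟩ := v
  simp only [Module.End.mul_apply, B.T_apply]
  simp only [← integral_const_mul]
  rw [integral_integral_swap]
  · congr 1; ext w
    congr 1; ext w'
    rw [mul_left_comm]
    congr 3
    abel
  · have h1 := ((B.integrable_mul_rpow hκ).const_mul (a * (1 + ‖x‖) ^ κ)).mul_prod
      (B.integrable_mul_rpow hκ)
    refine h1.mono' (Continuous.aestronglyMeasurable ?_) (Eventually.of_forall fun q => ?_)
    · have := B.continuous
      simp only [Function.uncurry_def]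
      fun_prop
    · have h0 : ∀ k, (0 : ℝ) ≤ (1 / 2) ^ k := fun k => by positivity
      have h1 : ∀ k, ((1 : ℝ) / 2) ^ k ≤ 1 := fun k => pow_le_one₀ (by norm_num) (by norm_num)
      have ha0 : 0 ≤ a := by
        have := (norm_nonneg _).trans (ha 0)
        simpa using this
      have h2 := B.norm_mul_le (h0 k) (h1 k) ha (x - (1 / 2 : ℝ) ^ j • q.1) q.2
      have h3 := one_add_norm_rpow_sub_smul_le κ x q.1 (h0 j) (h1 j)
      simp only [Function.uncurry_def, norm_mul] at h2 ⊢
      calc _ ≤ ‖B.toFun q.1‖ * (a * ((1 + ‖x‖) ^ κ * (1 + ‖q.1‖) ^ |κ|) *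
            (‖B.toFun q.2‖ * (1 + ‖q.2‖) ^ |κ|)) :=
            mul_le_mul_of_nonneg_left (h2.trans (by gcongr)) (norm_nonneg _)
        _ = _ := by ring

/-- The difference operator at scale `2 ^ (-k)`. -/
def AvgKernel.D (B : AvgKernel n R) {κ : ℝ} (hκ : |κ| ≤ R) (k : ℕ) :
    Module.End ℂ (growthSpace n κ) := 1 - B.T hκ k

theorem AvgKernel.coe_D (B : AvgKernel n R) {κ : ℝ} (hκ : |κ| ≤ R) (k : ℕ) (v : growthSpace n κ) :
    (B.D hκ k v : Rn n → ℂ) = fun x => (v : Rn n → ℂ) x - avg B.toFun ((1 / 2) ^ k) v x := rfl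

/-- `∑ i ≤ m, D_k ^ i D_{k+1} ^ (m - i)`. -/
def AvgKernel.G (B : AvgKernel n R) {κ : ℝ} (hκ : |κ| ≤ R) (m k : ℕ) :
    Module.End ℂ (growthSpace n κ) :=
  ∑ i ∈ Finset.range (m + 1), B.D hκ k ^ i * B.D hκ (k + 1) ^ (m + 1 - 1 - i)

/-- `∑ i ≤ m, D_0 ^ i`. -/
def AvgKernel.A (B : AvgKernel n R) {κ : ℝ} (hκ : |κ| ≤ R) (m : ℕ) :
    Module.End ℂ (growthSpace n κ) := ∑ i ∈ Finset.range (m + 1), B.D hκ 0 ^ i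

/-- `D_k ^ m v → 0` for `m ≥ 1`. -/
theorem AvgKernel.tendsto_D_pow (B : AvgKernel n R) {κ : ℝ} (hκ : |κ| ≤ R) (v : growthSpace n κ)
    (m : ℕ) (x : Rn n) :
    Tendsto (fun k => ((B.D hκ k ^ (m + 1)) v : Rn n → ℂ) x) atTop (𝓝 0) := by
  -- The bound uniform in k is the domination for the next averaging. The first difference has limit
  -- v - v, and all later ones 0 - 0.
  have key : ∀ m : ℕ, (∃ a, ∀ k x, ‖((B.D hκ k ^ m) v : Rn n → ℂ) x‖ ≤ a * (1 + ‖x‖) ^ κ) ∧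
      ∀ x, Tendsto (fun q : ℕ × Rn n => ((B.D hκ q.1 ^ m) v : Rn n → ℂ) q.2) (atTop ×ˢ 𝓝 x)
        (𝓝 (if m = 0 then (v : Rn n → ℂ) x else 0)) := by
    intro m
    induction m with
    | zero =>
      obtain ⟨v, hc, a, ha⟩ := v
      exact ⟨⟨a, fun k x => by simpa using ha x⟩, fun x => by
        simpa [Function.comp_def] using (hc.tendsto x).comp (tendsto_snd (f := (atTop : Filter ℕ)))⟩
    | succ m ih =>
      obtain ⟨⟨a, ha⟩, ht⟩ := ih
      have hcoe : ∀ k x, ((B.D hκ k ^ (m + 1)) v : Rn n → ℂ) x =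
          ((B.D hκ k ^ m) v : Rn n → ℂ) x -
            avg B.toFun ((1 / 2) ^ k) ((B.D hκ k ^ m) v : Rn n → ℂ) x := by
        intro k x
        rw [pow_succ', Module.End.mul_apply, B.coe_D]
      refine ⟨⟨a + absMoment B.toFun |κ| * a, fun k x => ?_⟩, fun x => ?_⟩
      · rw [hcoe, add_mul]
        exact (norm_sub_le _ _).trans (add_le_add (ha k x) (B.norm_avg_le hκ (by positivity)
          (pow_le_one₀ (by norm_num) (by norm_num)) (ha k) x))
      · have := (ht x).sub (B.tendsto_avg hκ (fun k => ((B.D hκ k ^ m) v).2.1) ha (ht x))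
        simpa [hcoe] using this
  have h1 := (key (m + 1)).2 x
  have h2 : Tendsto (fun k : ℕ => (k, x)) atTop (atTop ×ˢ 𝓝 x) :=
    tendsto_id.prodMk tendsto_const_nhds
  simpa [Function.comp_def] using h1.comp h2

variable {K L' : ℝ}

theorem integrable_growth_mul (hL' : (n : ℝ) + |K| < L') {F θ : Rn n → ℂ} (hF : F ∈ growthSpace n K)
    (hθ : θ ∈ growthSpace n (-L')) (x : Rn n) : Integrable fun z => F (x - z) * θ z := by
  obtain ⟨hFc, a, ha⟩ := hF
  obtain ⟨hθc, b, hb⟩ := hθ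
  have ha0 : 0 ≤ a := by
    have := (norm_nonneg _).trans (ha 0)
    simpa using this
  refine ((integrable_one_add_norm_rpow_neg (n := n) (L := L' - |K|) (by linarith)).const_mul
    (a * (1 + ‖x‖) ^ K * b)).mono' ((hFc.comp (by fun_prop)).mul hθc).aestronglyMeasurable
    (Eventually.of_forall fun z => ?_)
  have h1 := one_add_norm_rpow_sub_le K x z
  have hz : 0 < 1 + ‖z‖ := by positivity
  rw [norm_mul]
  calc _ ≤ (a * ((1 + ‖x‖) ^ K * (1 + ‖z‖) ^ |K|)) * (b * (1 + ‖z‖) ^ (-L')) := by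
        gcongr
        · exact (ha _).trans (by gcongr)
        · exact hb z
    _ = a * (1 + ‖x‖) ^ K * b * ((1 + ‖z‖) ^ |K| * (1 + ‖z‖) ^ (-L')) := by ring
    _ = _ := by rw [← Real.rpow_add hz]; congr 2; ring

/-- `v = F * θ`. -/
def IsConvOf (F v θ : Rn n → ℂ) : Prop := ∀ x, v x = ∫ z, F (x - z) * θ z

/-- Translation invariance and Fubini let an average of F * θ act on θ alone. In this way the
differences fall on the smooth factor, leaving F untouched. -/
theorem IsConvOf.T (B : AvgKernel n R) (hK : |K| ≤ R) (hLR : |-L'| ≤ R) (hL' : (n : ℝ) + |K| < L')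
    {F : Rn n → ℂ} (hF : F ∈ growthSpace n K) {v : growthSpace n K} {θ : growthSpace n (-L')}
    (h : IsConvOf F v θ) (k : ℕ) : IsConvOf F (B.T hK k v) (B.T hLR k θ) := by
  intro x
  obtain ⟨θ, hθ⟩ := θ
  rw [B.T_apply]
  simp only [h _, B.T_apply]
  have hshift : ∀ w, ∫ z, F (x - (1 / 2 : ℝ) ^ k • w - z) * θ z =
      ∫ z, F (x - z) * θ (z - (1 / 2 : ℝ) ^ k • w) := by
    intro w
    rw [← integral_sub_right_eq_self _ ((1 / 2 : ℝ) ^ k • w)]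
    congr 1; ext z; congr 2; abel
  simp only [hshift, ← integral_const_mul]
  rw [integral_integral_swap]
  · simp only [mul_left_comm]
  · obtain ⟨hFc, a, ha⟩ := hF
    obtain ⟨hθc, b, hb⟩ := hθ
    have ha0 : 0 ≤ a := by
      have := (norm_nonneg _).trans (ha 0)
      simpa using this
    have hi := (integrable_one_add_norm_rpow_neg (n := n) (L := L' - |K|) (by linarith)).const_mul
      (a * (1 + ‖x‖) ^ K)
    have h1 := ((B.integrable_mul_rpow hLR).const_mul b).mul_prod hi
    refine h1.mono' (Continuous.aestronglyMeasurable ?_) (Eventually.of_forall fun q => ?_)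
    · have := B.continuous
      simp only [Function.uncurry_def]
      fun_prop
    · have h2 := B.norm_mul_le (s := (1 / 2 : ℝ) ^ k) (by positivity)
        (pow_le_one₀ (by norm_num) (by norm_num)) hb q.2 q.1
      have h3 := one_add_norm_rpow_sub_le K x q.2
      have hz : 0 < 1 + ‖q.2‖ := by positivity
      simp only [Function.uncurry_def]
      calc ‖B.toFun q.1 * (F (x - q.2) * θ (q.2 - (1 / 2 : ℝ) ^ k • q.1))‖
          = ‖F (x - q.2)‖ * ‖B.toFun q.1 * θ (q.2 - (1 / 2 : ℝ) ^ k • q.1)‖ := by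
            simp only [norm_mul]; ring
        _ ≤ (a * ((1 + ‖x‖) ^ K * (1 + ‖q.2‖) ^ |K|)) *
            (b * (1 + ‖q.2‖) ^ (-L') * (‖B.toFun q.1‖ * (1 + ‖q.1‖) ^ |(-L')|)) := by
            gcongr
            exact (ha _).trans (by gcongr)
        _ = b * (‖B.toFun q.1‖ * (1 + ‖q.1‖) ^ |(-L')|) *
            (a * (1 + ‖x‖) ^ K * ((1 + ‖q.2‖) ^ |K| * (1 + ‖q.2‖) ^ (-L'))) := by ring
        _ = _ := by rw [← Real.rpow_add hz]; congr 3; ring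

theorem IsConvOf.D (B : AvgKernel n R) (hK : |K| ≤ R) (hLR : |-L'| ≤ R) (hL' : (n : ℝ) + |K| < L')
    {F : Rn n → ℂ} (hF : F ∈ growthSpace n K) {v : growthSpace n K} {θ : growthSpace n (-L')}
    (h : IsConvOf F v θ) (k : ℕ) : IsConvOf F (B.D hK k v) (B.D hLR k θ) := by
  intro x
  have h1 : (B.D hK k v : Rn n → ℂ) x = (v : Rn n → ℂ) x - (B.T hK k v : Rn n → ℂ) x := rfl
  rw [h1, h x, h.T B hK hLR hL' hF k x, ← integral_sub (integrable_growth_mul hL' hF θ.2 x)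
    (integrable_growth_mul hL' hF (B.T hLR k θ).2 x)]
  simp only [← mul_sub]
  rfl

theorem IsConvOf.D_pow (B : AvgKernel n R) (hK : |K| ≤ R) (hLR : |-L'| ≤ R)
    (hL' : (n : ℝ) + |K| < L')
    {F : Rn n → ℂ} (hF : F ∈ growthSpace n K) {v : growthSpace n K} {θ : growthSpace n (-L')}
    (h : IsConvOf F v θ) (k i : ℕ) : IsConvOf F ((B.D hK k ^ i) v) ((B.D hLR k ^ i) θ) := by
  induction i with
  | zero => simpa using h
  | succ i ih =>
    rw [pow_succ', pow_succ']
    exact ih.D B hK hLR hL' hF k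

theorem IsConvOf.sum (hL' : (n : ℝ) + |K| < L') {F : Rn n → ℂ} (hF : F ∈ growthSpace n K)
    {ι : Type*} (s : Finset ι) {v : ι → growthSpace n K} {θ : ι → growthSpace n (-L')}
    (h : ∀ i ∈ s, IsConvOf F (v i) (θ i)) :
    IsConvOf F (∑ i ∈ s, v i : growthSpace n K) (∑ i ∈ s, θ i : growthSpace n (-L')) := by
  intro x
  simp only [Submodule.coe_sum, Finset.sum_apply, Finset.mul_sum]
  rw [integral_finsetSum _ fun i _ => integrable_growth_mul hL' hF (θ i).2 x]
  exact Finset.sum_congr rfl fun i hi => h i hi x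

/-- Each factor D_k exchanges one derivative for 2^(-k). The exponent κ of the ambient space and the
exponent κ' of the estimate are independent. -/
theorem smoothGrowth_D_pow (B : AvgKernel n R) {κ κ' a : ℝ} (hκ : |κ| ≤ R) (hκ' : |κ'| + 1 ≤ R)
    {m i k : ℕ} {θ : growthSpace n κ} (h : SmoothGrowth κ' (m + i) a (θ : Rn n → ℂ)) :
    SmoothGrowth κ' m ((absMoment B.toFun (|κ'| + 1) * (1 / 2) ^ k) ^ i * a)
      ((B.D hκ k ^ i) θ : Rn n → ℂ) := by
  induction i generalizing m with
  | zero => simpa using h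
  | succ i ih =>
    have h1 := ih (m := m + 1) (by rwa [add_assoc, add_comm 1 i])
    have h2 := h1.sub_avg B hκ' (s := (1 / 2) ^ k) (by positivity)
      (pow_le_one₀ (by norm_num) (by norm_num))
    rw [pow_succ' (B.D hκ k), Module.End.mul_apply, B.coe_D, pow_succ', mul_assoc]
    exact h2

/-- The reproducing estimate: if `T_k u = F_k * Ψ` for all `k`, then `u` is controlled by the `F_k`. -/
theorem AvgKernel.enorm_le (B : AvgKernel n R) (hK : |K| ≤ R) (hLR : |-L'| ≤ R)
    (hL' : (n : ℝ) + |K| < L') {L a : ℝ} (hL : |-L| + 1 ≤ R) {m : ℕ} (u : growthSpace n K)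
    (F : ℕ → Rn n → ℂ) (hF : ∀ k, F k ∈ growthSpace n K) (Ψ : growthSpace n (-L'))
    (hu : ∀ k, IsConvOf (F k) (B.T hK k u) Ψ) (hΨ : SmoothGrowth (-L) m a (Ψ : Rn n → ℂ)) :
    ‖(u : Rn n → ℂ) 0‖ₑ ≤
      ENNReal.ofReal ((m + 1) * (1 + absMoment B.toFun (|-L| + 1)) ^ m * (2 + 2 ^ m) * a) *
      ∑' k, ENNReal.ofReal ((1 / 2) ^ (k * m)) *
        ∫⁻ z, ‖F k (-z)‖ₑ * ENNReal.ofReal ((1 + ‖z‖) ^ (-L)) := by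
  -- There are two decay exponents: L' only makes the convolutions with the growing F k converge
  -- absolutely, while L governs the bound. The final constant involves L but not K or L', hence not
  -- the order of the distribution.
  set A := absMoment B.toFun (|-L| + 1) with hA
  have hA0 : 0 ≤ A := absMoment_nonneg _ _
  have ha0 := hΨ.nonneg
  set I : ℕ → ℝ≥0∞ := fun k => ∫⁻ z, ‖F k (-z)‖ₑ * ENNReal.ofReal ((1 + ‖z‖) ^ (-L)) with hI
  set c : ℝ := (m + 1) * (1 + A) ^ m * a with hc
  have hc0 : 0 ≤ c := by positivity
  -- the estimate of one term
  have hterm : ∀ (k : ℕ) (v : growthSpace n K) (θ : growthSpace n (-L')) (b : ℝ),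
      IsConvOf (F k) v θ → (∀ z, ‖(θ : Rn n → ℂ) z‖ ≤ b * (1 + ‖z‖) ^ (-L)) →
      ‖(v : Rn n → ℂ) 0‖ₑ ≤ ENNReal.ofReal b * I k := by
    intro k v θ b hv hθ
    have hb0 : 0 ≤ b := by
      have := (norm_nonneg _).trans (hθ 0)
      simpa using this
    rw [hv 0, hI, ← lintegral_const_mul' _ _ ENNReal.ofReal_ne_top]
    refine (enorm_integral_le_lintegral_enorm _).trans (lintegral_mono fun z => ?_)
    rw [zero_sub, enorm_mul, mul_left_comm, ← ENNReal.ofReal_mul hb0]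
    gcongr
    rw [← ofReal_norm]
    exact ENNReal.ofReal_le_ofReal (hθ z)
  have hGconv : ∀ k j (v : growthSpace n K), IsConvOf (F j) v Ψ → IsConvOf (F j) (B.G hK m k v) (B.G hLR m k Ψ) := by
    intro k j v hv
    simp only [AvgKernel.G, LinearMap.sum_apply]
    exact IsConvOf.sum hL' (hF j) _ fun i _ =>
      (hv.D_pow B hK hLR hL' (hF j) (k + 1) _).D_pow B hK hLR hL' (hF j) k i
  have hA₀conv : ∀ j (v : growthSpace n K), IsConvOf (F j) v Ψ → IsConvOf (F j) (B.A hK m v) (B.A hLR m Ψ) := by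
    intro j v hv
    simp only [AvgKernel.A, LinearMap.sum_apply]
    exact IsConvOf.sum hL' (hF j) _ fun i _ => hv.D_pow B hK hLR hL' (hF j) 0 i
  -- Every summand of `B.G` has exactly m differences, i at scale 2^(-k) and m - i at the finer
  -- scale, which uses up all m derivatives of Ψ.
  have hGb : ∀ k z, ‖(B.G hLR m k Ψ : Rn n → ℂ) z‖ ≤ (c * (1 / 2) ^ (k * m)) * (1 + ‖z‖) ^ (-L) := by
    intro k z
    simp only [AvgKernel.G, LinearMap.sum_apply, Submodule.coe_sum, Finset.sum_apply]
    refine (norm_sum_le_of_le (n := fun _ => ((1 + A) ^ m * a * (1 / 2) ^ (k * m)) *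
      (1 + ‖z‖) ^ (-L)) _ fun i hi => ?_).trans (le_of_eq ?_)
    · have him : i ≤ m := Finset.mem_range_succ_iff.1 hi
      have h1 : SmoothGrowth (-L) (0 + i + (m + 1 - 1 - i)) a (Ψ : Rn n → ℂ) := by
        rw [show 0 + i + (m + 1 - 1 - i) = m by omega]; exact hΨ
      have h2 := (smoothGrowth_D_pow B hLR hL (k := k) (m := 0) (i := i)
        (smoothGrowth_D_pow B hLR hL (k := k + 1) h1)).2 z
      rw [Module.End.mul_apply]
      refine h2.trans (mul_le_mul_of_nonneg_right ?_ (by positivity))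
      rw [← hA]
      calc (A * (1 / 2) ^ k) ^ i * ((A * (1 / 2) ^ (k + 1)) ^ (m + 1 - 1 - i) * a)
          ≤ ((1 + A) * (1 / 2) ^ k) ^ i * (((1 + A) * (1 / 2) ^ k) ^ (m + 1 - 1 - i) * a) := by
            gcongr ?_ ^ i * (?_ ^ (m + 1 - 1 - i) * a)
            · gcongr; linarith
            · refine mul_le_mul (by linarith) ?_ (by positivity) (by positivity)
              exact pow_le_pow_of_le_one (by norm_num) (by norm_num) (Nat.le_succ k)
        _ = ((1 + A) * (1 / 2) ^ k) ^ (i + (m + 1 - 1 - i)) * a := by rw [pow_add]; ring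
        _ = _ := by
            rw [show i + (m + 1 - 1 - i) = m by omega, mul_pow, ← pow_mul]; ring
    · simp only [Finset.sum_const, Finset.card_range, nsmul_eq_mul]
      rw [hc]; push_cast; ring
  have hA₀b : ∀ z, ‖(B.A hLR m Ψ : Rn n → ℂ) z‖ ≤ c * (1 + ‖z‖) ^ (-L) := by
    intro z
    simp only [AvgKernel.A, LinearMap.sum_apply, Submodule.coe_sum, Finset.sum_apply]
    refine (norm_sum_le_of_le (n := fun _ => ((1 + A) ^ m * a) *
      (1 + ‖z‖) ^ (-L)) _ fun i hi => ?_).trans (le_of_eq ?_)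
    · have him : i ≤ m := Finset.mem_range_succ_iff.1 hi
      have h1 : SmoothGrowth (-L) (m - i + i) a (Ψ : Rn n → ℂ) := by
        rw [show m - i + i = m by omega]; exact hΨ
      refine ((smoothGrowth_D_pow B hLR hL (k := 0) h1).base.2 z).trans ?_
      gcongr
      rw [← hA, pow_zero, mul_one]
      exact (pow_le_pow_left₀ hA0 (by linarith) i).trans
        (pow_le_pow_right₀ (by linarith) him)
    · simp only [Finset.sum_const, Finset.card_range, nsmul_eq_mul]
      rw [hc]; push_cast; ring
  -- the telescoping identity
  have htel : ∀ j, (1 : Module.End ℂ (growthSpace n K)) - B.D hK j ^ (m + 1) =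
      B.A hK m * B.T hK 0 + ∑ k ∈ Finset.range j, B.G hK m k * (B.T hK (k + 1) - B.T hK k) :=
    fun j => one_sub_one_sub_pow_eq (B.T hK) (B.commute_T hK) m j
  set S := ∑' k, ENNReal.ofReal ((1 / 2) ^ (k * m)) * I k with hS
  have hSk : ∀ k, ENNReal.ofReal ((1 / 2) ^ (k * m)) * I k ≤ S := fun k =>
    ENNReal.le_tsum (f := fun k => ENNReal.ofReal ((1 / 2) ^ (k * m)) * I k) k
  have hbound : ∀ j, ‖(u : Rn n → ℂ) 0 - ((B.D hK j ^ (m + 1)) u : Rn n → ℂ) 0‖ₑ ≤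
      ENNReal.ofReal ((m + 1) * (1 + A) ^ m * (2 + 2 ^ m) * a) * S := by
    intro j
    have h1 : (u : Rn n → ℂ) 0 - ((B.D hK j ^ (m + 1)) u : Rn n → ℂ) 0 =
        (B.A hK m (B.T hK 0 u) : Rn n → ℂ) 0 + ∑ k ∈ Finset.range j,
          ((B.G hK m k (B.T hK (k + 1) u) : Rn n → ℂ) 0 - (B.G hK m k (B.T hK k u) : Rn n → ℂ) 0) := by
      have := congrArg (fun X : Module.End ℂ (growthSpace n K) => (X u : Rn n → ℂ) 0) (htel j)
      simpa [LinearMap.sum_apply, Submodule.coe_sum, mul_sub] using this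
    rw [h1]
    have e0 : ‖(B.A hK m (B.T hK 0 u) : Rn n → ℂ) 0‖ₑ ≤ ENNReal.ofReal c * S := by
      refine (hterm 0 _ _ c (hA₀conv 0 _ (hu 0)) hA₀b).trans ?_
      gcongr
      simpa using hSk 0
    have e1 : ∀ k, ‖(B.G hK m k (B.T hK k u) : Rn n → ℂ) 0‖ₑ ≤
        ENNReal.ofReal c * (ENNReal.ofReal ((1 / 2) ^ (k * m)) * I k) := by
      intro k
      refine (hterm k _ _ _ (hGconv k k _ (hu k)) (hGb k)).trans (le_of_eq ?_)
      rw [ENNReal.ofReal_mul hc0, mul_assoc]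
    -- F carries index k + 1 but the gain is only 2^(-km); the factor 2^m pays for the re-indexing.
    have e2 : ∀ k, ‖(B.G hK m k (B.T hK (k + 1) u) : Rn n → ℂ) 0‖ₑ ≤
        ENNReal.ofReal (c * 2 ^ m) * (ENNReal.ofReal ((1 / 2) ^ ((k + 1) * m)) * I (k + 1)) := by
      intro k
      refine (hterm (k + 1) _ _ _ (hGconv k (k + 1) _ (hu (k + 1))) (hGb k)).trans (le_of_eq ?_)
      rw [← mul_assoc, ← ENNReal.ofReal_mul (by positivity)]
      congr 2
      have : (1 / 2 : ℝ) ^ m * 2 ^ m = 1 := by rw [← mul_pow]; norm_num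
      rw [add_mul, one_mul, pow_add]
      linear_combination (-c * (1 / 2) ^ (k * m)) * this
    have e3 : ∑ k ∈ Finset.range j, ENNReal.ofReal ((1 / 2) ^ (k * m)) * I k ≤ S :=
      ENNReal.sum_le_tsum _
    have e4 : ∑ k ∈ Finset.range j, ENNReal.ofReal ((1 / 2) ^ ((k + 1) * m)) * I (k + 1) ≤ S := by
      refine le_trans ?_ (ENNReal.sum_le_tsum (f := fun k => ENNReal.ofReal ((1 / 2) ^ (k * m)) * I k)
        (Finset.range (j + 1)))
      rw [Finset.sum_range_succ']
      exact le_self_add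
    calc _ ≤ ENNReal.ofReal c * S + ∑ k ∈ Finset.range j,
          (ENNReal.ofReal (c * 2 ^ m) * (ENNReal.ofReal ((1 / 2) ^ ((k + 1) * m)) * I (k + 1)) +
            ENNReal.ofReal c * (ENNReal.ofReal ((1 / 2) ^ (k * m)) * I k)) := by
          refine (enorm_add_le _ _).trans (add_le_add e0 ((enorm_sum_le _ _).trans
            (Finset.sum_le_sum fun k _ => ?_)))
          exact (enorm_sub_le).trans (add_le_add (e2 k) (e1 k))
      -- The three contributions, from T_0, from T_{k+1} and from T_k, add up to the factor 2 + 2^m.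
      _ ≤ ENNReal.ofReal c * S + (ENNReal.ofReal (c * 2 ^ m) * S + ENNReal.ofReal c * S) := by
          rw [Finset.sum_add_distrib, ← Finset.mul_sum, ← Finset.mul_sum]
          gcongr
      _ = _ := by
          rw [← add_mul, ← add_mul, ← ENNReal.ofReal_add (by positivity) hc0,
            ← ENNReal.ofReal_add hc0 (by positivity)]
          congr 2
          rw [hc]; ring
  have hlim : Tendsto (fun j => ‖(u : Rn n → ℂ) 0 - ((B.D hK j ^ (m + 1)) u : Rn n → ℂ) 0‖ₑ) atTop
      (𝓝 ‖(u : Rn n → ℂ) 0‖ₑ) := by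
    have := (tendsto_const_nhds (x := (u : Rn n → ℂ) 0)).sub (B.tendsto_D_pow hK u m 0)
    rw [sub_zero] at this
    exact (continuous_enorm.tendsto _).comp this
  exact le_of_tendsto' hlim hbound

end Reproducing

end

/-! ### Schwartz functions in growth classes; control of f * Ψ_t by a kernel family -/

section

variable {n : ℕ}

theorem smoothGrowth_of_iteratedFDeriv {κ a : ℝ} {m : ℕ} {θ : Rn n → ℂ} (hθ : ContDiff ℝ ((⊤ : ℕ∞) : WithTop ℕ∞) θ)
    (h : ∀ k ≤ m, ∀ x, ‖iteratedFDeriv ℝ k θ x‖ ≤ a * (1 + ‖x‖) ^ κ) : SmoothGrowth κ m a θ := by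
  have hbase : ∀ {a : ℝ} {θ : Rn n → ℂ}, ContDiff ℝ ((⊤ : ℕ∞) : WithTop ℕ∞) θ →
      (∀ x, ‖iteratedFDeriv ℝ 0 θ x‖ ≤ a * (1 + ‖x‖) ^ κ) →
      Continuous θ ∧ ∀ x, ‖θ x‖ ≤ a * (1 + ‖x‖) ^ κ :=
    fun hθ h => ⟨hθ.continuous, fun x => by simpa using h x⟩
  induction m generalizing a θ with
  | zero => exact hbase hθ (h 0 le_rfl)
  | succ m ih =>
    refine ⟨hbase hθ (h 0 (Nat.zero_le _)), fun v x => fderiv ℝ θ x v, fun v => ⟨?_, fun x => ?_⟩⟩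
    · have hd : ContDiff ℝ ((⊤ : ℕ∞) : WithTop ℕ∞) (fderiv ℝ θ) := hθ.fderiv_right le_rfl
      refine ih (hd.clm_apply contDiff_const) fun k hk x => ?_
      refine (norm_iteratedFDeriv_clm_apply_const (N := ((⊤ : ℕ∞) : WithTop ℕ∞)) hd.contDiffAt (by exact_mod_cast le_top)).trans ?_
      rw [norm_iteratedFDeriv_fderiv, mul_comm a, mul_assoc]
      exact mul_le_mul_of_nonneg_left (h (k + 1) (by omega) x) (norm_nonneg v)
    · have h1 : HasFDerivAt θ (fderiv ℝ θ x) (x + (0 : ℝ) • v) := by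
        rw [zero_smul, add_zero]
        exact (hθ.differentiable (by simp) x).hasFDerivAt
      have h2 : HasDerivAt (fun τ : ℝ => x + τ • v) v 0 := by
        simpa using ((hasDerivAt_id (0 : ℝ)).smul_const v).const_add x
      exact h1.comp_hasDerivAt 0 h2

theorem exists_smoothGrowth (Ψ : 𝓢(Rn n, ℂ)) (κ : ℝ) (m : ℕ) : ∃ a, SmoothGrowth κ m a Ψ := by
  obtain ⟨K, hK⟩ := exists_nat_ge (-κ)
  refine ⟨schwartzNorm (max K m) Ψ, smoothGrowth_of_iteratedFDeriv (Ψ.smooth ⊤) fun k hk x => ?_⟩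
  have h1 := le_schwartzNorm (le_max_left K m) (hk.trans (le_max_right K m)) Ψ x
  have hx : 0 < 1 + ‖x‖ := by positivity
  have h2 : (1 + ‖x‖) ^ (-(K : ℝ)) ≤ (1 + ‖x‖) ^ κ :=
    Real.rpow_le_rpow_of_exponent_le (by linarith [norm_nonneg x]) (by linarith)
  refine le_trans ?_ (mul_le_mul_of_nonneg_left h2 (apply_nonneg _ _))
  rw [Real.rpow_neg hx.le, ← div_eq_mul_inv, le_div_iff₀ (by positivity), Real.rpow_natCast, mul_comm]
  exact h1

theorem schwartz_mem_growthSpace (Ψ : 𝓢(Rn n, ℂ)) (κ : ℝ) : (Ψ : Rn n → ℂ) ∈ growthSpace n κ := by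
  obtain ⟨a, ha⟩ := exists_smoothGrowth Ψ κ 0
  exact ⟨ha.1, a, ha.2⟩

theorem eq_sum_smul_single (x : Rn n) : x = ∑ j, x j • EuclideanSpace.single j (1 : ℝ) := by
  ext j
  simp [Pi.single_apply]

theorem norm_le_sum_single {k : ℕ} (A : ContinuousMultilinearMap ℝ (fun _ : Fin k => Rn n) ℂ) :
    ‖A‖ ≤ ∑ i : Fin k → Fin n, ‖A fun l => EuclideanSpace.single (i l) (1 : ℝ)‖ := by
  refine ContinuousMultilinearMap.opNorm_le_bound (Finset.sum_nonneg fun _ _ => norm_nonneg _)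
    fun v => ?_
  have h1 : v = fun l => ∑ j, (v l j) • EuclideanSpace.single j (1 : ℝ) :=
    funext fun l => eq_sum_smul_single (v l)
  conv_lhs => rw [h1]
  rw [A.map_sum, Finset.sum_mul]
  refine norm_sum_le_of_le _ fun i _ => ?_
  rw [A.map_smul_univ (fun l => v l (i l)) fun l => EuclideanSpace.single (i l) (1 : ℝ), norm_smul,
    mul_comm, norm_prod]
  exact mul_le_mul_of_nonneg_left (Finset.prod_le_prod (fun _ _ => norm_nonneg _)
    fun l _ => PiLp.norm_apply_le (v l) (i l)) (norm_nonneg _)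

/-- Only the monomials 1 and x_j^N are used: the largest of 1 and the |x_j| is at least (1 + ‖x‖)/(n
+ 1). The second factor (n + 1)^N counts the entries of the derivative tensor. -/
theorem pow_mul_norm_le_of_mem_unitClass {N k : ℕ} {Φ : 𝓢(Rn n, ℂ)} (hΦ : Φ ∈ unitClass n N)
    (hk : k ≤ N) (x : Rn n) :
    (1 + ‖x‖) ^ N * ‖iteratedFDeriv ℝ k Φ x‖ ≤ (n + 1) ^ N * (n + 1) ^ N := by
  obtain ⟨o, ho⟩ := Finite.exists_max fun o : Option (Fin n) => o.elim 1 fun j => |x j|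
  set c : ℝ := o.elim 1 fun j => |x j| with hc
  have hc1 : 1 ≤ c := ho none
  have hcj : ∀ j, |x j| ≤ c := fun j => ho (some j)
  have hx : 1 + ‖x‖ ≤ (n + 1) * c := by
    have h1 : ‖x‖ ≤ ∑ j, |x j| := by
      conv_lhs => rw [eq_sum_smul_single x]
      exact norm_sum_le_of_le _ fun j _ => by simp [norm_smul]
    have h2 : ∑ j, |x j| ≤ ∑ _j : Fin n, c := Finset.sum_le_sum fun j _ => hcj j
    simp at h2
    linarith
  have hα : ∃ α : Fin n → ℕ, ∑ j, α j ≤ N ∧ c ^ N = |∏ j, x j ^ α j| := by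
    cases o with
    | none => exact ⟨0, by simp, by simp [hc]⟩
    | some j =>
      refine ⟨Pi.single j N, by simp, ?_⟩
      rw [Finset.prod_eq_single j (fun i _ hi => by simp [hi]) (by simp)]
      simp [hc, abs_pow]
  obtain ⟨α, hα, hcα⟩ := hα
  have h1 : c ^ N * ‖iteratedFDeriv ℝ k Φ x‖ ≤ (n + 1) ^ N := by
    have h2 := norm_le_sum_single (iteratedFDeriv ℝ k Φ x)
    calc _ ≤ c ^ N * ∑ i : Fin k → Fin n,
          ‖iteratedFDeriv ℝ k Φ x fun l => EuclideanSpace.single (i l) (1 : ℝ)‖ := by gcongr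
      _ ≤ ∑ _i : Fin k → Fin n, (1 : ℝ) := by
          rw [Finset.mul_sum, hcα]
          exact Finset.sum_le_sum fun i _ => hΦ α hα k hk i x
      _ = (n : ℝ) ^ k := by simp
      _ ≤ ((n : ℝ) + 1) ^ k := by gcongr; linarith
      _ ≤ _ := pow_le_pow_right₀ (by linarith [Nat.cast_nonneg (α := ℝ) n]) hk
  calc _ ≤ ((n + 1) * c) ^ N * ‖iteratedFDeriv ℝ k Φ x‖ := by gcongr
    _ = (n + 1) ^ N * (c ^ N * ‖iteratedFDeriv ℝ k Φ x‖) := by rw [mul_pow, mul_assoc]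
    _ ≤ _ := by gcongr

theorem smoothGrowth_of_mem_unitClass {N : ℕ} {Φ : 𝓢(Rn n, ℂ)} (hΦ : Φ ∈ unitClass n N) :
    SmoothGrowth (-(N : ℝ)) N ((n + 1) ^ N * (n + 1) ^ N) Φ := by
  refine smoothGrowth_of_iteratedFDeriv (Φ.smooth ⊤) fun k hk x => ?_
  have hx : 0 < 1 + ‖x‖ := by positivity
  rw [Real.rpow_neg hx.le, ← div_eq_mul_inv, le_div_iff₀ (by positivity), Real.rpow_natCast, mul_comm]
  exact pow_mul_norm_le_of_mem_unitClass hΦ hk x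

theorem mem_unitClass_of_schwartzNorm_le {N : ℕ} {Φ : 𝓢(Rn n, ℂ)} (h : schwartzNorm N Φ ≤ 1) :
    Φ ∈ unitClass n N := by
  intro α hα k hk i x
  have h1 : |∏ j, x j ^ α j| ≤ (1 + ‖x‖) ^ N := by
    rw [Finset.abs_prod]
    calc _ ≤ ∏ j, (1 + ‖x‖) ^ α j := by
          refine Finset.prod_le_prod (fun _ _ => abs_nonneg _) fun j _ => ?_
          rw [abs_pow]
          gcongr
          linarith [PiLp.norm_apply_le x j, Real.norm_eq_abs (x j)]
      _ = (1 + ‖x‖) ^ (∑ j, α j) := Finset.prod_pow_eq_pow_sum _ _ _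
      _ ≤ _ := pow_le_pow_right₀ (by linarith [norm_nonneg x]) hα
  have h2 : ‖iteratedFDeriv ℝ k Φ x fun l => EuclideanSpace.single (i l) (1 : ℝ)‖ ≤
      ‖iteratedFDeriv ℝ k Φ x‖ := by
    simpa using (iteratedFDeriv ℝ k Φ x).le_opNorm fun l => EuclideanSpace.single (i l) (1 : ℝ)
  exact (mul_le_mul h1 h2 (norm_nonneg _) (by positivity)).trans
    ((le_schwartzNorm le_rfl hk Φ x).trans h)

theorem integral_mul_dilate (g : Rn n → ℂ) {t : ℝ} (ht : 0 < t) (Ψ : 𝓢(Rn n, ℂ)) :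
    ∫ z, g z * dilate t ht Ψ z = ∫ z, g (t • z) * Ψ z := by
  have h1 := Measure.integral_comp_smul (volume : Measure (Rn n)) (fun z => g z * Ψ (t⁻¹ • z)) t
  simp only [smul_smul, inv_mul_cancel₀ ht.ne', one_smul, finrank_euclideanSpace, Fintype.card_fin] at h1
  rw [h1, abs_of_nonneg (by positivity), ← integral_smul]
  congr 1; ext z
  rw [dilate_apply, Complex.real_smul]; ring

/-- The family `F` represents the convolutions of `f` with the dilations of `B`. -/
structure IsKernelFamily (f : 𝓢'(Rn n, ℂ)) (B : Rn n → ℂ) (K : ℝ) (F : ℝ → Rn n → ℂ) : Prop where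
  mem : ∀ s, 0 < s → F s ∈ growthSpace n K
  conv_mem : ∀ Ψ, conv f Ψ ∈ growthSpace n K
  comm : ∀ (Ψ : 𝓢(Rn n, ℂ)) s, 0 < s → ∀ x,
    ∫ w, B w * conv f Ψ (x - s • w) = ∫ z, F s (x - z) * Ψ z

/-- `f * Φ_s`, as a total function of `s`. -/
def dilConv (f : 𝓢'(Rn n, ℂ)) (Φ : 𝓢(Rn n, ℂ)) (s : ℝ) (x : Rn n) : ℂ :=
  (((s ^ n)⁻¹ : ℝ) : ℂ) * f (affine (-s⁻¹) (s⁻¹ • x) Φ)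

theorem conv_dilate (f : 𝓢'(Rn n, ℂ)) (Φ : 𝓢(Rn n, ℂ)) {s : ℝ} (hs : 0 < s) :
    conv f (dilate s hs Φ) = dilConv f Φ s := funext fun x => conv_dilate_eq f hs Φ x

/-- Growth comes from the finite order of f, and the exchange relation is the commutativity (f * Ψ)
* Φ_s = (f * Φ_s) * Ψ. -/
theorem exists_isKernelFamily (f : 𝓢'(Rn n, ℂ)) : ∃ K : ℕ, ∀ Φ : 𝓢(Rn n, ℂ),
    IsKernelFamily f Φ K (dilConv f Φ) := by
  obtain ⟨K, C, hC, h⟩ := exists_conv_growth f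
  have hm : ∀ Ψ, conv f Ψ ∈ growthSpace n K := fun Ψ =>
    ⟨continuous_conv f Ψ, C * schwartzNorm K Ψ, fun x => by simpa using h Ψ x⟩
  refine ⟨K, fun Φ => ⟨fun s hs => conv_dilate f Φ hs ▸ hm _, hm, fun Ψ s hs x => ?_⟩⟩
  rw [← conv_dilate f Φ hs, ← integral_conv_comm f (dilate s hs Φ) Ψ x,
    integral_mul_dilate (fun z => conv f Ψ (x - z)) hs Φ]
  simp only [mul_comm]

theorem growthSpace.comp_affine {K : ℝ} (hK : 0 ≤ K) {g : Rn n → ℂ} (hg : g ∈ growthSpace n K)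
    (x : Rn n) {t : ℝ} (ht : 0 < t) : (fun y => g (x + t • y)) ∈ growthSpace n K := by
  obtain ⟨hc, a, ha⟩ := hg
  have ha0 : 0 ≤ a := by
    have := (norm_nonneg _).trans (ha 0)
    simpa using this
  refine ⟨hc.comp (by fun_prop), a * ((1 + ‖x‖) * (1 + t)) ^ K, fun y => (ha _).trans ?_⟩
  rw [mul_assoc, ← Real.mul_rpow (by positivity) (by positivity)]
  gcongr
  calc 1 + ‖x + t • y‖ ≤ 1 + (‖x‖ + t * ‖y‖) := by
        gcongr
        refine (norm_add_le _ _).trans_eq ?_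
        rw [norm_smul, Real.norm_of_nonneg ht.le]
    _ ≤ _ := by
        have := norm_nonneg x
        have := norm_nonneg y
        have : 0 ≤ ‖x‖ * t + ‖x‖ * ‖y‖ + ‖x‖ * t * ‖y‖ + t + ‖y‖ := by positivity
        linarith

/-- Pointwise control of `f * Ψ_t` by the family `F`. -/
theorem IsKernelFamily.enorm_conv_dilate_le {R K : ℝ} {f : 𝓢'(Rn n, ℂ)} {B : AvgKernel n R}
    {F : ℝ → Rn n → ℂ} (h : IsKernelFamily f B.toFun K F) (hK : 0 ≤ K) (hR : n + K + 1 ≤ R)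
    {L a : ℝ} (hL : |-L| + 1 ≤ R) {m : ℕ} {Ψ : 𝓢(Rn n, ℂ)} (hΨ : SmoothGrowth (-L) m a Ψ)
    {t : ℝ} (ht : 0 < t) (x : Rn n) :
    ‖conv f (dilate t ht Ψ) x‖ₑ ≤
      ENNReal.ofReal ((m + 1) * (1 + absMoment B.toFun (|-L| + 1)) ^ m * (2 + 2 ^ m) * a) *
      ∑' k : ℕ, ENNReal.ofReal ((1 / 2) ^ (k * m)) *
        ∫⁻ z, ‖F ((1 / 2) ^ k * t) (x - t • z)‖ₑ * ENNReal.ofReal ((1 + ‖z‖) ^ (-L)) := by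
  have hn : (0 : ℝ) ≤ n := Nat.cast_nonneg n
  have hKa : |K| = K := abs_of_nonneg hK
  have hs : ∀ k : ℕ, 0 < (1 / 2 : ℝ) ^ k * t := fun k => by positivity
  have hF : ∀ k : ℕ, (fun y => F ((1 / 2) ^ k * t) (x + t • y)) ∈ growthSpace n K := fun k =>
    growthSpace.comp_affine hK (h.mem _ (hs k)) x ht
  have hKR : |K| ≤ R := by linarith
  have hLR : |(-((n : ℝ) + K + 1))| ≤ R := by rwa [abs_neg, abs_of_nonneg (by positivity)]
  -- The estimate at the origin is applied to y ↦ f * Ψ_t(x + t y), with L' = n + K + 1, large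
  -- enough for growth of order K.
  have := B.enorm_le hKR hLR (by linarith) hL
    ⟨_, growthSpace.comp_affine hK (h.conv_mem (dilate t ht Ψ)) x ht⟩
    (fun k y => F ((1 / 2) ^ k * t) (x + t • y)) hF ⟨Ψ, schwartz_mem_growthSpace Ψ _⟩ ?_ hΨ
  · simpa [sub_eq_add_neg] using this
  · intro k y
    rw [B.T_apply]
    have h1 := h.comm (dilate t ht Ψ) _ (hs k) (x + t • y)
    rw [integral_mul_dilate (fun z => F ((1 / 2) ^ k * t) (x + t • y - z)) ht Ψ] at h1
    calc _ = ∫ w, B.toFun w * conv f (dilate t ht Ψ) (x + t • y - ((1 / 2 : ℝ) ^ k * t) • w) := by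
          congr 1; ext w
          congr 1
          change conv f (dilate t ht Ψ) (x + t • (y - (1 / 2 : ℝ) ^ k • w)) = _
          rw [smul_sub, smul_smul, mul_comm t, add_sub_assoc]
      _ = _ := h1
      _ = _ := by
          congr 1; ext z
          congr 2
          rw [smul_sub]; abel

/-- A Schwartz function of integral `1` is an averaging kernel of every order. -/
def schwartzKernel (Φ : 𝓢(Rn n, ℂ)) (hΦ : ∫ x, Φ x = 1) (R : ℝ) : AvgKernel n R where
  toFun := Φ
  continuous := Φ.continuous
  integrable := integrable_schwartz_mul_rpow Φ R
  integral_eq_one := hΦ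

end

section

/-! ### Pointwise estimates for the maximal operator -/

section HardyLittlewood

variable {n : ℕ}

theorem volume_cube (a : Rn n) (r : ℝ) : volume (cube a r) = ENNReal.ofReal r ^ n := by
  have h : cube a r = WithLp.ofLp ⁻¹' Icc (fun i => a i) (fun i => a i + r) := by
    ext y
    simp only [cube, mem_ofPred_eq, mem_preimage, mem_Icc, Pi.le_def]
    exact ⟨fun h => ⟨fun i => (h i).1, fun i => (h i).2⟩, fun h i => ⟨h.1 i, h.2 i⟩⟩
  rw [h, (PiLp.volume_preserving_ofLp (Fin n)).measure_preimage measurableSet_Icc.nullMeasurableSet,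
    Real.volume_Icc_pi]
  simp

theorem closedBall_subset_cube (x : Rn n) (r : ℝ) :
    Metric.closedBall x r ⊆ cube (x - r • WithLp.toLp 2 fun _ => 1) (2 * r) := by
  intro y hy i
  have h1 := (PiLp.norm_apply_le (y - x) i).trans (mem_closedBall_iff_norm.1 hy)
  rw [Real.norm_eq_abs, PiLp.sub_apply] at h1
  have h2 := abs_le.1 h1
  simp only [PiLp.sub_apply, PiLp.smul_apply, smul_eq_mul, mul_one]
  constructor <;> linarith

theorem lintegral_closedBall_le (G : Rn n → ℝ≥0∞) (x : Rn n) {r : ℝ} (hr : 0 < r) :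
    ∫⁻ y in Metric.closedBall x r, G y ≤ ENNReal.ofReal (2 * r) ^ n * hlMaximal G x := by
  set a := x - r • WithLp.toLp 2 fun _ => (1 : ℝ)
  have hv := volume_cube a (2 * r)
  have h0 : ENNReal.ofReal (2 * r) ^ n ≠ 0 := pow_ne_zero _ (by simpa using hr)
  have h1 : ENNReal.ofReal (2 * r) ^ n ≠ ∞ := ENNReal.pow_ne_top ENNReal.ofReal_ne_top
  have h2 : (volume (cube a (2 * r)))⁻¹ * ∫⁻ y in cube a (2 * r), G y ≤ hlMaximal G x :=
    le_iSup_of_le a (le_iSup_of_le (2 * r) (le_iSup_of_le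
      ⟨by positivity, closedBall_subset_cube x r (Metric.mem_closedBall_self hr.le)⟩ le_rfl))
  rw [hv, ENNReal.inv_mul_le_iff h0 h1] at h2
  exact (lintegral_mono_set (closedBall_subset_cube x r)).trans h2

/-- The constant of `lintegral_mul_rpow_le`. -/
def decayConst (n : ℕ) (L : ℝ) : ℝ≥0∞ :=
  ∑' j : ℕ, ENNReal.ofReal ((2 : ℝ) ^ L * 2 ^ n * ((2 : ℝ) ^ ((n : ℝ) - L)) ^ j)

theorem decayConst_ne_top {L : ℝ} (hL : (n : ℝ) < L) : decayConst n L ≠ ∞ := by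
  refine Summable.tsum_ofReal_ne_top (Summable.mul_left _
    (summable_geometric_of_lt_one (by positivity) ?_))
  exact Real.rpow_lt_one_of_one_lt_of_neg (by norm_num) (by linarith)

/-- One term suffices, that of the smallest dyadic ball containing y. Minimality gives 2^(j-1) ≤ 1 +
‖x - y‖/s, hence the factor 2^L. -/
theorem rpow_neg_le_indicator_tsum {L : ℝ} (hL : 0 ≤ L) (x y : Rn n) {s : ℝ} (hs : 0 < s) :
    ENNReal.ofReal ((1 + ‖x - y‖ / s) ^ (-L)) ≤ ∑' j : ℕ,
      (Metric.closedBall x (2 ^ j * s)).indicator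
        (fun _ => ENNReal.ofReal ((2 : ℝ) ^ L * ((2 : ℝ) ^ (-L)) ^ j)) y := by
  have hex : ∃ j : ℕ, ‖x - y‖ / s ≤ 2 ^ j :=
    (pow_unbounded_of_one_lt (‖x - y‖ / s) (by norm_num : (1 : ℝ) < 2)).imp fun _ h => h.le
  classical
  obtain ⟨j, hj, hmin⟩ : ∃ j : ℕ, ‖x - y‖ / s ≤ 2 ^ j ∧ ∀ i < j, 2 ^ i < ‖x - y‖ / s :=
    ⟨Nat.find hex, Nat.find_spec hex, fun i hi => not_le.1 (Nat.find_min hex hi)⟩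
  refine le_trans ?_ (ENNReal.le_tsum j)
  rw [indicator_of_mem]
  · apply ENNReal.ofReal_le_ofReal
    have h1 : (2 : ℝ) ^ ((j : ℝ) - 1) ≤ 1 + ‖x - y‖ / s := by
      cases j with
      | zero =>
        have : (0 : ℝ) ≤ ‖x - y‖ / s := by positivity
        refine (Real.rpow_le_one_of_one_le_of_nonpos (by norm_num) (by simp)).trans ?_
        linarith
      | succ i =>
        have := (hmin i (Nat.lt_succ_self i)).le
        rw [Nat.cast_succ, add_sub_cancel_right, Real.rpow_natCast]
        linarith
    refine (Real.rpow_le_rpow_of_nonpos (by positivity) h1 (by linarith)).trans (le_of_eq ?_)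
    rw [← Real.rpow_mul (by norm_num), ← Real.rpow_natCast ((2 : ℝ) ^ (-L)) j,
      ← Real.rpow_mul (by norm_num), ← Real.rpow_add (by norm_num)]
    congr 1; ring
  · rw [mem_closedBall_iff_norm, norm_sub_rev]
    exact (div_le_iff₀ hs).1 hj

/-- Summing averages over the balls of radius 2^j s gives a geometric series of ratio 2^(n-L). No
condition L > n is imposed: otherwise the constant is infinite. -/
theorem lintegral_mul_rpow_le {L : ℝ} (hL : 0 ≤ L) {G : Rn n → ℝ≥0∞} (hG : Measurable G) (x : Rn n)
    {s : ℝ} (hs : 0 < s) :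
    ENNReal.ofReal ((s ^ n)⁻¹) * ∫⁻ y, G y * ENNReal.ofReal ((1 + ‖x - y‖ / s) ^ (-L)) ≤
      decayConst n L * hlMaximal G x := by
  have hm : ∀ j : ℕ, Measurable ((Metric.closedBall x (2 ^ j * s)).indicator
        (fun _ => ENNReal.ofReal ((2 : ℝ) ^ L * ((2 : ℝ) ^ (-L)) ^ j))) := fun j =>
    measurable_const.indicator Metric.isClosed_closedBall.measurableSet
  calc _ ≤ ENNReal.ofReal ((s ^ n)⁻¹) * ∫⁻ y, ∑' j : ℕ, G y *
        (Metric.closedBall x (2 ^ j * s)).indicator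
        (fun _ => ENNReal.ofReal ((2 : ℝ) ^ L * ((2 : ℝ) ^ (-L)) ^ j)) y := by
        gcongr with y
        rw [ENNReal.tsum_mul_left]
        gcongr
        exact rpow_neg_le_indicator_tsum hL x y hs
    _ = ENNReal.ofReal ((s ^ n)⁻¹) * ∑' j : ℕ,
        (∫⁻ y in Metric.closedBall x (2 ^ j * s), G y) *
          ENNReal.ofReal ((2 : ℝ) ^ L * ((2 : ℝ) ^ (-L)) ^ j) := by
        rw [lintegral_tsum fun j => (show Measurable fun y => G y * _ from hG.mul (hm j)).aemeasurable]
        congr 2; ext j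
        rw [← lintegral_mul_const _ hG, ← lintegral_indicator Metric.isClosed_closedBall.measurableSet]
        congr 1; ext y
        by_cases hy : y ∈ Metric.closedBall x (2 ^ j * s) <;> simp [hy]
    _ ≤ ENNReal.ofReal ((s ^ n)⁻¹) * ∑' j : ℕ,
        (ENNReal.ofReal (2 * (2 ^ j * s)) ^ n * hlMaximal G x) *
          ENNReal.ofReal ((2 : ℝ) ^ L * ((2 : ℝ) ^ (-L)) ^ j) := by
        gcongr with j
        exact lintegral_closedBall_le G x (by positivity)
    _ = _ := by
        rw [decayConst, ← ENNReal.tsum_mul_left, ← ENNReal.tsum_mul_right]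
        congr 1; ext j
        rw [mul_right_comm, ← mul_assoc, ← mul_assoc, ← ENNReal.ofReal_pow (by positivity),
          ← ENNReal.ofReal_mul (by positivity), ← ENNReal.ofReal_mul (by positivity)]
        congr 2
        rw [mul_pow, mul_pow, sub_eq_add_neg, Real.rpow_add (by norm_num), Real.rpow_natCast,
          mul_pow ((2 : ℝ) ^ n), ← pow_mul 2 j n, ← pow_mul 2 n j, mul_comm n j]
        field_simp

/-- A function dominating `c` near `y` has a large maximal function. -/
theorem le_mul_hlMaximal {G : Rn n → ℝ≥0∞} {c : ℝ≥0∞} {y : Rn n} {s : ℝ} (hs : 0 < s)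
    (h : ∀ z, ‖z - y‖ < s → c ≤ G z) (x : Rn n) :
    c ≤ (2 ^ n * (volume (Metric.ball (0 : Rn n) 1))⁻¹) * ENNReal.ofReal ((1 + ‖x - y‖ / s) ^ n) *
      hlMaximal G x := by
  set V := volume (Metric.ball (0 : Rn n) 1) with hV
  have hV0 : V ≠ 0 := (Metric.measure_ball_pos _ _ one_pos).ne'
  have hV1 : V ≠ ∞ := measure_ball_lt_top.ne
  have hb : volume (Metric.ball y s) = ENNReal.ofReal (s ^ n) * V := by
    rw [Measure.addHaar_ball_of_pos _ _ hs, finrank_euclideanSpace, Fintype.card_fin]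
  -- The ball about y of radius s lies in the ball about x of radius s + ‖x - y‖; the ratio of their
  -- volumes is the factor (1 + ‖x - y‖/s)^n.
  have h1 : c * volume (Metric.ball y s) ≤
      ENNReal.ofReal (2 * (s + ‖x - y‖)) ^ n * hlMaximal G x := by
    refine le_trans ?_ (lintegral_closedBall_le G x (by positivity))
    rw [← setLIntegral_const]
    refine (setLIntegral_mono' measurableSet_ball fun z hz =>
      h z (mem_ball_iff_norm.1 hz)).trans (lintegral_mono_set fun z hz => ?_)
    rw [mem_closedBall_iff_norm]
    rw [mem_ball_iff_norm] at hz
    calc ‖z - x‖ = ‖(z - y) - (x - y)‖ := by congr 1; abel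
      _ ≤ ‖z - y‖ + ‖x - y‖ := norm_sub_le _ _
      _ ≤ _ := by linarith
  rw [hb] at h1
  have hs0 : ENNReal.ofReal (s ^ n) ≠ 0 := by simpa using pow_pos hs n
  have e1 : ENNReal.ofReal (2 * (s + ‖x - y‖)) ^ n =
      ENNReal.ofReal (s ^ n) * (2 ^ n * ENNReal.ofReal ((1 + ‖x - y‖ / s) ^ n)) := by
    rw [← ENNReal.ofReal_pow (by positivity), show (2 : ℝ≥0∞) ^ n = ENNReal.ofReal (2 ^ n) by
      rw [ENNReal.ofReal_pow (by norm_num)]; norm_num, ← ENNReal.ofReal_mul (by positivity),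
      ← ENNReal.ofReal_mul (by positivity)]
    congr 1
    rw [← mul_pow, ← mul_pow]
    congr 1
    field_simp
  rw [e1, mul_left_comm, mul_assoc (ENNReal.ofReal (s ^ n)),
    ENNReal.mul_le_mul_iff_right hs0 ENNReal.ofReal_ne_top] at h1
  calc c = c * V * V⁻¹ := by rw [mul_assoc, ENNReal.mul_inv_cancel hV0 hV1, mul_one]
    _ ≤ 2 ^ n * ENNReal.ofReal ((1 + ‖x - y‖ / s) ^ n) * hlMaximal G x * V⁻¹ := by gcongr
    _ = _ := by ring

/-- Jensen's inequality for the maximal function. -/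
theorem hlMaximal_le_rpow {G : Rn n → ℝ≥0∞} (hG : Measurable G) {q : ℝ} (hq : 1 ≤ q) (x : Rn n) :
    hlMaximal G x ≤ hlMaximal (fun y => G y ^ q) x ^ (1 / q) := by
  have hq0 : 0 < q := by linarith
  refine iSup_le fun a => iSup_le fun r => iSup_le fun har => ?_
  set μ := (volume (cube a r))⁻¹ • volume.restrict (cube a r) with hμ
  have hv := volume_cube a r
  have hp : IsProbabilityMeasure μ := ⟨by
    rw [hμ, Measure.smul_apply, Measure.restrict_apply_univ, smul_eq_mul, hv]
    exact ENNReal.inv_mul_cancel (pow_ne_zero _ (by simpa using har.1))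
      (ENNReal.pow_ne_top ENNReal.ofReal_ne_top)⟩
  -- Averaging over a cube is integration against a probability measure, for which L^q norms
  -- increase with q.
  have h1 := eLpNorm'_le_eLpNorm'_of_exponent_le (μ := μ) one_pos hq hG.aestronglyMeasurable
  simp only [eLpNorm', enorm_eq_self, ENNReal.rpow_one, hμ, lintegral_smul_measure, smul_eq_mul,
    div_one] at h1
  refine h1.trans (ENNReal.rpow_le_rpow ?_ (by positivity))
  exact le_iSup_of_le a (le_iSup_of_le r (le_iSup_of_le har le_rfl))

theorem lintegral_comp_sub_smul {G : Rn n → ℝ≥0∞} (x : Rn n) {s : ℝ} (hs : 0 < s) :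
    ∫⁻ z, G (x - s • z) = ENNReal.ofReal ((s ^ n)⁻¹) * ∫⁻ y, G y := by
  have e : MeasurableEmbedding fun z : Rn n => s • z :=
    (Homeomorph.smulOfNeZero s hs.ne').isClosedEmbedding.measurableEmbedding
  have h1 := e.lintegral_map (μ := volume) fun y => G (x - y)
  rw [← h1, Measure.map_addHaar_smul _ hs.ne', lintegral_smul_measure,
    lintegral_sub_left_eq_self, finrank_euclideanSpace, Fintype.card_fin,
    abs_of_nonneg (by positivity), smul_eq_mul]

end HardyLittlewood

end

section

/-! ### Variable exponent quasi-norms -/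

section VarNorm

variable {n : ℕ} {p : Rn n → ℝ}

theorem varNorm_le {F : Rn n → ℝ≥0∞} {c : ℝ} (hc : 0 < c)
    (h : modular p (fun x => F x / ENNReal.ofReal c) ≤ 1) : varNorm p F ≤ ENNReal.ofReal c :=
  iInf₂_le c ⟨hc, h⟩

theorem modular_mono (hp : ∀ x, 0 ≤ p x) {F G : Rn n → ℝ≥0∞} (h : ∀ x, F x ≤ G x) :
    modular p F ≤ modular p G :=
  lintegral_mono fun x => ENNReal.rpow_le_rpow (h x) (hp x)

theorem varNorm_mono (hp : ∀ x, 0 ≤ p x) {F G : Rn n → ℝ≥0∞} (h : ∀ x, F x ≤ G x) :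
    varNorm p F ≤ varNorm p G :=
  le_iInf₂ fun _ hc => varNorm_le hc.1
    ((modular_mono hp fun x => ENNReal.div_le_div_right (h x) _).trans hc.2)

theorem varNorm_const_mul_le {C : ℝ≥0} (hC : 0 < C) (F : Rn n → ℝ≥0∞) :
    varNorm p (fun x => C * F x) ≤ C * varNorm p F := by
  have hC0 : (C : ℝ≥0∞) ≠ 0 := by simpa using hC.ne'
  rw [mul_comm, ← ENNReal.div_le_iff hC0 ENNReal.coe_ne_top]
  refine le_iInf₂ fun c hc => ?_
  rw [ENNReal.div_le_iff hC0 ENNReal.coe_ne_top]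
  have h1 : ENNReal.ofReal c * C = ENNReal.ofReal (c * C) := by
    rw [ENNReal.ofReal_mul hc.1.le, ENNReal.ofReal_coe_nnreal]
  rw [h1]
  refine varNorm_le (mul_pos hc.1 (by exact_mod_cast hC)) (le_trans (le_of_eq ?_) hc.2)
  congr 1; ext x
  rw [← h1, mul_comm (C : ℝ≥0∞) (F x), ENNReal.mul_div_mul_right _ _ hC0 ENNReal.coe_ne_top]

/-- An admissible c for F gives the admissible c^q for F^q, with the same modular. -/
theorem varNorm_rpow_le {q : ℝ} (hq : 0 < q) (F : Rn n → ℝ≥0∞) :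
    varNorm (fun x => p x / q) (fun x => F x ^ q) ≤ varNorm p F ^ q := by
  rw [← ENNReal.rpow_inv_le_iff hq]
  refine le_iInf₂ fun c hc => ?_
  rw [ENNReal.rpow_inv_le_iff hq, ENNReal.ofReal_rpow_of_pos hc.1]
  refine varNorm_le (Real.rpow_pos_of_pos hc.1 q) (le_trans (le_of_eq ?_) hc.2)
  unfold modular
  congr 1; ext x
  dsimp only
  rw [← ENNReal.ofReal_rpow_of_pos hc.1, ← ENNReal.div_rpow_of_nonneg _ _ hq.le, ← ENNReal.rpow_mul,
    mul_div_cancel₀ _ hq.ne']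

theorem varNorm_le_rpow {q : ℝ} (hq : 0 < q) (F : Rn n → ℝ≥0∞) :
    varNorm p (fun x => F x ^ (1 / q)) ≤ varNorm (fun x => p x / q) F ^ (1 / q) := by
  have := varNorm_rpow_le (p := fun x => p x / q) (one_div_pos.2 hq) F
  convert this using 2
  ext x
  field_simp

variable {p₀ : ℝ}

theorem MemVarLp.of_varNorm_lt_top {F : Rn n → ℝ≥0∞} (hF : AEMeasurable F)
    (h : varNorm p F < ∞) : MemVarLp p F := by
  refine ⟨hF, ?_⟩
  obtain ⟨c, hc⟩ := iInf_lt_iff.1 h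
  obtain ⟨hc, -⟩ := iInf_lt_iff.1 hc
  exact ⟨c, hc.1, hc.2.trans_lt ENNReal.one_lt_top⟩

theorem IsMP0.ae_lt (hp : IsMP0 p p₀) : ∀ᵐ x, p₀ < p x := by
  filter_upwards [ae_lt_of_lt_essInf hp.p₀_lt] with x hx
  exact_mod_cast hx

/-- As p > p₀ almost everywhere, dividing further by l ≥ 1 reduces the modular A at least by the
factor l^p₀; the choice l^p₀ = 1 + A brings it below 1. -/
theorem IsMP0.varNorm_lt_top (hp : IsMP0 p p₀) {F : Rn n → ℝ≥0∞} (h : MemVarLp p F) :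
    varNorm p F < ∞ := by
  obtain ⟨-, c, hc, hA⟩ := h
  set A := modular p (fun x => F x / ENNReal.ofReal c) with hAdef
  set l : ℝ := (1 + A.toReal) ^ (1 / p₀) with hl
  have hp₀ := hp.p₀_pos
  have hA0 : (0 : ℝ) ≤ A.toReal := ENNReal.toReal_nonneg
  have hl1 : 1 ≤ l := Real.one_le_rpow (by linarith) (by positivity)
  have hl0 : 0 < l := by linarith
  have hlp : l ^ p₀ = 1 + A.toReal := by
    rw [hl, ← Real.rpow_mul (by positivity), one_div_mul_cancel hp₀.ne', Real.rpow_one]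
  refine (varNorm_le (c := c * l) (mul_pos hc hl0) ?_).trans_lt ENNReal.ofReal_lt_top
  have h1 : modular p (fun x => F x / ENNReal.ofReal (c * l)) ≤
      (∫⁻ x, (F x / ENNReal.ofReal c) ^ p x * (ENNReal.ofReal (1 + A.toReal))⁻¹) := by
    refine lintegral_mono_ae ?_
    filter_upwards [hp.ae_lt] with x hx
    have hpx := hp.isExponent.pos x
    have e : F x / ENNReal.ofReal (c * l) = F x / ENNReal.ofReal c * (ENNReal.ofReal l)⁻¹ := by
      simp only [div_eq_mul_inv]
      rw [ENNReal.ofReal_mul hc.le, ENNReal.mul_inv (by simp) (by simp), mul_assoc]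
    rw [e, ENNReal.mul_rpow_of_nonneg _ _ hpx.le, ENNReal.inv_rpow, ENNReal.ofReal_rpow_of_pos hl0]
    gcongr
    rw [← hlp]
    exact Real.rpow_le_rpow_of_exponent_le hl1 hx.le
  refine h1.trans ?_
  have hpos : (0 : ℝ) < 1 + A.toReal := by linarith
  rw [lintegral_mul_const' _ _ (by simpa using hpos), ← modular, ← hAdef, ← div_eq_mul_inv]
  refine ENNReal.div_le_of_le_mul ?_
  rw [one_mul, ENNReal.ofReal_add zero_le_one hA0, ENNReal.ofReal_toReal hA.ne]
  exact le_add_self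

/-- The boundedness of M on L^{p(·)/p₀} enters only here, applied to F^p₀ and followed by a p₀-th
root. Every passage between maximal functions that costs an application of M goes through this
lemma. -/
theorem IsMP0.varNorm_le_of_le_hlMaximal (hp : IsMP0 p p₀) : ∃ C₁ : ℝ≥0, 0 < C₁ ∧
    ∀ (C : ℝ≥0) (F H : Rn n → ℝ≥0∞), Measurable F →
      (∀ x, H x ≤ C * hlMaximal (fun y => F y ^ p₀) x ^ (1 / p₀)) →
      varNorm p H ≤ (C + 1) * C₁ * varNorm p F := by
  obtain ⟨C₀, hC₀⟩ := hp.maximal_bounded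
  have hp₀ := hp.p₀_pos
  have hp0 : ∀ x, 0 ≤ p x := fun x => (hp.isExponent.pos x).le
  have hC₁ : 0 < (C₀ + 1) ^ (1 / p₀) := NNReal.rpow_pos (by positivity)
  refine ⟨(C₀ + 1) ^ (1 / p₀), hC₁, fun C F H hF h => ?_⟩
  -- The hypothesis on M concerns members of the space, so infinite norm is treated apart; the
  -- constants C + 1 and C₁ are nonzero so that the right side is then ∞.
  by_cases htop : varNorm p F = ∞
  · rw [htop, ENNReal.mul_top]
    · exact le_top
    · exact mul_ne_zero (by simp) (by exact_mod_cast hC₁.ne')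
  have h1 : varNorm (fun x => p x / p₀) (fun x => F x ^ p₀) ≤ varNorm p F ^ p₀ := varNorm_rpow_le hp₀ F
  have h2 : MemVarLp (fun x => p x / p₀) (fun x => F x ^ p₀) :=
    MemVarLp.of_varNorm_lt_top (hF.pow_const p₀).aemeasurable
      (h1.trans_lt (ENNReal.rpow_lt_top_of_nonneg hp₀.le htop))
  have h3 : varNorm p (fun x => hlMaximal (fun y => F y ^ p₀) x ^ (1 / p₀)) ≤
      ((C₀ + 1) ^ (1 / p₀) : ℝ≥0) * varNorm p F := by
    refine (varNorm_le_rpow hp₀ _).trans ?_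
    calc _ ≤ (C₀ * varNorm p F ^ p₀) ^ (1 / p₀) := by
          gcongr
          exact (hC₀ _ h2).trans (by gcongr)
      _ ≤ ((C₀ + 1 : ℝ≥0) * varNorm p F ^ p₀) ^ (1 / p₀) := by
          gcongr
          exact le_self_add
      _ = _ := by
          rw [ENNReal.mul_rpow_of_nonneg _ _ (by positivity), ← ENNReal.rpow_mul,
            mul_one_div_cancel hp₀.ne', ENNReal.rpow_one, ENNReal.coe_rpow_of_nonneg _ (by positivity)]
  calc varNorm p H ≤ varNorm p (fun x => ((C + 1 : ℝ≥0) : ℝ≥0∞) *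
        hlMaximal (fun y => F y ^ p₀) x ^ (1 / p₀)) := by
        refine varNorm_mono hp0 fun x => (h x).trans ?_
        gcongr
        exact le_self_add
    _ ≤ (C + 1 : ℝ≥0) * (((C₀ + 1) ^ (1 / p₀) : ℝ≥0) * varNorm p F) :=
        (varNorm_const_mul_le (by positivity) _).trans (by gcongr)
    _ = _ := by push_cast; ring

/-- If c exceeds an admissible l, then (c/l)^p₀ ≤ (F/l)^p on the ball, whose volume does not depend
on its centre. The modular bound 1 then limits c uniformly in x. -/
theorem IsMP0.exists_le_of_le_on_ball (hp : IsMP0 p p₀) {F : Rn n → ℝ≥0∞} (hF : varNorm p F < ∞) :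
    ∃ A : ℝ≥0, ∀ (c : ℝ≥0∞) (x : Rn n), (∀ y ∈ Metric.ball x 1, c ≤ F y) → c ≤ A := by
  obtain ⟨l, hl⟩ := iInf_lt_iff.1 hF
  obtain ⟨⟨hl0, hl1⟩, -⟩ := iInf_lt_iff.1 hl
  have hp₀ := hp.p₀_pos
  set V := volume (Metric.ball (0 : Rn n) 1) with hV
  have hV0 : V ≠ 0 := (Metric.measure_ball_pos _ _ one_pos).ne'
  have hV1 : V ≠ ∞ := measure_ball_lt_top.ne
  have hll : ENNReal.ofReal l ≠ 0 := by simpa using hl0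
  have hA : ENNReal.ofReal l * (1 + (V⁻¹) ^ (1 / p₀)) ≠ ∞ := by
    refine ENNReal.mul_ne_top ENNReal.ofReal_ne_top (ENNReal.add_ne_top.2 ⟨by simp, ?_⟩)
    exact ENNReal.rpow_ne_top_of_nonneg (by positivity) (by simpa using hV0)
  refine ⟨(ENNReal.ofReal l * (1 + (V⁻¹) ^ (1 / p₀))).toNNReal, fun c x hc => ?_⟩
  rw [ENNReal.coe_toNNReal hA, mul_comm, ← ENNReal.div_le_iff hll ENNReal.ofReal_ne_top]
  rcases le_total (c / ENNReal.ofReal l) 1 with h | h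
  · exact h.trans le_self_add
  · refine le_trans ?_ le_add_self
    rw [one_div, ENNReal.le_rpow_inv_iff hp₀, ENNReal.le_inv_iff_mul_le]
    refine le_trans ?_ hl1
    rw [hV, ← Measure.addHaar_ball_center volume x 1, ← setLIntegral_const]
    refine (setLIntegral_mono_ae' measurableSet_ball ?_).trans (setLIntegral_le_lintegral _ _)
    filter_upwards [hp.ae_lt] with y hy hyx
    calc _ ≤ (c / ENNReal.ofReal l) ^ p y := ENNReal.rpow_le_rpow_of_exponent_le h hy.le
      _ ≤ _ := ENNReal.rpow_le_rpow (ENNReal.div_le_div_right (hc y hyx) _)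
          (hp.isExponent.pos y).le

end VarNorm

end

section

/-! ### Peetre-type maximal functions -/

section Nontangential

variable {n : ℕ}

/-- `IsKernelFamily.enorm_conv_dilate_le` after a change of variables. -/
theorem IsKernelFamily.enorm_conv_dilate_le' {R K : ℝ} {f : 𝓢'(Rn n, ℂ)} {B : AvgKernel n R}
    {F : ℝ → Rn n → ℂ} (h : IsKernelFamily f B.toFun K F) (hK : 0 ≤ K) (hR : n + K + 1 ≤ R)
    {L a : ℝ} (hL : |-L| + 1 ≤ R) {m : ℕ} {Ψ : 𝓢(Rn n, ℂ)} (hΨ : SmoothGrowth (-L) m a Ψ)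
    {t : ℝ} (ht : 0 < t) (x : Rn n) :
    ‖conv f (dilate t ht Ψ) x‖ₑ ≤
      ENNReal.ofReal ((m + 1) * (1 + absMoment B.toFun (|-L| + 1)) ^ m * (2 + 2 ^ m) * a) *
      ∑' k : ℕ, ENNReal.ofReal ((1 / 2) ^ (k * m)) * (ENNReal.ofReal ((t ^ n)⁻¹) *
        ∫⁻ y, ‖F ((1 / 2) ^ k * t) y‖ₑ * ENNReal.ofReal ((1 + ‖x - y‖ / t) ^ (-L))) := by
  refine (h.enorm_conv_dilate_le hK hR hL hΨ ht x).trans (le_of_eq ?_)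
  congr 2; ext k
  congr 1
  rw [← lintegral_comp_sub_smul x ht]
  congr 1; ext z
  rw [sub_sub_cancel, norm_smul, Real.norm_of_nonneg ht.le, mul_div_cancel_left₀ _ ht.ne']

/-- The reproducing estimate with B = Ψ = Φ. The moment order R must follow the order of f, but the
constant sees only the moment of order |-L| + 1, so it is uniform in f. -/
theorem exists_enorm_dilConv_le (Φ : 𝓢(Rn n, ℂ)) (hΦ : ∫ x, Φ x = 1) (L : ℝ) (m : ℕ) :
    ∃ C : ℝ≥0, ∀ (f : 𝓢'(Rn n, ℂ)) (t : ℝ), 0 < t → ∀ x, ‖dilConv f Φ t x‖ₑ ≤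
      C * ∑' k : ℕ, ENNReal.ofReal ((1 / 2) ^ (k * m)) * (ENNReal.ofReal ((t ^ n)⁻¹) *
        ∫⁻ y, ‖dilConv f Φ ((1 / 2) ^ k * t) y‖ₑ * ENNReal.ofReal ((1 + ‖x - y‖ / t) ^ (-L))) := by
  obtain ⟨a, ha⟩ := exists_smoothGrowth Φ (-L) m
  refine ⟨((m + 1) * (1 + absMoment Φ (|-L| + 1)) ^ m * (2 + 2 ^ m) * a).toNNReal,
    fun f t ht x => ?_⟩
  obtain ⟨K, hK⟩ := exists_isKernelFamily f
  have := (show IsKernelFamily f (schwartzKernel Φ hΦ (max (n + K + 1) (|-L| + 1))).toFun K _ from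
    hK Φ).enorm_conv_dilate_le' K.cast_nonneg (le_max_left _ _) (le_max_right _ _) ha ht x
  rwa [conv_dilate] at this

/-- The weight `2 ^ (-l M) (1 + |x - z| / (2 ^ (-l) t)) ^ (-L)`. -/
def peetreWeight (M : ℕ) (L : ℝ) (x : Rn n) (t : ℝ) (l : ℕ) (z : Rn n) : ℝ :=
  (1 / 2) ^ (l * M) * (1 + ‖x - z‖ / ((1 / 2) ^ l * t)) ^ (-L)

theorem peetreWeight_nonneg (M : ℕ) (L : ℝ) (x : Rn n) {t : ℝ} (ht : 0 < t) (l : ℕ) (z : Rn n) :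
    0 ≤ peetreWeight M L x t l z := by
  unfold peetreWeight; positivity

theorem one_add_div_half_pow_le {d t : ℝ} (ht : 0 < t) (l k : ℕ) :
    1 + d / ((1 / 2) ^ (l + k) * t) ≤ 2 ^ k * (1 + d / ((1 / 2) ^ l * t)) := by
  have h1 : d / ((1 / 2) ^ (l + k) * t) = 2 ^ k * (d / ((1 / 2) ^ l * t)) := by
    rw [pow_add]
    field_simp
    rw [mul_assoc, ← mul_pow]; norm_num
  have h2 : (1 : ℝ) ≤ 2 ^ k := one_le_pow₀ (by norm_num)
  rw [h1, mul_add]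
  linarith

theorem one_add_norm_sub_div_le (x y z : Rn n) {s : ℝ} (hs : 0 < s) :
    1 + ‖x - y‖ / s ≤ (1 + ‖x - z‖ / s) * (1 + ‖z - y‖ / s) := by
  have h1 : ‖x - y‖ / s ≤ ‖x - z‖ / s + ‖z - y‖ / s := by
    rw [← add_div]
    gcongr
    exact norm_sub_le_norm_sub_add_norm_sub x z y
  have : 0 ≤ ‖x - z‖ / s * (‖z - y‖ / s) := by positivity
  linarith

theorem half_pow_mul_le {M m : ℕ} {L : ℝ} (hm : M + L ≤ m) (k : ℕ) :
    ((1 : ℝ) / 2) ^ (k * m) ≤ (1 / 2) ^ (k * M) * (2 ^ k) ^ (-L) := by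
  have e1 : ((2 : ℝ) ^ k) ^ (-L) = (1 / 2) ^ (k * L) := by
    rw [one_div, Real.inv_rpow (by norm_num), ← Real.rpow_neg (by norm_num), ← Real.rpow_natCast,
      ← Real.rpow_mul (by norm_num)]
    congr 1; ring
  rw [e1, ← Real.rpow_natCast, ← Real.rpow_natCast, ← Real.rpow_add (by norm_num)]
  refine Real.rpow_le_rpow_of_exponent_ge (by norm_num) (by norm_num) ?_
  push_cast
  rw [← mul_add]
  gcongr

/-- Refining the scale by 2^(-k) costs 2^(kM) in the first factor of the weight and 2^(kL) in the
second; m ≥ M + L pays for both. This lets the reproducing estimate be inserted into the supremum it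
is to bound. -/
theorem peetreWeight_mul_le {M m : ℕ} {L : ℝ} (hL : 0 ≤ L) (hm : M + L ≤ m) (x y z : Rn n) {t : ℝ}
    (ht : 0 < t) (l k : ℕ) :
    peetreWeight M L x t l z * ((1 / 2) ^ (k * m) * (1 + ‖z - y‖ / ((1 / 2) ^ l * t)) ^ (-L)) ≤
      peetreWeight M L x t (l + k) y := by
  have hs : 0 < (1 / 2) ^ l * t := by positivity
  have hs' : 0 < (1 / 2) ^ (l + k) * t := by positivity
  have h1 : 1 + ‖x - y‖ / ((1 / 2) ^ (l + k) * t) ≤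
      2 ^ k * ((1 + ‖x - z‖ / ((1 / 2) ^ l * t)) * (1 + ‖z - y‖ / ((1 / 2) ^ l * t))) :=
    (one_add_div_half_pow_le ht l k).trans (by
      gcongr; exact one_add_norm_sub_div_le x y z hs)
  have h2 := Real.rpow_le_rpow_of_nonpos (by positivity) h1 (neg_nonpos.2 hL)
  rw [Real.mul_rpow (by positivity) (by positivity), Real.mul_rpow (by positivity) (by positivity)] at h2
  have h3 := half_pow_mul_le hm k
  unfold peetreWeight
  calc _ ≤ (1 / 2 : ℝ) ^ (l * M) * (1 + ‖x - z‖ / ((1 / 2) ^ l * t)) ^ (-L) *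
        (((1 / 2) ^ (k * M) * (2 ^ k) ^ (-L)) * (1 + ‖z - y‖ / ((1 / 2) ^ l * t)) ^ (-L)) := by
        gcongr
    _ = (1 / 2) ^ ((l + k) * M) * ((2 ^ k) ^ (-L) * ((1 + ‖x - z‖ / ((1 / 2) ^ l * t)) ^ (-L) *
        (1 + ‖z - y‖ / ((1 / 2) ^ l * t)) ^ (-L))) := by rw [add_mul, pow_add]; ring
    _ ≤ _ := by gcongr

/-- Moving the centre from z to x at the unrefined scale costs (1 + ‖x - z‖/s)^L, and the finer
scales are paid for by M' ≥ M + L. It transfers information from large exponents, possibly depending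
on f, to fixed ones. -/
theorem peetreWeight_le_center {M M' : ℕ} {L L' : ℝ} (hL : 0 ≤ L) (hM : M + L ≤ M') (hL' : L ≤ L')
    (x y z : Rn n) {s : ℝ} (hs : 0 < s) (k : ℕ) :
    peetreWeight M' L' z s k y ≤ (1 + ‖x - z‖ / s) ^ L * peetreWeight M L x s k y := by
  have hs' : 0 < (1 / 2) ^ k * s := by positivity
  have hzy : 0 < 1 + ‖z - y‖ / ((1 / 2) ^ k * s) := by positivity
  have hxz : 0 < 1 + ‖x - z‖ / s := by positivity
  have h0 : (1 + ‖z - y‖ / ((1 / 2) ^ k * s)) ^ (-L') ≤ (1 + ‖z - y‖ / ((1 / 2) ^ k * s)) ^ (-L) :=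
    Real.rpow_le_rpow_of_exponent_le (by
      have : 0 ≤ ‖z - y‖ / ((1 / 2) ^ k * s) := by positivity
      linarith) (by linarith)
  have h1 : 1 + ‖x - y‖ / ((1 / 2) ^ k * s) ≤
      (2 ^ k * (1 + ‖x - z‖ / s)) * (1 + ‖z - y‖ / ((1 / 2) ^ k * s)) := by
    refine (one_add_norm_sub_div_le x y z hs').trans ?_
    gcongr
    simpa using one_add_div_half_pow_le (d := ‖x - z‖) hs 0 k
  have h2 := Real.rpow_le_rpow_of_nonpos (by positivity) h1 (neg_nonpos.2 hL)
  rw [Real.mul_rpow (by positivity) (by positivity), Real.mul_rpow (by positivity) (by positivity)] at h2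
  have h3 := half_pow_mul_le hM k
  have h4 : (1 + ‖x - z‖ / s) ^ L * (1 + ‖x - z‖ / s) ^ (-L) = 1 := by
    rw [← Real.rpow_add hxz, add_neg_cancel, Real.rpow_zero]
  unfold peetreWeight
  calc _ ≤ ((1 / 2) ^ (k * M) * (2 ^ k) ^ (-L)) * (1 + ‖z - y‖ / ((1 / 2) ^ k * s)) ^ (-L) := by
        gcongr
    _ = (1 + ‖x - z‖ / s) ^ L * ((1 / 2) ^ (k * M) * ((2 ^ k) ^ (-L) * (1 + ‖x - z‖ / s) ^ (-L) *
        (1 + ‖z - y‖ / ((1 / 2) ^ k * s)) ^ (-L))) := by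
        linear_combination (-((1 / 2) ^ (k * M) * ((2 : ℝ) ^ k) ^ (-L)) *
          (1 + ‖z - y‖ / ((1 / 2) ^ k * s)) ^ (-L)) * h4
    _ ≤ _ := by gcongr

/-- `sup_{l, z} |F_{2 ^ (-l) t}(z)| 2 ^ (-l M) (1 + |x - z| / (2 ^ (-l) t)) ^ (-L)`. -/
def peetreSup (F : ℝ → Rn n → ℂ) (M : ℕ) (L : ℝ) (x : Rn n) (t : ℝ) : ℝ≥0∞ :=
  ⨆ (l : ℕ) (z : Rn n), ‖F ((1 / 2) ^ l * t) z‖ₑ * ENNReal.ofReal (peetreWeight M L x t l z)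

/-- The sum of integrals corresponding to `peetreSup`. -/
def peetreSum (F : ℝ → Rn n → ℂ) (r : ℝ) (M : ℕ) (L : ℝ) (x : Rn n) (t : ℝ) : ℝ≥0∞ :=
  ∑' j : ℕ, ENNReal.ofReal ((((1 / 2) ^ j * t) ^ n)⁻¹) *
    ∫⁻ y, (‖F ((1 / 2) ^ j * t) y‖ₑ * ENNReal.ofReal (peetreWeight M L x t j y)) ^ r

/-- If `F` satisfies the reproducing estimate with constant `C`, then `peetreSup` is controlled by
`peetreSum` as soon as it is finite. -/
theorem peetreSup_rpow_le {F : ℝ → Rn n → ℂ} {M m : ℕ} {L r : ℝ} {C : ℝ≥0∞} (hL : 0 ≤ L)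
    (hm : M + L ≤ m) (hr : 0 < r) (hr1 : r ≤ 1)
    (hF : ∀ t, 0 < t → ∀ x, ‖F t x‖ₑ ≤
      C * ∑' k : ℕ, ENNReal.ofReal ((1 / 2) ^ (k * m)) * (ENNReal.ofReal ((t ^ n)⁻¹) *
        ∫⁻ y, ‖F ((1 / 2) ^ k * t) y‖ₑ * ENNReal.ofReal ((1 + ‖x - y‖ / t) ^ (-L))))
    {t : ℝ} (ht : 0 < t) (x : Rn n) (hfin : peetreSup F M L x t < ∞) :
    peetreSup F M L x t ^ r ≤ C * peetreSum F r M L x t := by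
  set a := peetreSup F M L x t with ha
  set S := peetreSum F r M L x t with hS
  set b : ℕ → Rn n → ℝ≥0∞ := fun l z =>
    ‖F ((1 / 2) ^ l * t) z‖ₑ * ENNReal.ofReal (peetreWeight M L x t l z) with hb
  have hba : ∀ l z, b l z ≤ a := fun l z => le_iSup₂_of_le l z le_rfl
  have hr1' : 0 ≤ 1 - r := sub_nonneg.2 hr1
  -- The factor b^(1-r) is replaced by the supremum a; dividing by a^(1-r) at the end requires a to
  -- be finite.
  have hbr : ∀ l z, b l z ≤ a ^ (1 - r) * b l z ^ r := fun l z =>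
    calc b l z = b l z ^ (1 - r) * b l z ^ r := by
          rw [← ENNReal.rpow_add_of_nonneg _ _ (by linarith) hr.le, sub_add_cancel, ENNReal.rpow_one]
      _ ≤ _ := by
          gcongr
          exact hba l z
  have har : a ^ (1 - r) ≠ ∞ := ENNReal.rpow_ne_top_of_nonneg (by linarith) hfin.ne
  have hmain : a ≤ a ^ (1 - r) * (C * S) := by
    refine iSup₂_le fun l z => ?_
    have hs : 0 < (1 / 2) ^ l * t := by positivity
    calc _ ≤ (C * ∑' k : ℕ, ENNReal.ofReal ((1 / 2) ^ (k * m)) *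
          (ENNReal.ofReal ((((1 / 2) ^ l * t) ^ n)⁻¹) *
          ∫⁻ y, ‖F ((1 / 2) ^ k * ((1 / 2) ^ l * t)) y‖ₑ *
            ENNReal.ofReal ((1 + ‖z - y‖ / ((1 / 2) ^ l * t)) ^ (-L)))) *
          ENNReal.ofReal (peetreWeight M L x t l z) := by
          gcongr
          exact hF _ hs z
      _ ≤ C * ∑' k : ℕ, a ^ (1 - r) * (ENNReal.ofReal ((((1 / 2) ^ (l + k) * t) ^ n)⁻¹) *
          ∫⁻ y, b (l + k) y ^ r) := by
          rw [mul_assoc, ← ENNReal.tsum_mul_right]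
          refine mul_le_mul' le_rfl (ENNReal.tsum_le_tsum fun k => ?_)
          rw [mul_right_comm, mul_left_comm, ← ENNReal.ofReal_mul (by positivity),
            ← lintegral_const_mul' _ _ ENNReal.ofReal_ne_top, mul_left_comm (a ^ (1 - r)),
            ← lintegral_const_mul' _ _ har]
          refine mul_le_mul' ?_ ?_
          -- The normalization t^(-n) of scale l is enlarged to that of the finer scale l + k, to
          -- match the terms of `peetreSum`.
          · apply ENNReal.ofReal_le_ofReal
            gcongr ?_⁻¹
            gcongr ?_ ^ n
            gcongr ?_ * t
            exact pow_le_pow_of_le_one (by norm_num) (by norm_num) (Nat.le_add_right l k)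
          · refine lintegral_mono fun y => le_trans ?_ (hbr (l + k) y)
            rw [hb]
            dsimp only
            rw [show (1 / 2 : ℝ) ^ k * ((1 / 2) ^ l * t) = (1 / 2) ^ (l + k) * t by rw [pow_add]; ring,
              mul_left_comm, ← ENNReal.ofReal_mul (mul_nonneg (by positivity)
              (peetreWeight_nonneg M L x ht l z))]
            refine mul_le_mul' le_rfl (ENNReal.ofReal_le_ofReal ?_)
            refine le_trans (le_of_eq ?_) (peetreWeight_mul_le hL hm x y z ht l k)
            ring
      _ ≤ _ := by
          rw [ENNReal.tsum_mul_left, mul_left_comm]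
          gcongr
          exact ENNReal.tsum_comp_le_tsum_of_injective (add_right_injective l)
            (fun j => ENNReal.ofReal ((((1 / 2) ^ j * t) ^ n)⁻¹) * ∫⁻ y, b j y ^ r)
  by_cases h0 : a = 0
  · rw [h0, ENNReal.zero_rpow_of_pos hr]
    exact zero_le
  · have h1 : a ^ (1 - r) * a ^ r ≤ a ^ (1 - r) * (C * S) := by
      rwa [← ENNReal.rpow_add_of_nonneg _ _ (by linarith) hr.le, sub_add_cancel, ENNReal.rpow_one]
    exact (ENNReal.mul_le_mul_iff_right (by
      simpa [ENNReal.rpow_eq_zero_iff, h0] using fun h => absurd h hfin.ne) har).1 h1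

/-- A bound for `peetreSum` by the maximal function. -/
theorem peetreSum_le {F : ℝ → Rn n → ℂ} {G : Rn n → ℝ≥0∞} (hG : Measurable G)
    (hFG : ∀ s, 0 < s → ∀ y, ‖F s y‖ₑ ≤ G y) {L r : ℝ} (hL : 0 ≤ L) (hr : 0 < r) (x : Rn n)
    {t : ℝ} (ht : 0 < t) :
    peetreSum F r 1 L x t ≤ ((∑' j : ℕ, ENNReal.ofReal (((1 / 2) ^ r) ^ j)) * decayConst n (L * r)) *
      hlMaximal (fun y => G y ^ r) x := by
  -- With M = 1 the r-th power of the weight contains 2^(-jr), which makes the sum over scales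
  -- converge.
  rw [peetreSum, mul_assoc, ← ENNReal.tsum_mul_right]
  refine ENNReal.tsum_le_tsum fun j => ?_
  have hs : 0 < (1 / 2) ^ j * t := by positivity
  refine le_trans ?_ (mul_le_mul' le_rfl (lintegral_mul_rpow_le (mul_nonneg hL hr.le)
    (hG.pow_const r) x hs))
  rw [mul_left_comm, ← lintegral_const_mul' (ENNReal.ofReal (((1 / 2) ^ r) ^ j)) _
    ENNReal.ofReal_ne_top]
  refine mul_le_mul' le_rfl (lintegral_mono fun y => ?_)
  rw [ENNReal.mul_rpow_of_nonneg _ _ hr.le, ENNReal.ofReal_rpow_of_nonneg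
    (peetreWeight_nonneg 1 L x ht j y) hr.le, mul_left_comm, ← ENNReal.ofReal_mul (by positivity)]
  gcongr
  · exact hFG _ hs y
  · rw [peetreWeight, Real.mul_rpow (by positivity) (by positivity), ← Real.rpow_mul (by positivity),
      neg_mul, mul_one, ← Real.rpow_natCast, ← Real.rpow_natCast, ← Real.rpow_mul (by positivity),
      ← Real.rpow_mul (by positivity), mul_comm r]

theorem peetreSum_le_center {F : ℝ → Rn n → ℂ} {M M' : ℕ} {L L' r : ℝ} (hL : 0 ≤ L)
    (hM : M + L ≤ M') (hL' : L ≤ L') (hr : 0 < r) (x z : Rn n) {s : ℝ} (hs : 0 < s) :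
    peetreSum F r M' L' z s ≤ ENNReal.ofReal ((1 + ‖x - z‖ / s) ^ L) ^ r * peetreSum F r M L x s := by
  rw [peetreSum, peetreSum, ← ENNReal.tsum_mul_left]
  refine ENNReal.tsum_le_tsum fun j => ?_
  rw [mul_left_comm, ← lintegral_const_mul' (ENNReal.ofReal ((1 + ‖x - z‖ / s) ^ L) ^ r) _
    (ENNReal.rpow_ne_top_of_nonneg hr.le ENNReal.ofReal_ne_top)]
  refine mul_le_mul' le_rfl (lintegral_mono fun y => ?_)
  rw [← ENNReal.mul_rpow_of_nonneg _ _ hr.le, mul_left_comm, ← ENNReal.ofReal_mul (by positivity)]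
  gcongr
  exact peetreWeight_le_center hL hM hL' x y z hs j

end Nontangential

end

section

/-! ### Non-tangential control by the radial maximal function -/

section NontangentialBound

variable {n : ℕ}

theorem dilate_eq_affine {s : ℝ} (hs : 0 < s) (Φ : 𝓢(Rn n, ℂ)) :
    dilate s hs Φ = (((s ^ n)⁻¹ : ℝ) : ℂ) • affine s⁻¹ 0 Φ := by
  ext y
  rw [dilate_apply, smul_apply, affine_apply (inv_ne_zero hs.ne'), smul_eq_mul, add_zero]

/-- If f has order K, dilating Φ to scale 2^(-l) t costs 2^(l(n+K)) and f * Φ_s grows like (1 +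
‖z‖)^K; exponents at least n + K absorb both. The threshold depends on f. -/
theorem exists_peetreSup_lt_top (f : 𝓢'(Rn n, ℂ)) (Φ : 𝓢(Rn n, ℂ)) : ∃ N : ℕ, ∀ M : ℕ, N ≤ M →
    ∀ L : ℝ, N ≤ L → ∀ (x : Rn n) (t : ℝ), 0 < t → peetreSup (dilConv f Φ) M L x t < ∞ := by
  obtain ⟨K, C, hC, hK⟩ := exists_conv_growth f
  refine ⟨n + K, fun M hM L hL x t ht => ?_⟩
  set A : ℝ := C * ((t ^ n)⁻¹ * (2 ^ K * ((1 + t) ^ K * (1 + t⁻¹) ^ K * schwartzNorm K Φ))) *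
    (1 + ‖x‖) ^ K * (1 + t) ^ K with hA
  have hbound : ∀ l z, ‖dilConv f Φ ((1 / 2) ^ l * t) z‖ * peetreWeight M L x t l z ≤ A := by
    intro l z
    have hs : 0 < (1 / 2) ^ l * t := by positivity
    have hsinv : ((1 / 2) ^ l * t)⁻¹ = 2 ^ l * t⁻¹ := by rw [mul_inv, ← inv_pow]; norm_num
    have h2l : (1 : ℝ) ≤ 2 ^ l := one_le_pow₀ (by norm_num)
    have hti : 0 < t⁻¹ := by positivity
    have h1 : schwartzNorm K (dilate _ hs Φ) ≤ (2 ^ l) ^ n * (t ^ n)⁻¹ *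
        (2 ^ K * ((1 + t) ^ K * (2 ^ l * (1 + t⁻¹)) ^ K * schwartzNorm K Φ)) := by
      rw [dilate_eq_affine, map_smul_eq_mul, Complex.norm_real, Real.norm_of_nonneg (by positivity),
        ← inv_pow, hsinv, mul_pow, inv_pow]
      refine mul_le_mul_of_nonneg_left ?_ (by positivity)
      have := schwartzNorm_affine_le (δ := t⁻¹) (a := 2 ^ l * t⁻¹) (A := 2 ^ l * (1 + t⁻¹)) (H := 0)
        (h := (0 : Rn n)) hti (by rw [abs_of_nonneg (by positivity)]; nlinarith)
        (by rw [abs_of_nonneg (by positivity)]; gcongr; linarith) (by nlinarith) (by simp) K Φ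
      simpa using this
    have h2 : ‖dilConv f Φ ((1 / 2) ^ l * t) z‖ ≤ C * schwartzNorm K (dilate _ hs Φ) * (1 + ‖z‖) ^ K := by
      rw [← conv_dilate f Φ hs]; exact hK _ _
    set v : ℝ := 1 + ‖x - z‖ / ((1 / 2) ^ l * t) with hv
    have hv1 : 1 ≤ v := by
      have : 0 ≤ ‖x - z‖ / ((1 / 2) ^ l * t) := by positivity
      linarith
    have h3 : 1 + ‖z‖ ≤ (1 + ‖x‖) * ((1 + t) * v) := by
      have e1 : ‖z‖ ≤ ‖x‖ + ‖x - z‖ := by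
        rw [norm_sub_rev]
        simpa using norm_add_le x (z - x)
      have e2 : ‖x - z‖ ≤ t * (‖x - z‖ / ((1 / 2) ^ l * t)) := by
        rw [mul_div_assoc', le_div_iff₀ hs, mul_comm]
        exact mul_le_mul_of_nonneg_right
          (mul_le_of_le_one_left ht.le (pow_le_one₀ (by norm_num) (by norm_num))) (norm_nonneg _)
      have e3 : 1 + ‖x - z‖ ≤ (1 + t) * v := by
        have : 0 ≤ ‖x - z‖ / ((1 / 2) ^ l * t) := by positivity
        rw [hv]; nlinarith
      have := mul_le_mul_of_nonneg_left e3 (norm_nonneg x)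
      have h4 : 0 ≤ ‖x‖ * ‖x - z‖ := by positivity
      nlinarith [norm_nonneg x]
    have h4 : peetreWeight M L x t l z ≤ (1 / 2) ^ (l * (n + K)) * (v ^ K)⁻¹ := by
      unfold peetreWeight
      rw [← hv, ← Real.rpow_natCast v K, ← Real.rpow_neg (by positivity)]
      have hL' : (K : ℝ) ≤ L := by
        push_cast at hL
        linarith [Nat.cast_nonneg (α := ℝ) n]
      refine mul_le_mul ?_ ?_ (by positivity) (by positivity)
      · exact pow_le_pow_of_le_one (by norm_num) (by norm_num) (Nat.mul_le_mul_left l hM)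
      · exact Real.rpow_le_rpow_of_exponent_le hv1 (by linarith)
    have hsn := apply_nonneg (schwartzNorm (n := n) K) Φ
    calc _ ≤ (C * ((2 ^ l) ^ n * (t ^ n)⁻¹ *
          (2 ^ K * ((1 + t) ^ K * (2 ^ l * (1 + t⁻¹)) ^ K * schwartzNorm K Φ))) *
          ((1 + ‖x‖) * ((1 + t) * v)) ^ K) * ((1 / 2) ^ (l * (n + K)) * (v ^ K)⁻¹) := by
          refine mul_le_mul (h2.trans ?_) h4 (peetreWeight_nonneg M L x ht l z) (by positivity)
          gcongr
      _ = A * (((2 ^ l) ^ n * (2 ^ l) ^ K) * (1 / 2) ^ (l * (n + K))) * (v ^ K * (v ^ K)⁻¹) := by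
          rw [hA, mul_pow (2 ^ l : ℝ), mul_pow (1 + ‖x‖), mul_pow (1 + t)]; ring
      _ = A := by
          rw [mul_inv_cancel₀ (by positivity), ← pow_add, ← pow_mul, ← mul_pow]
          norm_num
  refine lt_of_le_of_lt (iSup₂_le fun l z => ?_) (ENNReal.ofReal_lt_top (r := A))
  rw [← ofReal_norm, ← ENNReal.ofReal_mul (norm_nonneg _)]
  exact ENNReal.ofReal_le_ofReal (hbound l z)

theorem enorm_dilConv_le_radialMaximal (f : 𝓢'(Rn n, ℂ)) (Φ : 𝓢(Rn n, ℂ)) {s : ℝ} (hs : 0 < s)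
    (y : Rn n) : ‖dilConv f Φ s y‖ₑ ≤ radialMaximal Φ f y := by
  rw [← conv_dilate f Φ hs]
  exact le_iSup₂_of_le s hs le_rfl

theorem lowerSemicontinuous_radialMaximal (Φ : 𝓢(Rn n, ℂ)) (f : 𝓢'(Rn n, ℂ)) :
    LowerSemicontinuous (radialMaximal Φ f) :=
  lowerSemicontinuous_biSup fun t ht =>
    (continuous_enorm.comp (continuous_conv f (dilate t ht Φ))).lowerSemicontinuous

theorem lowerSemicontinuous_grandMaximal (N : ℕ) (f : 𝓢'(Rn n, ℂ)) :
    LowerSemicontinuous (grandMaximal N f) :=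
  lowerSemicontinuous_biSup fun Φ _ => lowerSemicontinuous_radialMaximal Φ f

/-- The absorption is done twice. With large exponents depending on f the supremum is finite a
priori, and the resulting estimate, re-centred, shows that the supremum with the fixed exponents 1
and L is finite wherever the maximal function is. A second absorption with these exponents then has
a constant independent of f. -/
theorem exists_enorm_dilConv_rpow_le (Φ : 𝓢(Rn n, ℂ)) (hΦ : ∫ x, Φ x = 1) {r : ℝ} (hr : 0 < r)
    (hr1 : r ≤ 1) : ∃ C : ℝ≥0, 0 < C ∧ ∀ (f : 𝓢'(Rn n, ℂ)) (x y : Rn n) (t : ℝ), 0 < t →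
      ‖x - y‖ < t →
      ‖dilConv f Φ t y‖ₑ ^ r ≤ C * hlMaximal (fun z => radialMaximal Φ f z ^ r) x := by
  -- Chosen so that L r > n, which makes `decayConst n (L * r)` finite.
  set L : ℝ := n / r + 1 with hL
  have hL0 : 0 ≤ L := by positivity
  have hLr : (n : ℝ) < L * r := by rw [hL, add_mul, div_mul_cancel₀ _ hr.ne']; linarith
  obtain ⟨C₁, hC₁⟩ := exists_enorm_dilConv_le Φ hΦ L ⌈1 + L⌉₊
  set D : ℝ≥0∞ := (∑' j : ℕ, ENNReal.ofReal (((1 / 2) ^ r) ^ j)) * decayConst n (L * r) with hD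
  have hDtop : D ≠ ∞ := by
    refine ENNReal.mul_ne_top (Summable.tsum_ofReal_ne_top
      (summable_geometric_of_lt_one (by positivity) ?_)) (decayConst_ne_top hLr)
    exact Real.rpow_lt_one (by norm_num) (by norm_num) hr
  refine ⟨(ENNReal.ofReal (2 ^ L) ^ r * (C₁ * D)).toNNReal + 1, by positivity,
    fun f x y t ht hxy => ?_⟩
  set W := hlMaximal (fun z => radialMaximal Φ f z ^ r) x with hW
  by_cases hWtop : W = ∞
  · rw [hWtop, ENNReal.mul_top (by simp)]
    exact le_top
  set F := dilConv f Φ with hF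
  have hFG : ∀ s, 0 < s → ∀ y, ‖F s y‖ₑ ≤ radialMaximal Φ f y := fun s hs y =>
    enorm_dilConv_le_radialMaximal f Φ hs y
  have hG := (lowerSemicontinuous_radialMaximal Φ f).measurable
  -- The constant C₀ here depends on f through M' and L'; it is used only for finiteness.
  have hfin : peetreSup F 1 L x t < ∞ := by
    obtain ⟨N, hN⟩ := exists_peetreSup_lt_top f Φ
    set M' := max N ⌈1 + L⌉₊ with hM'
    set L' : ℝ := max N L with hL'
    obtain ⟨C₀, hC₀⟩ := exists_enorm_dilConv_le Φ hΦ L' ⌈M' + L'⌉₊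
    have hL'0 : 0 ≤ L' := hL0.trans (le_max_right _ _)
    have hb : peetreSup F 1 L x t ≤ (C₀ * (D * W)) ^ (1 / r) := by
      refine iSup₂_le fun l z => ?_
      have hs : 0 < (1 / 2) ^ l * t := by positivity
      have h1 : ‖F ((1 / 2) ^ l * t) z‖ₑ ≤ peetreSup F M' L' z ((1 / 2) ^ l * t) :=
        le_iSup₂_of_le 0 z (by simp [peetreWeight])
      have h2 := peetreSup_rpow_le hL'0 (Nat.le_ceil _) hr hr1 (hC₀ f) hs z
        (hN M' (le_max_left _ _) L' (le_max_left _ _) z _ hs)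
      have h3 := peetreSum_le_center (F := F) (M := 1) (M' := M') (L := L) (L' := L') hL0
        (by
          have : (⌈1 + L⌉₊ : ℝ) ≤ M' := by exact_mod_cast le_max_right N ⌈1 + L⌉₊
          push_cast
          linarith [Nat.le_ceil (1 + L)]) (le_max_right _ _) hr x z hs
      have h4 := peetreSum_le hG hFG hL0 hr x hs
      rw [one_div r, ENNReal.le_rpow_inv_iff hr, ENNReal.mul_rpow_of_nonneg _ _ hr.le]
      have hpw : ENNReal.ofReal ((1 + ‖x - z‖ / ((1 / 2) ^ l * t)) ^ L) ^ r *
          ENNReal.ofReal (peetreWeight 1 L x t l z) ^ r ≤ 1 := by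
        rw [← ENNReal.mul_rpow_of_nonneg _ _ hr.le, ← ENNReal.ofReal_mul (by positivity)]
        refine ENNReal.rpow_le_one ?_ hr.le
        rw [← ENNReal.ofReal_one]
        apply ENNReal.ofReal_le_ofReal
        unfold peetreWeight
        rw [mul_left_comm, ← Real.rpow_add (by positivity), add_neg_cancel, Real.rpow_zero, mul_one]
        exact pow_le_one₀ (by norm_num) (by norm_num)
      calc _ ≤ (C₀ * (ENNReal.ofReal ((1 + ‖x - z‖ / ((1 / 2) ^ l * t)) ^ L) ^ r * (D * W))) *
            ENNReal.ofReal (peetreWeight 1 L x t l z) ^ r := by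
            gcongr
            refine (ENNReal.rpow_le_rpow h1 hr.le).trans (h2.trans ?_)
            exact mul_le_mul' le_rfl (h3.trans (mul_le_mul' le_rfl h4))
        _ = C₀ * (D * W) * (ENNReal.ofReal ((1 + ‖x - z‖ / ((1 / 2) ^ l * t)) ^ L) ^ r *
            ENNReal.ofReal (peetreWeight 1 L x t l z) ^ r) := by ring
        _ ≤ _ := mul_le_of_le_one_right' hpw
    exact hb.trans_lt (ENNReal.rpow_lt_top_of_nonneg (by positivity)
      (ENNReal.mul_ne_top ENNReal.coe_ne_top (ENNReal.mul_ne_top hDtop hWtop)))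
  have h1 := peetreSup_rpow_le hL0 (by push_cast; exact Nat.le_ceil _) hr hr1 (hC₁ f) ht x hfin
  have h2 := peetreSum_le hG hFG hL0 hr x ht
  -- On the cone ‖x - y‖ < t the weight at l = 0 is at least 2^(-L).
  have h3 : ‖F t y‖ₑ ≤ ENNReal.ofReal (2 ^ L) * peetreSup F 1 L x t := by
    have h4 : ‖F t y‖ₑ * ENNReal.ofReal ((1 + ‖x - y‖ / t) ^ (-L)) ≤ peetreSup F 1 L x t :=
      le_iSup₂_of_le 0 y (by simp [peetreWeight])
    have hxy' : ‖x - y‖ / t ≤ 1 := (div_le_one ht).2 hxy.le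
    have hv : 0 < 1 + ‖x - y‖ / t := by positivity
    calc ‖F t y‖ₑ = ENNReal.ofReal ((1 + ‖x - y‖ / t) ^ L) *
          (‖F t y‖ₑ * ENNReal.ofReal ((1 + ‖x - y‖ / t) ^ (-L))) := by
          rw [mul_left_comm, ← ENNReal.ofReal_mul (by positivity), ← Real.rpow_add hv, add_neg_cancel,
            Real.rpow_zero, ENNReal.ofReal_one, mul_one]
      _ ≤ _ := by
          gcongr
          linarith
  calc _ ≤ (ENNReal.ofReal (2 ^ L) * peetreSup F 1 L x t) ^ r := ENNReal.rpow_le_rpow h3 hr.le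
    _ ≤ ENNReal.ofReal (2 ^ L) ^ r * (C₁ * (D * W)) := by
        rw [ENNReal.mul_rpow_of_nonneg _ _ hr.le]
        exact mul_le_mul' le_rfl (h1.trans (mul_le_mul' le_rfl h2))
    _ = (ENNReal.ofReal (2 ^ L) ^ r * (C₁ * D)) * W := by ring
    _ ≤ _ := by
        gcongr
        rw [ENNReal.coe_add, ENNReal.coe_toNNReal (ENNReal.mul_ne_top
          (ENNReal.rpow_ne_top_of_nonneg hr.le ENNReal.ofReal_ne_top)
          (ENNReal.mul_ne_top ENNReal.coe_ne_top hDtop))]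
        exact le_self_add

end NontangentialBound

end

section

/-! ### The grand maximal function -/

section GrandMaximal

variable {n : ℕ}

theorem lintegral_one_add_norm_rpow_neg_ne_top {L : ℝ} (hL : (n : ℝ) < L) :
    ∫⁻ z : Rn n, ENNReal.ofReal ((1 + ‖z‖) ^ (-L)) ≠ ∞ := by
  have h := (integrable_one_add_norm_rpow_neg (n := n) hL).lintegral_lt_top
  exact h.ne

/-- With m = L = N in the reproducing estimate, the k-th term is at most a multiple of 2^(-k(N-κ)) ∫
(1 + |z|)^(κ-N) dz, and N - κ > n gives both convergences. The kernel enters only through the moment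
bound μ, so R and K may vary with f. -/
theorem exists_grandMaximal_le_of_tangential {N : ℕ} {κ : ℝ} (hκ : 0 ≤ κ) (hN : κ + n < N) (μ : ℝ) :
    ∃ C : ℝ≥0, ∀ {R K : ℝ} (B : AvgKernel n R) (f : 𝓢'(Rn n, ℂ)) (F : ℝ → Rn n → ℂ),
      absMoment B.toFun (N + 1) ≤ μ → IsKernelFamily f B.toFun K F → 0 ≤ K → n + K + 1 ≤ R →
      N + 1 ≤ R → ∀ (x : Rn n) (A : ℝ≥0∞),
        (∀ τ, 0 < τ → ∀ y, ‖F τ y‖ₑ ≤ A * ENNReal.ofReal ((1 + ‖x - y‖ / τ) ^ κ)) →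
        grandMaximal N f x ≤ C * A := by
  set c : ℝ := (N + 1) * (1 + μ) ^ N * (2 + 2 ^ N) * ((n + 1) ^ N * (n + 1) ^ N) with hc
  set S : ℝ≥0∞ := ∑' k : ℕ, ENNReal.ofReal (((1 / 2) ^ (N - κ)) ^ k) with hS
  set I : ℝ≥0∞ := ∫⁻ z : Rn n, ENNReal.ofReal ((1 + ‖z‖) ^ (-(N - κ))) with hI
  have hn : (0 : ℝ) ≤ n := n.cast_nonneg
  have hStop : S ≠ ∞ := by
    refine Summable.tsum_ofReal_ne_top (summable_geometric_of_lt_one (by positivity) ?_)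
    exact Real.rpow_lt_one (by norm_num) (by norm_num) (by linarith)
  have hItop : I ≠ ∞ := lintegral_one_add_norm_rpow_neg_ne_top (by linarith)
  have htop : ENNReal.ofReal c * (S * I) ≠ ∞ :=
    ENNReal.mul_ne_top ENNReal.ofReal_ne_top (ENNReal.mul_ne_top hStop hItop)
  refine ⟨(ENNReal.ofReal c * (S * I)).toNNReal, fun {R K} B f F hμ hfam hK hR hNR x A hA => ?_⟩
  rw [ENNReal.coe_toNNReal htop]
  refine iSup₂_le fun Φ hΦ => iSup₂_le fun t ht => ?_
  have habs : |(-(N : ℝ))| = N := by rw [abs_neg, abs_of_nonneg (by positivity)]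
  have h1 := hfam.enorm_conv_dilate_le hK hR (L := N) (by rwa [habs])
    (smoothGrowth_of_mem_unitClass hΦ) ht x
  rw [habs] at h1
  refine h1.trans ?_
  rw [mul_assoc (ENNReal.ofReal c)]
  refine mul_le_mul' (ENNReal.ofReal_le_ofReal ?_) ?_
  · have := absMoment_nonneg B.toFun (N + 1)
    rw [hc]
    gcongr
  · rw [hS, mul_assoc, ← ENNReal.tsum_mul_right]
    refine ENNReal.tsum_le_tsum fun k => ?_
    have hIA : I * A = ∫⁻ z : Rn n, ENNReal.ofReal ((1 + ‖z‖) ^ (-(N - κ))) * A := by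
      rw [lintegral_mul_const]
      exact (continuous_one_add_norm_rpow _).measurable.ennreal_ofReal
    rw [hIA, ← lintegral_const_mul' _ _ ENNReal.ofReal_ne_top,
      ← lintegral_const_mul' _ _ ENNReal.ofReal_ne_top]
    refine lintegral_mono fun z => ?_
    have hs : 0 < (1 / 2) ^ k * t := by positivity
    have hz : 0 < 1 + ‖z‖ := by positivity
    have h2 : ‖x - (x - t • z)‖ / ((1 / 2) ^ k * t) = 2 ^ k * ‖z‖ := by
      rw [sub_sub_cancel, norm_smul, Real.norm_of_nonneg ht.le]
      field_simp
      rw [mul_assoc, ← mul_pow]; norm_num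
    have h3 := hA _ hs (x - t • z)
    rw [h2] at h3
    have h2k : (1 : ℝ) ≤ 2 ^ k := one_le_pow₀ (by norm_num)
    have h4 : (1 + 2 ^ k * ‖z‖) ^ κ ≤ (2 ^ k) ^ κ * (1 + ‖z‖) ^ κ := by
      rw [← Real.mul_rpow (by positivity) hz.le]
      gcongr
      linarith
    have h5 : ((1 : ℝ) / 2) ^ (k * N) * (2 ^ k) ^ κ = ((1 / 2) ^ (N - κ)) ^ k := by
      rw [show (2 : ℝ) ^ k = ((1 / 2) ^ k)⁻¹ by rw [← inv_pow]; norm_num,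
        Real.inv_rpow (by positivity), ← Real.rpow_neg (by positivity), ← Real.rpow_natCast,
        ← Real.rpow_natCast, ← Real.rpow_natCast, ← Real.rpow_mul (by norm_num),
        ← Real.rpow_mul (by norm_num), ← Real.rpow_add (by norm_num)]
      congr 1; push_cast; ring
    have h6 : (1 + ‖z‖) ^ κ * (1 + ‖z‖) ^ (-(N : ℝ)) = (1 + ‖z‖) ^ (-(N - κ)) := by
      rw [← Real.rpow_add hz]; congr 1; ring
    calc _ ≤ ENNReal.ofReal ((1 / 2) ^ (k * N)) * ((A * ENNReal.ofReal ((2 ^ k) ^ κ * (1 + ‖z‖) ^ κ)) *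
          ENNReal.ofReal ((1 + ‖z‖) ^ (-(N : ℝ)))) := by
          refine mul_le_mul' le_rfl (mul_le_mul' (h3.trans ?_) le_rfl)
          exact mul_le_mul' le_rfl (ENNReal.ofReal_le_ofReal h4)
      _ = ENNReal.ofReal ((1 / 2) ^ (k * N) * ((2 ^ k) ^ κ * (1 + ‖z‖) ^ κ *
          (1 + ‖z‖) ^ (-(N : ℝ)))) * A := by
          rw [ENNReal.ofReal_mul (p := (1 / 2) ^ (k * N)) (by positivity),
            ENNReal.ofReal_mul (q := (1 + ‖z‖) ^ (-(N : ℝ))) (by positivity)]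
          ring
      _ = _ := by
          rw [mul_assoc ((2 ^ k : ℝ) ^ κ), h6, ← mul_assoc, h5, ENNReal.ofReal_mul (by positivity),
            mul_assoc]

/-- As G dominates |F_τ(y)| on the whole ball of radius τ about y, its maximal function is large
even at distant x, with loss (1 + ‖x - y‖/τ)^n before the p₀-th root. This gives κ = n/p₀ and the
threshold on N. -/
theorem exists_grandMaximal_le_hlMaximal {p₀ : ℝ} (hp₀ : 0 < p₀) {N : ℕ} (hN : n / p₀ + n < N)
    (μ : ℝ) : ∃ C : ℝ≥0, ∀ {R K : ℝ} (B : AvgKernel n R) (f : 𝓢'(Rn n, ℂ)) (F : ℝ → Rn n → ℂ),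
      absMoment B.toFun (N + 1) ≤ μ → IsKernelFamily f B.toFun K F → 0 ≤ K → n + K + 1 ≤ R →
      N + 1 ≤ R → ∀ G : Rn n → ℝ≥0∞, (∀ τ, 0 < τ → ∀ y z, ‖z - y‖ < τ → ‖F τ y‖ₑ ≤ G z) →
      ∀ x, grandMaximal N f x ≤ C * hlMaximal (fun y => G y ^ p₀) x ^ (1 / p₀) := by
  obtain ⟨C, hC⟩ := exists_grandMaximal_le_of_tangential (n := n) (κ := n / p₀) (by positivity) hN μ
  set V : ℝ≥0∞ := 2 ^ n * (volume (Metric.ball (0 : Rn n) 1))⁻¹ with hV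
  have hVtop : V ≠ ∞ := ENNReal.mul_ne_top (ENNReal.pow_ne_top (by simp))
    (ENNReal.inv_ne_top.2 (Metric.measure_ball_pos _ _ one_pos).ne')
  have hp : 0 ≤ 1 / p₀ := by positivity
  have hVp : V ^ (1 / p₀) ≠ ∞ := ENNReal.rpow_ne_top_of_nonneg hp hVtop
  refine ⟨C * (V ^ (1 / p₀)).toNNReal, fun {R K} B f F hμ hfam hK hR hNR G hG x => ?_⟩
  rw [ENNReal.coe_mul, ENNReal.coe_toNNReal hVp, mul_assoc]
  refine hC B f F hμ hfam hK hR hNR x _ fun τ hτ y => ?_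
  have h1 := le_mul_hlMaximal (G := fun z => G z ^ p₀) hτ (fun z hz =>
    ENNReal.rpow_le_rpow (hG τ hτ y z hz) hp₀.le) x
  rw [← hV, ← ENNReal.le_rpow_inv_iff hp₀, ← one_div p₀] at h1
  refine h1.trans (le_of_eq ?_)
  rw [ENNReal.mul_rpow_of_nonneg _ _ hp, ENNReal.mul_rpow_of_nonneg _ _ hp, ENNReal.ofReal_rpow_of_nonneg
    (by positivity) hp, ← Real.rpow_natCast, ← Real.rpow_mul (by positivity), mul_one_div]
  ring

theorem reflectTranslate_smul (c : ℂ) (x : Rn n) (Φ : 𝓢(Rn n, ℂ)) :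
    reflectTranslate x (c • Φ) = c • reflectTranslate x Φ := by
  ext y; simp

theorem dilate_smul (c : ℂ) {t : ℝ} (ht : 0 < t) (Φ : 𝓢(Rn n, ℂ)) :
    dilate t ht (c • Φ) = c • dilate t ht Φ := by
  ext y; simp [mul_left_comm]

theorem conv_smul (f : 𝓢'(Rn n, ℂ)) (c : ℂ) (Φ : 𝓢(Rn n, ℂ)) (x : Rn n) :
    conv f (c • Φ) x = c * conv f Φ x := by
  rw [conv, reflectTranslate_smul, map_smul, smul_eq_mul, conv]

theorem radialMaximal_smul (c : ℂ) (Φ : 𝓢(Rn n, ℂ)) (f : 𝓢'(Rn n, ℂ)) (x : Rn n) :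
    radialMaximal (c • Φ) f x = ‖c‖ₑ * radialMaximal Φ f x := by
  simp only [radialMaximal, dilate_smul, conv_smul, enorm_mul, ENNReal.mul_iSup]

theorem enorm_conv_dilate_le_grandMaximal {N : ℕ} {Φ : 𝓢(Rn n, ℂ)} {σ : ℝ} (hσ : 0 < σ)
    (hΦ : schwartzNorm N Φ ≤ σ) (f : 𝓢'(Rn n, ℂ)) {t : ℝ} (ht : 0 < t) (x : Rn n) :
    ‖conv f (dilate t ht Φ) x‖ₑ ≤ ENNReal.ofReal σ * grandMaximal N f x := by
  have h1 : ((σ⁻¹ : ℝ) : ℂ) • Φ ∈ unitClass n N := by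
    refine mem_unitClass_of_schwartzNorm_le ?_
    rw [map_smul_eq_mul, Complex.norm_real, Real.norm_of_nonneg (by positivity)]
    exact inv_mul_le_one_of_le₀ hΦ hσ.le
  have h2 : Φ = (σ : ℂ) • ((σ⁻¹ : ℝ) : ℂ) • Φ := by
    rw [smul_smul, ← Complex.ofReal_mul, mul_inv_cancel₀ hσ.ne', Complex.ofReal_one, one_smul]
  rw [h2, dilate_smul, conv_smul, enorm_mul]
  refine mul_le_mul' (le_of_eq ?_) ?_
  · rw [← ofReal_norm, Complex.norm_real, Real.norm_of_nonneg hσ.le]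
  · exact le_iSup₂_of_le _ h1 (le_iSup₂_of_le t ht le_rfl)

theorem radialMaximal_le_grandMaximal (N : ℕ) (Φ : 𝓢(Rn n, ℂ)) (f : 𝓢'(Rn n, ℂ)) (x : Rn n) :
    radialMaximal Φ f x ≤ ENNReal.ofReal (schwartzNorm N Φ + 1) * grandMaximal N f x := by
  have := apply_nonneg (schwartzNorm (n := n) N) Φ
  exact iSup₂_le fun t ht =>
    enorm_conv_dilate_le_grandMaximal (by linarith) (by linarith) f ht x

/-- The non-tangential maximal function of a family of functions. -/
def nontangential (F : ℝ → Rn n → ℂ) (x : Rn n) : ℝ≥0∞ :=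
  ⨆ (t : ℝ) (y : Rn n) (_ : 0 < t ∧ ‖x - y‖ < t), ‖F t y‖ₑ

theorem enorm_le_nontangential (F : ℝ → Rn n → ℂ) {t : ℝ} (ht : 0 < t) {x y : Rn n}
    (h : ‖x - y‖ < t) : ‖F t y‖ₑ ≤ nontangential F x :=
  le_iSup₂_of_le t y (le_iSup_of_le ⟨ht, h⟩ le_rfl)

theorem lowerSemicontinuous_nontangential (F : ℝ → Rn n → ℂ) :
    LowerSemicontinuous (nontangential F) := by
  intro x a ha
  obtain ⟨t, ha⟩ := lt_iSup_iff.1 ha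
  obtain ⟨y, ha⟩ := lt_iSup_iff.1 ha
  obtain ⟨⟨ht, hxy⟩, ha⟩ := lt_iSup_iff.1 ha
  have : ∀ᶠ z in 𝓝 x, ‖z - y‖ < t :=
    (show Continuous fun z : Rn n => ‖z - y‖ by fun_prop).continuousAt.eventually_lt
      continuousAt_const hxy
  filter_upwards [this] with z hz
  exact ha.trans_le (enorm_le_nontangential F ht hz)

/-- The absorption argument needs r ≤ 1, so r = min 1 p₀ is used and Jensen's inequality raises the
exponent to p₀. -/
theorem exists_nontangential_dilConv_le (Φ : 𝓢(Rn n, ℂ)) (hΦ : ∫ x, Φ x = 1) {p₀ : ℝ} (hp₀ : 0 < p₀) :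
    ∃ C : ℝ≥0, ∀ (f : 𝓢'(Rn n, ℂ)) (x : Rn n), nontangential (dilConv f Φ) x ≤
      C * hlMaximal (fun z => radialMaximal Φ f z ^ p₀) x ^ (1 / p₀) := by
  set r := min 1 p₀ with hr
  have hr0 : 0 < r := lt_min one_pos hp₀
  obtain ⟨C, -, hC⟩ := exists_enorm_dilConv_rpow_le Φ hΦ hr0 (min_le_left _ _)
  have hr' : 0 ≤ 1 / r := by positivity
  refine ⟨C ^ (1 / r), fun f x => iSup₂_le fun t y => iSup_le fun hty => ?_⟩
  have h1 := hC f x y t hty.1 hty.2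
  have hq : 1 ≤ p₀ / r := (one_le_div hr0).2 (min_le_right _ _)
  have h2 := hlMaximal_le_rpow ((lowerSemicontinuous_radialMaximal Φ f).measurable.pow_const r) hq x
  have h3 : (fun y => (radialMaximal Φ f y ^ r) ^ (p₀ / r)) = fun y => radialMaximal Φ f y ^ p₀ := by
    ext y; rw [← ENNReal.rpow_mul, mul_div_cancel₀ _ hr0.ne']
  rw [h3] at h2
  calc ‖dilConv f Φ t y‖ₑ = (‖dilConv f Φ t y‖ₑ ^ r) ^ (1 / r) := by
        rw [← ENNReal.rpow_mul, mul_one_div_cancel hr0.ne', ENNReal.rpow_one]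
    _ ≤ (C * hlMaximal (fun z => radialMaximal Φ f z ^ p₀) x ^ (1 / (p₀ / r))) ^ (1 / r) :=
        ENNReal.rpow_le_rpow (h1.trans (mul_le_mul' le_rfl h2)) hr'
    _ = _ := by
        rw [ENNReal.mul_rpow_of_nonneg _ _ hr', ← ENNReal.rpow_mul,
          ENNReal.coe_rpow_of_nonneg _ hr']
        congr 2
        field_simp

/-- The grand maximal function is controlled in norm by a radial maximal function. -/
theorem IsMP0.exists_varNorm_grandMaximal_le {p : Rn n → ℝ} {p₀ : ℝ} (hp : IsMP0 p p₀)
    {Φ : 𝓢(Rn n, ℂ)} (hΦ : ∫ x, Φ x ≠ 0) {N : ℕ} (hN : n / p₀ + n < N) :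
    ∃ C : ℝ≥0, ∀ f : 𝓢'(Rn n, ℂ),
      varNorm p (grandMaximal N f) ≤ C * varNorm p (radialMaximal Φ f) := by
  -- Averaging kernels must have integral 1; the rescaling changes the radial maximal function by a
  -- constant factor. Then M is applied twice, from radial to non-tangential (`h1`) and from there
  -- to grand (`h2`).
  set Φ' := (∫ x, Φ x)⁻¹ • Φ with hΦ'
  have hint : ∫ x, Φ' x = 1 := by
    simp only [hΦ', smul_apply, smul_eq_mul]
    rw [integral_const_mul, inv_mul_cancel₀ hΦ]
  obtain ⟨C₁, hC₁, hhl⟩ := hp.varNorm_le_of_le_hlMaximal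
  obtain ⟨C₂, hC₂⟩ := exists_nontangential_dilConv_le Φ' hint hp.p₀_pos
  obtain ⟨C₃, hC₃⟩ := exists_grandMaximal_le_hlMaximal hp.p₀_pos hN (absMoment Φ' (N + 1))
  have hc : 0 < ‖(∫ x, Φ x)⁻¹‖₊ := by simpa using hΦ
  refine ⟨(C₃ + 1) * C₁ * ((C₂ + 1) * C₁ * ‖(∫ x, Φ x)⁻¹‖₊), fun f => ?_⟩
  have h1 := hhl C₂ _ _ (lowerSemicontinuous_radialMaximal Φ' f).measurable (hC₂ f)
  obtain ⟨K, hK⟩ := exists_isKernelFamily f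
  have h2 := hhl C₃ _ _ (lowerSemicontinuous_nontangential (dilConv f Φ')).measurable
    (hC₃ (schwartzKernel Φ' hint (max (n + K + 1) (N + 1))) f _ le_rfl (hK Φ') K.cast_nonneg
      (le_max_left _ _) (le_max_right _ _) _ fun τ hτ y z h => enorm_le_nontangential _ hτ h)
  have h3 : varNorm p (radialMaximal Φ' f) ≤
      ‖(∫ x, Φ x)⁻¹‖₊ * varNorm p (radialMaximal Φ f) := by
    refine le_trans (le_of_eq ?_) (varNorm_const_mul_le hc _)
    congr 1; ext x
    exact radialMaximal_smul _ _ _ _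
  calc _ ≤ _ := h2
    _ ≤ (C₃ + 1) * C₁ * ((C₂ + 1) * C₁ * (‖(∫ x, Φ x)⁻¹‖₊ * varNorm p (radialMaximal Φ f))) :=
        mul_le_mul' le_rfl (h1.trans (mul_le_mul' le_rfl h3))
    _ = _ := by push_cast; ring

end GrandMaximal

end

section

/-! ### Gaussians and bounded distributions -/

section Gaussian

variable {n : ℕ}

theorem one_add_pow_mul_exp_neg_sq_le (m : ℕ) {r : ℝ} (hr : 0 ≤ r) :
    (1 + r) ^ m * Real.exp (-r ^ 2) ≤ m.factorial * Real.exp 2 := by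
  have h1 := Real.pow_div_factorial_le_exp (x := 1 + r) (by linarith) m
  rw [div_le_iff₀ (by positivity)] at h1
  calc _ ≤ Real.exp (1 + r) * m.factorial * Real.exp (-r ^ 2) := by gcongr
    _ = m.factorial * Real.exp (1 + r + -r ^ 2) := by rw [Real.exp_add (1 + r)]; ring
    _ ≤ _ := by
        gcongr
        nlinarith [sq_nonneg (r - 1 / 2)]

theorem contDiff_ofReal_exp_neg : ContDiff ℝ ((⊤ : ℕ∞) : WithTop ℕ∞)
    fun s : ℝ => ((Real.exp (-1 * s) : ℝ) : ℂ) :=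
  Complex.ofRealCLM.contDiff.comp (Real.contDiff_exp.comp (contDiff_const.mul contDiff_id))

theorem norm_iteratedFDeriv_ofReal_exp_neg (i : ℕ) (s : ℝ) :
    ‖iteratedFDeriv ℝ i (fun s : ℝ => ((Real.exp (-1 * s) : ℝ) : ℂ)) s‖ = Real.exp (-s) := by
  have h := Complex.ofRealLI.norm_iteratedFDeriv_comp_left (x := s) (i := i)
    (f := fun s : ℝ => Real.exp (-1 * s)) (n := i)
    (Real.contDiff_exp.comp (contDiff_const.mul contDiff_id)).contDiffAt le_rfl
  refine h.trans ?_
  rw [norm_iteratedFDeriv_eq_norm_iteratedDeriv, iteratedDeriv_exp_const_mul]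
  simp

/-- The Gaussian `x ↦ exp (-|x|²)`. -/
def gaussian (n : ℕ) : 𝓢(Rn n, ℂ) where
  toFun := (fun s : ℝ => ((Real.exp (-1 * s) : ℝ) : ℂ)) ∘ fun x : Rn n => ‖x‖ ^ 2
  smooth' := contDiff_ofReal_exp_neg.comp (contDiff_norm_sq ℝ)
  decay' k l := by
    obtain ⟨K, C, hC, h⟩ :=
      (Function.hasTemperateGrowth_norm_sq (Rn n)).norm_iteratedFDeriv_le_uniform l
    refine ⟨l.factorial * (1 + C) ^ l * ((k + K * l).factorial * Real.exp 2), fun x => ?_⟩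
    have h1 : ‖iteratedFDeriv ℝ l ((fun s : ℝ => ((Real.exp (-1 * s) : ℝ) : ℂ)) ∘
        fun x : Rn n => ‖x‖ ^ 2) x‖ ≤
        l.factorial * Real.exp (-‖x‖ ^ 2) * ((1 + C) * (1 + ‖x‖) ^ K) ^ l := by
      refine norm_iteratedFDeriv_comp_le (N := ((⊤ : ℕ∞) : WithTop ℕ∞)) contDiff_ofReal_exp_neg
        (contDiff_norm_sq ℝ) (by exact_mod_cast le_top) x
        (fun i _ => (norm_iteratedFDeriv_ofReal_exp_neg i _).le) fun i hi hil => ?_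
      have hD : 1 ≤ (1 + C) * (1 + ‖x‖) ^ K :=
        one_le_mul_of_one_le_of_one_le (by linarith)
          (one_le_pow₀ (by linarith [norm_nonneg x]))
      refine (h i hil x).trans (le_trans ?_ (le_self_pow₀ hD (by omega)))
      gcongr
      linarith
    have h2 := one_add_pow_mul_exp_neg_sq_le (k + K * l) (norm_nonneg x)
    calc _ ≤ (1 + ‖x‖) ^ k * (l.factorial * Real.exp (-‖x‖ ^ 2) * ((1 + C) * (1 + ‖x‖) ^ K) ^ l) := by
          gcongr
          linarith
      _ = l.factorial * (1 + C) ^ l * ((1 + ‖x‖) ^ (k + K * l) * Real.exp (-‖x‖ ^ 2)) := by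
          rw [mul_pow, ← pow_mul, pow_add]; ring
      _ ≤ _ := by gcongr

theorem gaussian_apply (x : Rn n) : gaussian n x = ((Real.exp (-‖x‖ ^ 2) : ℝ) : ℂ) := by
  change ((Real.exp (-1 * ‖x‖ ^ 2) : ℝ) : ℂ) = _
  simp

theorem affine_gaussian_apply {q : ℝ} (hq : 0 < q) (x : Rn n) :
    affine q 0 (gaussian n) x = ((Real.exp (-(q ^ 2 * ‖x‖ ^ 2)) : ℝ) : ℂ) := by
  rw [affine_apply hq.ne', gaussian_apply, add_zero, norm_smul, mul_pow, Real.norm_of_nonneg hq.le]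

theorem exp_neg_mul_exp_neg_eq {α β : ℝ} (hα : 0 < α) (hβ : 0 < β) (w y : Rn n) :
    Real.exp (-(β * ‖y‖ ^ 2)) * Real.exp (-(α * ‖w - y‖ ^ 2)) =
      Real.exp (-(α * β / (α + β) * ‖w‖ ^ 2)) *
        Real.exp (-(α + β) * ‖y - (α / (α + β)) • w‖ ^ 2) := by
  rw [← Real.exp_add, ← Real.exp_add, norm_sub_sq_real, norm_sub_sq_real, norm_smul, mul_pow,
    inner_smul_right, real_inner_comm, Real.norm_eq_abs, sq_abs]
  congr 1
  field_simp
  ring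

theorem dilConv_eq_affine (f : 𝓢'(Rn n, ℂ)) (Φ : 𝓢(Rn n, ℂ)) {s : ℝ} (hs : 0 < s) (x : Rn n) :
    dilConv f Φ s x = (((s ^ n)⁻¹ : ℝ) : ℂ) * conv f (affine s⁻¹ 0 Φ) x := by
  rw [← conv_dilate f Φ hs, dilate_eq_affine, conv_smul]

/-- For a bounded distribution the convolutions with wide Gaussians are bounded. -/
theorem conv_affine_gaussian_le {f : 𝓢'(Rn n, ℂ)} {A : ℝ}
    (hA : ∀ x, ‖conv f (affine 2 0 (gaussian n)) x‖ ≤ A) {q : ℝ} (hq : 0 < q) (hq1 : q ≤ 1)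
    (x : Rn n) : ‖conv f (affine q 0 (gaussian n)) x‖ ≤ A * (4 / q ^ 2) ^ (n / 2 : ℝ) := by
  -- Solves 4b/(4 + b) = q², so that convolving exp(-4|x|²) with exp(-b|x|²) gives κ exp(-q²|x|²): a
  -- wide Gaussian is a superposition of translates of a fixed narrow one.
  set b : ℝ := 4 * q ^ 2 / (4 - q ^ 2) with hb
  have hq2 : q ^ 2 ≤ 1 := pow_le_one₀ hq.le hq1
  have h4 : 0 < 4 - q ^ 2 := by linarith
  have hb0 : 0 < b := by positivity
  have hsb : √b ^ 2 = b := Real.sq_sqrt hb0.le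
  have hsb0 : 0 < √b := Real.sqrt_pos.2 hb0
  have hη : 4 * b / (4 + b) = q ^ 2 := by
    rw [hb]; field_simp; ring
  have hint : ∀ c : ℝ, 0 < c → ∫ y : Rn n, Real.exp (-c * ‖y‖ ^ 2) = (Real.pi / c) ^ (n / 2 : ℝ) := by
    intro c hc
    rw [GaussianFourier.integral_rexp_neg_mul_sq_norm hc, finrank_euclideanSpace, Fintype.card_fin]
  set κ : ℝ := (Real.pi / (4 + b)) ^ (n / 2 : ℝ) with hκ
  have hκ0 : 0 < κ := by positivity
  have h1 : ∀ z, ((κ : ℂ) • reflectTranslate x (affine q 0 (gaussian n))) z =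
      ∫ y, affine (√b) 0 (gaussian n) y * affine 2 0 (gaussian n) (x - y - z) := by
    intro z
    have e1 : ∀ y, affine (√b) 0 (gaussian n) y * affine 2 0 (gaussian n) (x - y - z) =
        ((Real.exp (-(q ^ 2 * ‖x - z‖ ^ 2)) *
          Real.exp (-(4 + b) * ‖y - (4 / (4 + b)) • (x - z)‖ ^ 2) : ℝ) : ℂ) := by
      intro y
      rw [affine_gaussian_apply hsb0, affine_gaussian_apply two_pos, ← Complex.ofReal_mul, hsb,
        show x - y - z = x - z - y by abel, show (2 : ℝ) ^ 2 = 4 by norm_num,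
        exp_neg_mul_exp_neg_eq (by norm_num) hb0, hη]
    simp only [e1]
    rw [integral_complex_ofReal, integral_const_mul,
      integral_sub_right_eq_self (fun y : Rn n => Real.exp (-(4 + b) * ‖y‖ ^ 2)),
      hint _ (by positivity), smul_apply, reflectTranslate_apply, affine_gaussian_apply hq,
      smul_eq_mul]
    push_cast
    ring
  have h2 := integral_conv_mul f (affine (√b) 0 (gaussian n)) (affine 2 0 (gaussian n)) _ x h1
  rw [map_smul, smul_eq_mul] at h2
  have h3 : κ * ‖conv f (affine q 0 (gaussian n)) x‖ ≤ A * (Real.pi / b) ^ (n / 2 : ℝ) := by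
    have e2 : κ * ‖conv f (affine q 0 (gaussian n)) x‖ = ‖(κ : ℂ) * conv f (affine q 0 (gaussian n)) x‖ := by
      rw [norm_mul, Complex.norm_real, Real.norm_of_nonneg hκ0.le]
    rw [e2, conv, ← h2, ← hint b hb0, ← integral_const_mul]
    refine norm_integral_le_of_norm_le ?_ (Eventually.of_forall fun y => ?_)
    · refine Integrable.const_mul ?_ A
      have := (affine (√b) 0 (gaussian n)).integrable (μ := volume).norm
      refine this.congr (Eventually.of_forall fun y => ?_)
      simp only [affine_gaussian_apply hsb0, hsb, Complex.norm_real, Real.norm_eq_abs, Real.abs_exp,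
        neg_mul]
    · rw [norm_mul, affine_gaussian_apply hsb0, hsb, Complex.norm_real, Real.norm_eq_abs,
        Real.abs_exp, neg_mul]
      gcongr
      exact hA _
  have h5 : (Real.pi / b) ^ (n / 2 : ℝ) = κ * (4 / q ^ 2) ^ (n / 2 : ℝ) := by
    rw [hκ, ← Real.mul_rpow (by positivity) (by positivity)]
    congr 1
    rw [← hη]; field_simp
  rw [h5, mul_left_comm] at h3
  exact le_of_mul_le_mul_left h3 hκ0

/-- Seminorms of wide Gaussians blow up, so for s ≥ 1 the superposition argument is used, whose
factor 2^n s^n cancels the normalization. For s ≤ 1 the uniform seminorm bound gives a power of 1/s,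
harmless against exp(-v²) when s = t/v. -/
theorem IsBoundedDistribution.exists_dilConv_gaussian_le {f : 𝓢'(Rn n, ℂ)}
    (hf : IsBoundedDistribution f) : ∃ C : ℝ, 0 ≤ C ∧ ∃ K : ℕ, ∀ s, 0 < s → ∀ x,
      ‖dilConv f (gaussian n) s x‖ ≤ C * (1 + s⁻¹) ^ K := by
  obtain ⟨K, C, hC, h⟩ := hf.exists_bound
  have hA := h (affine 2 0 (gaussian n))
  set A := C * schwartzNorm K (affine 2 0 (gaussian n)) with hAdef
  set A' := C * (2 ^ K * (2 ^ K * schwartzNorm K (gaussian n))) with hA'def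
  have hγ := apply_nonneg (schwartzNorm (n := n) K) (gaussian n)
  have hA0 : 0 ≤ A := mul_nonneg hC (apply_nonneg _ _)
  have hA'0 : 0 ≤ A' := by positivity
  refine ⟨A * 2 ^ n + A', by positivity, n + K, fun s hs x => ?_⟩
  have hsi : 0 < s⁻¹ := inv_pos.2 hs
  rw [dilConv_eq_affine f _ hs, norm_mul, Complex.norm_real, Real.norm_of_nonneg (by positivity),
    ← inv_pow]
  rcases le_total s⁻¹ 1 with h1 | h1
  · have h2 := conv_affine_gaussian_le hA hsi h1 x
    have h3 : ((4 : ℝ) / s⁻¹ ^ 2) ^ (n / 2 : ℝ) = 2 ^ n * (s⁻¹ ^ n)⁻¹ := by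
      rw [show (4 : ℝ) / s⁻¹ ^ 2 = (2 / s⁻¹) ^ (2 : ℝ) by
        rw [Real.rpow_two, div_pow]; norm_num, ← Real.rpow_mul (by positivity),
        mul_div_cancel₀ _ (two_ne_zero), Real.rpow_natCast, div_pow, div_eq_mul_inv]
    calc _ ≤ s⁻¹ ^ n * (A * (2 ^ n * (s⁻¹ ^ n)⁻¹)) := by
          rw [← h3]; gcongr
      _ = A * 2 ^ n * 1 := by field_simp
      _ ≤ _ := by
          gcongr
          · linarith
          · exact one_le_pow₀ (by linarith)
  · have h2 : ‖conv f (affine s⁻¹ 0 (gaussian n)) x‖ ≤ A' * s⁻¹ ^ K := by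
      refine (h _ x).trans ?_
      have := schwartzNorm_affine_le (δ := 1) (a := s⁻¹) (A := s⁻¹) (H := 0) (h := (0 : Rn n)) one_pos
        (by rwa [abs_of_pos hsi]) (by rw [abs_of_pos hsi]) h1 (by simp) K (gaussian n)
      rw [hA'def, mul_assoc C]
      refine mul_le_mul_of_nonneg_left (this.trans (le_of_eq ?_)) hC
      norm_num; ring
    calc _ ≤ s⁻¹ ^ n * (A' * s⁻¹ ^ K) := by gcongr
      _ = A' * s⁻¹ ^ (n + K) := by rw [pow_add]; ring
      _ ≤ _ := by
          gcongr
          · have : 0 ≤ A * 2 ^ n := by positivity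
            linarith
          · linarith

end Gaussian

end

section

/-! ### Subordination and the Poisson extension -/

section Poisson

variable {n : ℕ}

theorem integrableOn_one_add_pow_mul_exp_neg_sq (m : ℕ) :
    IntegrableOn (fun v : ℝ => (1 + v) ^ m * Real.exp (-v ^ 2)) (Ioi 0) := by
  have h := (integrable_one_add_norm (E := ℝ) (μ := volume) (r := 2) (by simp)).const_mul
    ((m + 2).factorial * Real.exp 2)
  refine h.integrableOn.mono' (by fun_prop) ?_
  filter_upwards [ae_restrict_mem measurableSet_Ioi] with v hv
  have hv0 : 0 < v := hv
  have h1 := one_add_pow_mul_exp_neg_sq_le (m + 2) hv0.le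
  have h2 : (0 : ℝ) < 1 + v := by linarith
  rw [Real.norm_of_nonneg (by positivity), Real.norm_of_nonneg hv0.le, Real.rpow_neg h2.le,
    Real.rpow_two, ← div_eq_mul_inv, le_div_iff₀ (by positivity)]
  calc _ = (1 + v) ^ (m + 2) * Real.exp (-v ^ 2) := by ring
    _ ≤ _ := h1

theorem integrableOn_one_add_div_pow_mul_exp_neg_sq (m : ℕ) {t : ℝ} (ht : 0 < t) (C : ℝ) :
    IntegrableOn (fun v : ℝ => Real.exp (-v ^ 2) * (C * (1 + v / t) ^ m)) (Ioi 0) := by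
  have h := (integrableOn_one_add_pow_mul_exp_neg_sq m).const_mul (|C| * (1 + t⁻¹) ^ m)
  refine h.mono' (Continuous.aestronglyMeasurable (by fun_prop)) ?_
  filter_upwards [ae_restrict_mem measurableSet_Ioi] with v hv
  have hv0 : 0 < v := hv
  have ht' : 0 < t⁻¹ := inv_pos.2 ht
  rw [norm_mul, norm_mul, Real.norm_of_nonneg (Real.exp_pos _).le, norm_pow, Real.norm_eq_abs C,
    Real.norm_of_nonneg (show 0 ≤ 1 + v / t by positivity)]
  have h1 : 1 + v / t ≤ (1 + t⁻¹) * (1 + v) := by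
    rw [div_eq_mul_inv]
    nlinarith [mul_pos hv0 ht']
  calc _ ≤ Real.exp (-v ^ 2) * (|C| * ((1 + t⁻¹) * (1 + v)) ^ m) := by gcongr
    _ = _ := by rw [mul_pow]; ring

theorem integral_pow_mul_exp_neg_mul_sq (n : ℕ) {r : ℝ} (hr : 0 < r) :
    ∫ v in Ioi (0 : ℝ), v ^ n * Real.exp (-r * v ^ 2) =
      r ^ (-(((n : ℝ) + 1) / 2)) * (1 / 2) * Real.Gamma (((n : ℝ) + 1) / 2) := by
  have h := integral_rpow_mul_exp_neg_mul_rpow (p := 2) (q := n) two_pos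
    (by linarith [n.cast_nonneg (α := ℝ)]) hr
  rw [neg_div] at h
  rw [← h]
  simp

/-- The normalizing constant of the subordination formula. -/
def poissonConst (n : ℕ) : ℝ := 2 / Real.pi ^ (((n : ℝ) + 1) / 2)

theorem poissonConst_pos (n : ℕ) : 0 < poissonConst n := by unfold poissonConst; positivity

/-- Subordination: the integral of v^n exp(-r v²) with r = 1 + |z/t|² is a Gamma integral
proportional to r^(-(n+1)/2). Thus P_t mixes Gaussians of scale t/v with weight exp(-v²). -/
theorem poissonDilate_eq {t : ℝ} (ht : 0 < t) (z : Rn n) :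
    poissonDilate t z = poissonConst n * ∫ v in Ioi (0 : ℝ),
      Real.exp (-v ^ 2) * ((v / t) ^ n * Real.exp (-((v / t) ^ 2 * ‖z‖ ^ 2))) := by
  have hr : 0 < 1 + ‖t⁻¹ • z‖ ^ 2 := by positivity
  have h1 : ∀ v : ℝ, Real.exp (-v ^ 2) * ((v / t) ^ n * Real.exp (-((v / t) ^ 2 * ‖z‖ ^ 2))) =
      (t ^ n)⁻¹ * (v ^ n * Real.exp (-(1 + ‖t⁻¹ • z‖ ^ 2) * v ^ 2)) := by
    intro v
    rw [mul_left_comm, ← Real.exp_add, norm_smul, norm_inv, Real.norm_of_nonneg ht.le, div_pow]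
    rw [show -v ^ 2 + -((v / t) ^ 2 * ‖z‖ ^ 2) = -(1 + (t⁻¹ * ‖z‖) ^ 2) * v ^ 2 by
      field_simp; ring]
    ring
  simp only [h1]
  rw [integral_const_mul, integral_pow_mul_exp_neg_mul_sq n hr, Real.rpow_neg hr.le, poissonDilate,
    poisson, poissonConst]
  ring

theorem dilate_gaussian_apply {s : ℝ} (hs : 0 < s) (z : Rn n) :
    dilate s hs (gaussian n) z =
      ((s⁻¹ ^ n * Real.exp (-(s⁻¹ ^ 2 * ‖z‖ ^ 2)) : ℝ) : ℂ) := by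
  rw [dilate_eq_affine, smul_apply, affine_gaussian_apply (inv_pos.2 hs), smul_eq_mul,
    ← Complex.ofReal_mul, inv_pow s n]

theorem continuousAt_dilConv (f : 𝓢'(Rn n, ℂ)) (Φ : 𝓢(Rn n, ℂ)) {q : ℝ × Rn n} (hq : q.1 ≠ 0) :
    ContinuousAt (fun q : ℝ × Rn n => dilConv f Φ q.1 q.2) q := by
  have h1 : ContinuousAt (fun q : ℝ × Rn n => (-q.1⁻¹, q.1⁻¹ • q.2)) q :=
    ((continuousAt_fst.inv₀ hq).neg).prodMk ((continuousAt_fst.inv₀ hq).smul continuousAt_snd)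
  have h2 : ContinuousAt (fun q : ℝ × Rn n => affine (-q.1⁻¹) (q.1⁻¹ • q.2) Φ) q :=
    ContinuousAt.comp (g := fun q : ℝ × Rn n => affine q.1 q.2 Φ) (f := fun q : ℝ × Rn n =>
      (-q.1⁻¹, q.1⁻¹ • q.2)) (continuousAt_affine Φ (by simpa using hq)) h1
  have h3 : ContinuousAt (fun q : ℝ × Rn n => f (affine (-q.1⁻¹) (q.1⁻¹ • q.2) Φ)) q :=
    f.cont.continuousAt.comp h2
  have h4 : ContinuousAt (fun q : ℝ × Rn n => (((q.1 ^ n)⁻¹ : ℝ) : ℂ)) q :=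
    Complex.continuous_ofReal.continuousAt.comp ((continuousAt_fst.pow n).inv₀ (pow_ne_zero n hq))
  exact h4.mul h3

/-- The Poisson extension of a bounded distribution, by subordination. -/
def poissonExt (f : 𝓢'(Rn n, ℂ)) (t : ℝ) (y : Rn n) : ℂ :=
  poissonConst n * ∫ v in Ioi (0 : ℝ), ((Real.exp (-v ^ 2) : ℝ) : ℂ) * dilConv f (gaussian n) (t / v) y

theorem continuousOn_subordination (f : 𝓢'(Rn n, ℂ)) {t : ℝ} (ht : 0 < t) :
    ContinuousOn (fun q : ℝ × Rn n => ((Real.exp (-q.1 ^ 2) : ℝ) : ℂ) *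
      dilConv f (gaussian n) (t / q.1) q.2) (Ioi 0 ×ˢ univ) := by
  intro q hq
  have hq1 : 0 < q.1 := hq.1
  have h1 : ContinuousAt (fun q : ℝ × Rn n => (t / q.1, q.2)) q :=
    (continuousAt_const.div continuousAt_fst hq1.ne').prodMk continuousAt_snd
  have h2 : ContinuousAt (fun q : ℝ × Rn n => dilConv f (gaussian n) (t / q.1) q.2) q :=
    ContinuousAt.comp (g := fun q : ℝ × Rn n => dilConv f (gaussian n) q.1 q.2)
      (f := fun q : ℝ × Rn n => (t / q.1, q.2))
      (continuousAt_dilConv f _ (div_pos ht hq1).ne') h1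
  refine (ContinuousAt.mul (Continuous.continuousAt ?_) h2).continuousWithinAt
  fun_prop

theorem norm_subordination_le {f : 𝓢'(Rn n, ℂ)} {C : ℝ} {K : ℕ}
    (h : ∀ s, 0 < s → ∀ x, ‖dilConv f (gaussian n) s x‖ ≤ C * (1 + s⁻¹) ^ K) {t v : ℝ} (ht : 0 < t)
    (hv : 0 < v) (y : Rn n) :
    ‖((Real.exp (-v ^ 2) : ℝ) : ℂ) * dilConv f (gaussian n) (t / v) y‖ ≤
      Real.exp (-v ^ 2) * (C * (1 + v / t) ^ K) := by
  rw [norm_mul, Complex.norm_real, Real.norm_of_nonneg (Real.exp_pos _).le]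
  have := h (t / v) (div_pos ht hv) y
  rw [inv_div] at this
  gcongr

theorem aestronglyMeasurable_subordination (f : 𝓢'(Rn n, ℂ)) {t : ℝ} (ht : 0 < t) (y : Rn n) :
    AEStronglyMeasurable (fun v : ℝ => ((Real.exp (-v ^ 2) : ℝ) : ℂ) *
      dilConv f (gaussian n) (t / v) y) (volume.restrict (Ioi 0)) := by
  refine ContinuousOn.aestronglyMeasurable ?_ measurableSet_Ioi
  exact (continuousOn_subordination f ht).comp (f := fun v : ℝ => (v, y)) (by fun_prop)
    fun v hv => ⟨hv, mem_univ _⟩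

/-- The Gaussians in the mixture all have mass π^(n/2), leaving the integral of exp(-v²). -/
theorem integrable_gaussian_mixture {t : ℝ} (ht : 0 < t) :
    Integrable (fun q : ℝ × Rn n => Real.exp (-q.1 ^ 2) * ((q.1 / t) ^ n *
      Real.exp (-((q.1 / t) ^ 2 * ‖q.2‖ ^ 2)))) ((volume.restrict (Ioi 0)).prod volume) := by
  have hc : Continuous fun q : ℝ × Rn n => Real.exp (-q.1 ^ 2) * ((q.1 / t) ^ n *
      Real.exp (-((q.1 / t) ^ 2 * ‖q.2‖ ^ 2))) := by fun_prop
  have hint : ∀ q : ℝ, 0 < q → ∫ z : Rn n, Real.exp (-(q ^ 2 * ‖z‖ ^ 2)) =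
      (q ^ n)⁻¹ * Real.pi ^ (n / 2 : ℝ) := by
    intro q hq
    have := GaussianFourier.integral_rexp_neg_mul_sq_norm (V := Rn n) (pow_pos hq 2)
    rw [finrank_euclideanSpace, Fintype.card_fin] at this
    simp only [neg_mul] at this
    rw [this, Real.div_rpow Real.pi_pos.le (by positivity), ← Real.rpow_two, ← Real.rpow_mul hq.le,
      mul_div_cancel₀ _ (two_ne_zero), Real.rpow_natCast, div_eq_inv_mul]
  refine (integrable_prod_iff hc.aestronglyMeasurable).2 ⟨?_, ?_⟩
  · filter_upwards [ae_restrict_mem measurableSet_Ioi] with v hv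
    have hq : 0 < v / t := div_pos hv ht
    refine Integrable.const_mul (Integrable.const_mul ?_ _) _
    have := (affine (v / t) 0 (gaussian n)).integrable (μ := volume).norm
    refine this.congr (Eventually.of_forall fun y => ?_)
    simp only [affine_gaussian_apply hq, Complex.norm_real, Real.norm_eq_abs, Real.abs_exp]
  · have h0 : IntegrableOn (fun v : ℝ => Real.exp (-v ^ 2) * Real.pi ^ (n / 2 : ℝ)) (Ioi 0) := by
      simpa using integrableOn_one_add_div_pow_mul_exp_neg_sq 0 ht (Real.pi ^ (n / 2 : ℝ))
    refine h0.congr ?_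
    filter_upwards [ae_restrict_mem measurableSet_Ioi] with v hv
    have hv0 : 0 < v := hv
    have hq : 0 < v / t := div_pos hv ht
    have e : ∀ z : Rn n, ‖Real.exp (-v ^ 2) * ((v / t) ^ n * Real.exp (-((v / t) ^ 2 * ‖z‖ ^ 2)))‖ =
        Real.exp (-v ^ 2) * ((v / t) ^ n * Real.exp (-((v / t) ^ 2 * ‖z‖ ^ 2))) := fun z =>
      Real.norm_of_nonneg (by positivity)
    simp only [e]
    rw [integral_const_mul, integral_const_mul, hint _ hq, mul_inv_cancel_left₀ (by positivity)]

theorem integral_dilConv_mul (f : 𝓢'(Rn n, ℂ)) (Φ φ : 𝓢(Rn n, ℂ)) {s : ℝ} (hs : 0 < s) :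
    ∫ x, dilConv f Φ s x * φ x = ∫ z, conv f (reflect φ) z * dilate s hs Φ (-z) := by
  have h := integral_conv_comm f (reflect φ) (dilate s hs Φ) 0
  rw [conv_dilate f Φ hs] at h
  simp only [zero_sub, reflect_apply] at h
  rw [integral_neg_eq_self fun x => dilConv f Φ s x * φ x] at h
  rw [h, ← integral_neg_eq_self]
  simp

/-- The defining weak identity holds for each Gaussian of the mixture and is integrated over v by
Fubini on both sides, using the bound of f * Φ_s on the left and that of f * φ~ on the right. -/
theorem IsBoundedDistribution.isPoissonConv_poissonExt {f : 𝓢'(Rn n, ℂ)}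
    (hf : IsBoundedDistribution f) {t : ℝ} (ht : 0 < t) : IsPoissonConv f t (poissonExt f t) := by
  obtain ⟨C, hC, K, h⟩ := hf.exists_dilConv_gaussian_le
  have hG := integrableOn_one_add_div_pow_mul_exp_neg_sq K ht C
  have hb : ∀ y, ∀ᵐ v ∂volume.restrict (Ioi (0 : ℝ)),
      ‖((Real.exp (-v ^ 2) : ℝ) : ℂ) * dilConv f (gaussian n) (t / v) y‖ ≤
      Real.exp (-v ^ 2) * (C * (1 + v / t) ^ K) := fun y => by
    filter_upwards [ae_restrict_mem measurableSet_Ioi] with v hv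
    exact norm_subordination_le h ht hv y
  refine ⟨?_, ⟨poissonConst n * ∫ v in Ioi (0 : ℝ), Real.exp (-v ^ 2) * (C * (1 + v / t) ^ K),
    fun x => ?_⟩, fun φ => ?_⟩
  · refine continuous_const.mul (continuous_of_dominated
      (fun y => aestronglyMeasurable_subordination f ht y) hb hG ?_)
    filter_upwards [ae_restrict_mem measurableSet_Ioi] with v hv
    have hv0 : 0 < v := hv
    refine continuous_const.mul ?_
    rw [← conv_dilate f _ (div_pos ht hv0)]
    exact continuous_conv _ _
  · rw [poissonExt, norm_mul, Complex.norm_real, Real.norm_of_nonneg (poissonConst_pos n).le]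
    exact mul_le_mul_of_nonneg_left (norm_integral_le_of_norm_le hG (hb x)) (poissonConst_pos n).le
  · have e1 : ∀ x, poissonExt f t x * φ x = poissonConst n * ∫ v in Ioi (0 : ℝ),
        ((Real.exp (-v ^ 2) : ℝ) : ℂ) * dilConv f (gaussian n) (t / v) x * φ x := fun x => by
      rw [poissonExt, mul_assoc, ← integral_mul_const]
    have e2 : ∀ z, conv f (reflect φ) z * (poissonDilate t (-z) : ℂ) = poissonConst n *
        ∫ v in Ioi (0 : ℝ), conv f (reflect φ) z * ((Real.exp (-v ^ 2) *
          ((v / t) ^ n * Real.exp (-((v / t) ^ 2 * ‖z‖ ^ 2))) : ℝ) : ℂ) := fun z => by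
      rw [poissonDilate_eq ht, norm_neg, integral_const_mul, integral_complex_ofReal]
      push_cast; ring
    simp only [e1, e2]
    rw [integral_const_mul, integral_const_mul]
    congr 1
    have hI1 : Integrable (Function.uncurry fun (x : Rn n) (v : ℝ) =>
        ((Real.exp (-v ^ 2) : ℝ) : ℂ) * dilConv f (gaussian n) (t / v) x * φ x)
        (volume.prod (volume.restrict (Ioi 0))) := by
      have hp := (φ.integrable (μ := volume)).norm.mul_prod hG
      have hres : (volume : Measure (Rn n)).prod (volume.restrict (Ioi (0 : ℝ))) =
          ((volume : Measure (Rn n)).prod (volume : Measure ℝ)).restrict (univ ×ˢ Ioi 0) := by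
        rw [← Measure.prod_restrict, Measure.restrict_univ]
      have hms : MeasurableSet ((univ : Set (Rn n)) ×ˢ Ioi (0 : ℝ)) :=
        MeasurableSet.univ.prod measurableSet_Ioi
      refine hp.mono' ?_ ?_
      · rw [hres]
        refine ContinuousOn.aestronglyMeasurable ?_ hms
        refine ContinuousOn.mul ((continuousOn_subordination f ht).comp
          (f := fun q : Rn n × ℝ => (q.2, q.1)) (by fun_prop) fun q hq => ⟨hq.2, mem_univ _⟩) ?_
        exact (φ.continuous.comp continuous_fst).continuousOn
      · rw [hres]
        filter_upwards [ae_restrict_mem hms] with q hq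
        simp only [Function.uncurry_def]
        rw [norm_mul, mul_comm]
        exact mul_le_mul_of_nonneg_left (norm_subordination_le h ht hq.2 q.1) (norm_nonneg _)
    have hI2 : Integrable (Function.uncurry fun (z : Rn n) (v : ℝ) =>
        conv f (reflect φ) z * ((Real.exp (-v ^ 2) *
          ((v / t) ^ n * Real.exp (-((v / t) ^ 2 * ‖z‖ ^ 2))) : ℝ) : ℂ))
        (volume.prod (volume.restrict (Ioi 0))) := by
      obtain ⟨K', C', -, hA⟩ := hf.exists_bound
      exact Integrable.bdd_mul (c := C' * schwartzNorm K' (reflect φ))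
        (integrable_gaussian_mixture (n := n) ht).swap.ofReal
        ((continuous_conv f (reflect φ)).comp continuous_fst).aestronglyMeasurable
        (Eventually.of_forall fun q => hA _ _)
    rw [integral_integral_swap hI1, integral_integral_swap hI2]
    refine setIntegral_congr_fun measurableSet_Ioi fun v hv => ?_
    have hs : 0 < t / v := div_pos ht hv
    have h1 := integral_dilConv_mul f (gaussian n) φ hs
    simp only [mul_assoc]
    rw [integral_const_mul, h1, ← integral_const_mul]
    congr 1; ext z
    rw [dilate_gaussian_apply, inv_div, norm_neg]
    push_cast; ring

theorem IsPoissonConv.unique {f : 𝓢'(Rn n, ℂ)} {t : ℝ} {g g' : Rn n → ℂ} (h : IsPoissonConv f t g)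
    (h' : IsPoissonConv f t g') : g = g' := by
  obtain ⟨hc, ⟨A, hA⟩, hg⟩ := h
  obtain ⟨hc', ⟨A', hA'⟩, hg'⟩ := h'
  have hint : ∀ {g : Rn n → ℂ} {A : ℝ}, Continuous g → (∀ x, ‖g x‖ ≤ A) → ∀ φ : 𝓢(Rn n, ℂ),
      Integrable fun x => g x * φ x := fun hc hA φ =>
    φ.integrable.bdd_mul hc.aestronglyMeasurable (Eventually.of_forall hA)
  have hae : ∀ᵐ x ∂volume, (g - g') x = 0 := by
    refine ae_eq_zero_of_integral_contDiff_smul_eq_zero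
      (hc.sub hc').locallyIntegrable fun η hη hηc => ?_
    have hηc' : HasCompactSupport fun x => (η x : ℂ) := hηc.comp_left Complex.ofReal_zero
    set φ : 𝓢(Rn n, ℂ) := hηc'.toSchwartzMap (Complex.ofRealCLM.contDiff.comp hη) with hφ
    have h1 := (hg φ).trans (hg' φ).symm
    rw [← sub_eq_zero, ← integral_sub (hint hc hA φ) (hint hc' hA' φ)] at h1
    rw [← h1]
    congr 1; ext x
    rw [Complex.real_smul, Pi.sub_apply, ← sub_mul, mul_comm]
    rfl
  have := (hc.sub hc').ae_eq_iff_eq volume continuous_zero |>.1 hae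
  exact sub_eq_zero.1 this

/-- Uniqueness among continuous functions identifies the chosen representative with the explicit
subordination integral. -/
theorem IsBoundedDistribution.poissonConv_eq {f : 𝓢'(Rn n, ℂ)} (hf : IsBoundedDistribution f)
    {t : ℝ} (ht : 0 < t) : poissonConv f t = poissonExt f t := by
  have h : ∃ g, IsPoissonConv f t g := ⟨_, hf.isPoissonConv_poissonExt ht⟩
  rw [poissonConv, dif_pos h]
  exact h.choose_spec.unique (hf.isPoissonConv_poissonExt ht)

end Poisson

end

section

/-! ### A rapidly decaying kernel built from Poisson kernels -/

section PoissonKernel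

variable {n : ℕ}

theorem pow_mul_exp_integrableOn (m : ℕ) {r : ℝ} (hr : 1 ≤ r) :
    IntegrableOn (fun v : ℝ => v ^ m * Real.exp (-r * v ^ 2)) (Ioi 0) := by
  refine (integrableOn_one_add_pow_mul_exp_neg_sq m).mono'
    (Continuous.aestronglyMeasurable (by fun_prop)) ?_
  filter_upwards [ae_restrict_mem measurableSet_Ioi] with v hv
  have hv0 : 0 < v := hv
  rw [Real.norm_of_nonneg (by positivity)]
  gcongr
  · linarith
  · nlinarith [sq_nonneg v]

theorem inv_mul_poissonDilate_eq {σ : ℝ} (hσ : 0 < σ) (z : Rn n) :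
    σ⁻¹ * poissonDilate σ z = poissonConst n * ∫ v in Ioi (0 : ℝ),
      v ^ n * Real.exp (-(σ ^ 2 + ‖z‖ ^ 2) * v ^ 2) := by
  have hr : 0 < 1 + ‖σ⁻¹ • z‖ ^ 2 := by positivity
  have hr' : 0 < σ ^ 2 + ‖z‖ ^ 2 := by positivity
  have h1 : σ ^ 2 + ‖z‖ ^ 2 = σ ^ (2 : ℝ) * (1 + ‖σ⁻¹ • z‖ ^ 2) := by
    rw [norm_smul, norm_inv, Real.norm_of_nonneg hσ.le, Real.rpow_two]
    field_simp
  have h2 : (σ ^ (2 : ℝ)) ^ (((n : ℝ) + 1) / 2) = σ * σ ^ n := by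
    rw [← Real.rpow_mul hσ.le, mul_div_cancel₀ _ two_ne_zero, Real.rpow_add_one hσ.ne',
      Real.rpow_natCast, mul_comm]
  rw [integral_pow_mul_exp_neg_mul_sq n hr', h1, Real.rpow_neg (by positivity),
    Real.mul_rpow (by positivity) hr.le, h2, poissonDilate, poisson, poissonConst]
  field_simp

theorem continuous_poissonDilate {t : ℝ} : Continuous (poissonDilate t : Rn n → ℝ) := by
  unfold poissonDilate poisson
  refine continuous_const.mul (continuous_const.mul (Continuous.div continuous_const
    (Continuous.rpow_const (by fun_prop) fun x => Or.inl ?_) fun x => ?_)) <;> positivity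

theorem integrable_poissonDilate {t : ℝ} (ht : 0 < t) : Integrable (poissonDilate t : Rn n → ℝ) := by
  have := (integrable_gaussian_mixture (n := n) ht).integral_prod_right.const_mul (poissonConst n)
  exact this.congr (Eventually.of_forall fun z => (poissonDilate_eq ht z).symm)

/-- A combination of dilated Poisson kernels with fast decay. -/
def fastKernel (n J : ℕ) (z : Rn n) : ℝ :=
  ∑ j ∈ Finset.range (J + 1), (-1) ^ j * J.choose j * (√(1 + j))⁻¹ * poissonDilate (√(1 + j)) z

/-- Decay at infinity is governed by v near 0, so the subordination integrand is multiplied by (1 -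
exp(-v²))^J, which vanishes there to order 2J. In the binomial expansion exp(-j v²) turns 1 + |z|²
into σ² + |z|² with σ = √(1 + j), that is, into σ⁻¹ P_σ. -/
theorem fastKernel_eq (J : ℕ) (z : Rn n) : fastKernel n J z = poissonConst n *
    ∫ v in Ioi (0 : ℝ), v ^ n * Real.exp (-(1 + ‖z‖ ^ 2) * v ^ 2) * (1 - Real.exp (-v ^ 2)) ^ J := by
  have hj : ∀ j : ℕ, (0 : ℝ) < 1 + j := fun j => by positivity
  have h1 : ∀ v : ℝ, v ^ n * Real.exp (-(1 + ‖z‖ ^ 2) * v ^ 2) * (1 - Real.exp (-v ^ 2)) ^ J =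
      ∑ j ∈ Finset.range (J + 1), (-1) ^ j * J.choose j *
        (v ^ n * Real.exp (-(√(1 + j) ^ 2 + ‖z‖ ^ 2) * v ^ 2)) := by
    intro v
    rw [sub_eq_neg_add, add_pow, Finset.mul_sum]
    refine Finset.sum_congr rfl fun j _ => ?_
    rw [Real.sq_sqrt (hj j).le, show -(1 + (j : ℝ) + ‖z‖ ^ 2) * v ^ 2 =
      -(1 + ‖z‖ ^ 2) * v ^ 2 + j * (-v ^ 2) by ring, Real.exp_add, Real.exp_nat_mul, neg_pow]
    ring
  simp only [h1]
  rw [integral_finsetSum, Finset.mul_sum]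
  · refine Finset.sum_congr rfl fun j _ => ?_
    rw [integral_const_mul, mul_assoc, inv_mul_poissonDilate_eq (Real.sqrt_pos.2 (hj j))]
    ring
  · intro j _
    refine Integrable.const_mul (pow_mul_exp_integrableOn n ?_) _
    rw [Real.sq_sqrt (hj j).le]
    have := sq_nonneg ‖z‖
    linarith [j.cast_nonneg (α := ℝ)]

theorem one_sub_exp_neg_sq_mem (v : ℝ) : 0 ≤ 1 - Real.exp (-v ^ 2) ∧ 1 - Real.exp (-v ^ 2) ≤ v ^ 2 := by
  constructor
  · have := Real.exp_le_one_iff.2 (show -v ^ 2 ≤ 0 by nlinarith [sq_nonneg v])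
    linarith
  · have := Real.add_one_le_exp (-v ^ 2)
    linarith

theorem fastKernel_integrableOn (J : ℕ) (z : Rn n) : IntegrableOn (fun v : ℝ =>
    v ^ n * Real.exp (-(1 + ‖z‖ ^ 2) * v ^ 2) * (1 - Real.exp (-v ^ 2)) ^ J) (Ioi 0) := by
  have hr : 1 ≤ 1 + ‖z‖ ^ 2 := by linarith [sq_nonneg ‖z‖]
  refine (pow_mul_exp_integrableOn (n + 2 * J) hr).mono'
    (Continuous.aestronglyMeasurable (by fun_prop)) ?_
  filter_upwards [ae_restrict_mem measurableSet_Ioi] with v hv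
  have hv0 : 0 < v := hv
  obtain ⟨h1, h2⟩ := one_sub_exp_neg_sq_mem v
  rw [Real.norm_of_nonneg (by positivity), pow_add, pow_mul, mul_right_comm]
  gcongr

/-- The signs in the combination alternate, but the integral representation has a positive
integrand. Hence the total mass is nonzero and the kernel can be normalized. -/
theorem fastKernel_pos (J : ℕ) (z : Rn n) : 0 < fastKernel n J z := by
  rw [fastKernel_eq]
  refine mul_pos (poissonConst_pos n) ?_
  have hpos : ∀ v ∈ Ioi (0 : ℝ),
      0 < v ^ n * Real.exp (-(1 + ‖z‖ ^ 2) * v ^ 2) * (1 - Real.exp (-v ^ 2)) ^ J := by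
    intro v hv
    have hv0 : 0 < v := hv
    have h1 : 0 < 1 - Real.exp (-v ^ 2) := by
      have := Real.exp_lt_one_iff.2 (show -v ^ 2 < 0 by nlinarith [pow_pos hv0 2])
      linarith
    positivity
  rw [setIntegral_pos_iff_support_of_nonneg_ae]
  · refine lt_of_lt_of_le ?_ (measure_mono fun v (hv : v ∈ Ioi (0 : ℝ)) => ⟨(hpos v hv).ne', hv⟩)
    simp
  · filter_upwards [ae_restrict_mem measurableSet_Ioi] with v hv
    exact (hpos v hv).le
  · exact fastKernel_integrableOn J z

/-- Replacing (1 - exp(-v²))^J by v^(2J) raises the exponent of the Gamma integral from (n + 1)/2 to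
(n + 2J + 1)/2. -/
theorem exists_fastKernel_le (n J : ℕ) : ∃ C : ℝ, ∀ z : Rn n,
    fastKernel n J z ≤ C * (1 + ‖z‖) ^ (-((n : ℝ) + 2 * J + 1)) := by
  set a : ℝ := ((n : ℝ) + 2 * J + 1) / 2 with ha
  have ha0 : 0 ≤ a := by positivity
  have hG : 0 < Real.Gamma a := Real.Gamma_pos_of_pos (by positivity)
  refine ⟨poissonConst n * (2 ^ a * (1 / 2) * Real.Gamma a), fun z => ?_⟩
  have hr : 0 < 1 + ‖z‖ ^ 2 := by positivity
  have hz : 0 < 1 + ‖z‖ := by positivity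
  have h1 : ∫ v in Ioi (0 : ℝ), v ^ n * Real.exp (-(1 + ‖z‖ ^ 2) * v ^ 2) *
      (1 - Real.exp (-v ^ 2)) ^ J ≤ (1 + ‖z‖ ^ 2) ^ (-a) * (1 / 2) * Real.Gamma a := by
    have h := integral_pow_mul_exp_neg_mul_sq (n + 2 * J) hr
    push_cast at h
    rw [← ha] at h
    rw [← h]
    refine setIntegral_mono_on (fastKernel_integrableOn J z)
      (pow_mul_exp_integrableOn _ (by linarith [sq_nonneg ‖z‖])) measurableSet_Ioi fun v hv => ?_
    have hv0 : 0 < v := hv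
    obtain ⟨h1, h2⟩ := one_sub_exp_neg_sq_mem v
    rw [pow_add, pow_mul, mul_right_comm]
    gcongr
  have h2 : (1 + ‖z‖ ^ 2) ^ (-a) ≤ 2 ^ a * (1 + ‖z‖) ^ (-((n : ℝ) + 2 * J + 1)) := by
    have h3 : (1 + ‖z‖) ^ (2 : ℝ) / 2 ≤ 1 + ‖z‖ ^ 2 := by
      rw [Real.rpow_two]
      nlinarith [sq_nonneg (‖z‖ - 1)]
    refine (Real.rpow_le_rpow_of_nonpos (by positivity) h3 (by linarith)).trans (le_of_eq ?_)
    rw [Real.div_rpow (by positivity) two_pos.le, ← Real.rpow_mul hz.le, Real.rpow_neg two_pos.le,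
      div_inv_eq_mul, mul_comm]
    congr 2
    rw [ha]; ring
  have h4 : (1 + ‖z‖ ^ 2) ^ (-a) * (1 / 2) * Real.Gamma a ≤
      2 ^ a * (1 + ‖z‖) ^ (-((n : ℝ) + 2 * J + 1)) * (1 / 2) * Real.Gamma a := by gcongr
  rw [fastKernel_eq, mul_assoc]
  refine mul_le_mul_of_nonneg_left (h1.trans (h4.trans (le_of_eq ?_))) (poissonConst_pos n).le
  ring

theorem continuous_fastKernel (n J : ℕ) : Continuous (fastKernel n J) := by
  unfold fastKernel
  exact continuous_finsetSum _ fun j _ => continuous_const.mul continuous_poissonDilate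

theorem integrable_fastKernel_mul {J : ℕ} {R : ℝ} (hJ : R ≤ 2 * J) :
    Integrable fun z : Rn n => fastKernel n J z * (1 + ‖z‖) ^ R := by
  obtain ⟨C, hC⟩ := exists_fastKernel_le n J
  refine ((integrable_one_add_norm_rpow_neg (n := n) (L := n + 2 * J + 1 - R) (by linarith)).const_mul
    C).mono' ((continuous_fastKernel n J).mul
      (continuous_one_add_norm_rpow R)).aestronglyMeasurable (Eventually.of_forall fun z => ?_)
  have hz : 0 < 1 + ‖z‖ := by positivity
  have := (fastKernel_pos J z).le
  rw [Real.norm_of_nonneg (by positivity)]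
  calc _ ≤ C * (1 + ‖z‖) ^ (-((n : ℝ) + 2 * J + 1)) * (1 + ‖z‖) ^ R := by
        gcongr; exact hC z
    _ = _ := by
        rw [mul_assoc, ← Real.rpow_add hz]; congr 2; ring

theorem integrable_fastKernel (n J : ℕ) : Integrable (fastKernel n J) := by
  simpa using integrable_fastKernel_mul (n := n) (J := J) (R := 0) (by positivity)

theorem integral_fastKernel_pos (n J : ℕ) : 0 < ∫ z, fastKernel n J z := by
  rw [integral_pos_iff_support_of_nonneg (fun z => (fastKernel_pos J z).le)
    (integrable_fastKernel n J), show Function.support (fastKernel n J) = univ from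
      eq_univ_of_forall fun z => (fastKernel_pos J z).ne']
  exact isOpen_univ.measure_pos volume univ_nonempty

/-- The averaging kernel proportional to a positive function. -/
def AvgKernel.ofPos {R : ℝ} (k : Rn n → ℝ) (hk : Continuous k) (hk0 : ∀ z, 0 ≤ k z)
    (hi : Integrable fun z => k z * (1 + ‖z‖) ^ R) (hI : 0 < ∫ z, k z) : AvgKernel n R where
  toFun z := (((∫ z, k z)⁻¹ * k z : ℝ) : ℂ)
  continuous := Complex.continuous_ofReal.comp (continuous_const.mul hk)
  integrable := by
    have h : (fun z => ‖(((∫ z, k z)⁻¹ * k z : ℝ) : ℂ)‖ * (1 + ‖z‖) ^ R) =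
        fun z => (∫ z, k z)⁻¹ * (k z * (1 + ‖z‖) ^ R) := by
      ext z
      rw [Complex.norm_real, Real.norm_of_nonneg (mul_nonneg (inv_nonneg.2 hI.le) (hk0 z)), mul_assoc]
    rw [h]
    exact hi.const_mul _
  integral_eq_one := by
    rw [integral_complex_ofReal, integral_const_mul, inv_mul_cancel₀ hI.ne', Complex.ofReal_one]

theorem AvgKernel.ofPos_apply {R : ℝ} (k : Rn n → ℝ) (hk : Continuous k) (hk0 : ∀ z, 0 ≤ k z)
    (hi : Integrable fun z => k z * (1 + ‖z‖) ^ R) (hI : 0 < ∫ z, k z) (z : Rn n) :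
    (AvgKernel.ofPos k hk hk0 hi hI).toFun z = (((∫ z, k z)⁻¹ * k z : ℝ) : ℂ) := rfl

/-- An averaging kernel that is a combination of dilated Poisson kernels. -/
theorem exists_poissonAvgKernel (n : ℕ) (R : ℝ) : ∃ (B : AvgKernel n R) (J : ℕ)
    (c σ : ℕ → ℝ), (∀ j, 1 ≤ σ j) ∧ ∀ z, B.toFun z =
      ∑ j ∈ Finset.range J, (c j : ℂ) * (poissonDilate (σ j) z : ℂ) := by
  obtain ⟨J, hJ⟩ := exists_nat_ge R
  have hRJ : R ≤ 2 * J := by linarith [J.cast_nonneg (α := ℝ)]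
  refine ⟨.ofPos (fastKernel n J) (continuous_fastKernel n J) (fun z => (fastKernel_pos J z).le)
    (integrable_fastKernel_mul hRJ) (integral_fastKernel_pos n J), J + 1, fun j => (∫ z, fastKernel n J z)⁻¹ *
    ((-1) ^ j * J.choose j * (√(1 + j))⁻¹), fun j => √(1 + j), fun j => ?_, fun z => ?_⟩
  -- Scales at least 1 only widen the cones in which the non-tangential maximal function is taken.
  · exact Real.one_le_sqrt.2 (by linarith [j.cast_nonneg (α := ℝ)])
  · rw [AvgKernel.ofPos_apply, fastKernel.eq_1 n J z, Finset.mul_sum]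
    push_cast
    exact Finset.sum_congr rfl fun j _ => by ring

/-- Testing the weak identity on z ↦ Ψ(x - z) turns it into the exchange relation required of a
kernel family. -/
theorem IsPoissonConv.integral_eq {f : 𝓢'(Rn n, ℂ)} {t : ℝ} {g : Rn n → ℂ} (h : IsPoissonConv f t g)
    (Ψ : 𝓢(Rn n, ℂ)) (x : Rn n) :
    ∫ w, (poissonDilate t w : ℂ) * conv f Ψ (x - w) = ∫ z, g (x - z) * Ψ z := by
  have h1 := h.2.2 (reflectTranslate x Ψ)
  have h2 : ∀ z, conv f (reflect (reflectTranslate x Ψ)) z = conv f Ψ (x + z) := by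
    intro z
    unfold conv
    congr 1; ext y
    simp only [reflectTranslate_apply, reflect_apply]
    congr 1; abel
  simp only [h2, reflectTranslate_apply] at h1
  rw [← integral_sub_left_eq_self (fun z => g (x - z) * Ψ z) volume x,
    ← integral_neg_eq_self (fun w => (poissonDilate t w : ℂ) * conv f Ψ (x - w))]
  simp only [sub_sub_cancel, sub_neg_eq_add, h1]
  exact integral_congr_ae (Eventually.of_forall fun z => mul_comm _ _)

theorem poissonDilate_mul {s σ : ℝ} (z : Rn n) :
    poissonDilate (s * σ) z = (s ^ n)⁻¹ * poissonDilate σ (s⁻¹ • z) := by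
  unfold poissonDilate
  rw [smul_smul, mul_pow, mul_inv, mul_inv, mul_assoc, mul_comm σ⁻¹]

theorem integral_poissonDilate_mul_comp_smul (g : Rn n → ℂ) {s σ : ℝ} (hs : 0 < s) (x : Rn n) :
    ∫ w, (poissonDilate σ w : ℂ) * g (x - s • w) = ∫ w, (poissonDilate (s * σ) w : ℂ) * g (x - w) := by
  have h1 := Measure.integral_comp_smul (volume : Measure (Rn n))
    (fun w => (poissonDilate σ (s⁻¹ • w) : ℂ) * g (x - w)) s
  simp only [smul_smul, inv_mul_cancel₀ hs.ne', one_smul, finrank_euclideanSpace, Fintype.card_fin] at h1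
  rw [h1, abs_of_nonneg (by positivity), ← integral_smul]
  congr 1; ext w
  rw [poissonDilate_mul, Complex.real_smul]; push_cast; ring

/-- Boundedness allows growth exponent 0, so the number of moments required of B, and hence B
itself, does not depend on f. -/
theorem IsBoundedDistribution.isKernelFamily {f : 𝓢'(Rn n, ℂ)} (hf : IsBoundedDistribution f)
    {R : ℝ} {B : AvgKernel n R} {J : ℕ} {c σ : ℕ → ℝ} (hσ : ∀ j, 1 ≤ σ j)
    (hB : ∀ z, B.toFun z = ∑ j ∈ Finset.range J, (c j : ℂ) * (poissonDilate (σ j) z : ℂ)) :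
    IsKernelFamily f B.toFun 0
      (fun τ => ∑ j ∈ Finset.range J, (c j : ℂ) • poissonConv f (τ * σ j)) := by
  have hP : ∀ t, 0 < t → IsPoissonConv f t (poissonConv f t) := fun t ht =>
    hf.poissonConv_eq ht ▸ hf.isPoissonConv_poissonExt ht
  have hσ0 : ∀ j, 0 < σ j := fun j => one_pos.trans_le (hσ j)
  obtain ⟨K', C', -, hA⟩ := hf.exists_bound
  have hmem : ∀ t, 0 < t → poissonConv f t ∈ growthSpace n 0 := fun t ht => by
    obtain ⟨hc, ⟨A, hA⟩, -⟩ := hP t ht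
    exact ⟨hc, A, fun x => by simpa using hA x⟩
  refine ⟨fun s hs => Submodule.sum_mem _ fun j _ => Submodule.smul_mem _ _
    (hmem _ (mul_pos hs (hσ0 j))), fun Ψ => ⟨continuous_conv f Ψ, _, fun x => by
      simpa using hA Ψ x⟩, fun Ψ s hs x => ?_⟩
  simp only [hB, Finset.sum_mul, Finset.sum_apply, Pi.smul_apply, smul_eq_mul, mul_assoc]
  rw [integral_finsetSum, integral_finsetSum]
  · refine Finset.sum_congr rfl fun j _ => ?_
    rw [integral_const_mul, integral_const_mul, integral_poissonDilate_mul_comp_smul _ hs,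
      (hP _ (mul_pos hs (hσ0 j))).integral_eq]
  · intro j _
    obtain ⟨hc, ⟨A, hA⟩, -⟩ := hP _ (mul_pos hs (hσ0 j))
    exact (Ψ.integrable.bdd_mul (hc.comp (by fun_prop)).aestronglyMeasurable
      (Eventually.of_forall fun z => hA _)).const_mul _
  · intro j _
    refine Integrable.const_mul ?_ _
    exact (integrable_poissonDilate (hσ0 j)).ofReal.mul_bdd
      ((continuous_conv f Ψ).comp (by fun_prop)).aestronglyMeasurable
      (Eventually.of_forall fun z => hA Ψ _)

/-- For bounded distributions the grand maximal function is controlled in norm by the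
non-tangential one. -/
theorem IsMP0.exists_varNorm_grandMaximal_le_nontangential {p : Rn n → ℝ} {p₀ : ℝ} (hp : IsMP0 p p₀)
    {N : ℕ} (hN : n / p₀ + n < N) : ∃ C : ℝ≥0, ∀ f : 𝓢'(Rn n, ℂ), IsBoundedDistribution f →
      varNorm p (grandMaximal N f) ≤ C * varNorm p (nontangentialMaximal f) := by
  obtain ⟨B, J, c, σ, hσ, hB⟩ := exists_poissonAvgKernel n (max (n + 0 + 1) (N + 1))
  obtain ⟨C₁, hC₁, hhl⟩ := hp.varNorm_le_of_le_hlMaximal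
  obtain ⟨C₂, hC₂⟩ := exists_grandMaximal_le_hlMaximal hp.p₀_pos hN (absMoment B.toFun (N + 1))
  set A : ℝ≥0 := ∑ j ∈ Finset.range J, ‖(c j : ℂ)‖₊ with hA
  refine ⟨(C₂ + 1) * C₁ * (A + 1), fun f hf => ?_⟩
  -- By unfolding, `nontangentialMaximal f` is `nontangential (poissonConv f)`.
  have hm : Measurable (nontangentialMaximal f) :=
    (lowerSemicontinuous_nontangential (poissonConv f)).measurable
  have h2 := hhl C₂ (fun x => ((A + 1 : ℝ≥0) : ℝ≥0∞) * nontangentialMaximal f x) _ (hm.const_mul _)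
    (hC₂ B f _ le_rfl (hf.isKernelFamily hσ hB) le_rfl
      (le_max_left _ _) (le_max_right _ _) _ fun τ hτ y z h => ?_)
  · calc _ ≤ _ := h2
      _ ≤ (C₂ + 1) * C₁ * ((A + 1 : ℝ≥0) * varNorm p (nontangentialMaximal f)) :=
          mul_le_mul' le_rfl (varNorm_const_mul_le (by positivity) _)
      _ = _ := by push_cast; ring
  -- If ‖z - y‖ < τ then also ‖z - y‖ < τ σ_j, so each P_{τ σ_j} * f(y) lies in the cone at z.
  · rw [Finset.sum_apply]
    refine (enorm_sum_le _ _).trans ?_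
    calc _ ≤ ∑ j ∈ Finset.range J, (‖(c j : ℂ)‖₊ : ℝ≥0∞) * nontangentialMaximal f z := by
          refine Finset.sum_le_sum fun j _ => ?_
          rw [Pi.smul_apply, smul_eq_mul, enorm_mul]
          refine mul_le_mul' le_rfl (enorm_le_nontangential (poissonConv f)
            (mul_pos hτ (one_pos.trans_le (hσ j))) (h.trans_le ?_))
          exact le_mul_of_one_le_right hτ.le (hσ j)
      _ = (A : ℝ≥0∞) * nontangentialMaximal f z := by rw [← Finset.sum_mul, hA]; push_cast; rfl
      _ ≤ _ := by gcongr; exact le_self_add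

end PoissonKernel

end

/-! ### Comparison with the Poisson maximal function and boundedness of f -/

section

variable {n : ℕ}

/-- f * Φ_s at y is f * Θ_s at x for the translate Θ of Φ by (y - x)/s, whose seminorm has grown at
most by a multiple of (1 + v)^N. -/
theorem enorm_dilConv_le_grandMaximal (N : ℕ) (Φ : 𝓢(Rn n, ℂ)) (f : 𝓢'(Rn n, ℂ)) {s v : ℝ}
    (hs : 0 < s) (hv : 0 ≤ v) {x y : Rn n} (h : ‖x - y‖ ≤ s * v) :
    ‖dilConv f Φ s y‖ₑ ≤
      ENNReal.ofReal (2 ^ N * 2 ^ N * (schwartzNorm N Φ + 1) * (1 + v) ^ N) * grandMaximal N f x := by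
  have hΦ := apply_nonneg (schwartzNorm (n := n) N) Φ
  set Θ := affine 1 (s⁻¹ • (y - x)) Φ with hΘ
  have hnorm : ‖s⁻¹ • (y - x)‖ ≤ v := by
    rw [norm_smul, norm_inv, Real.norm_of_nonneg hs.le, norm_sub_rev, inv_mul_le_iff₀ hs]
    exact h
  have h1 : schwartzNorm N Θ ≤ 2 ^ N * 2 ^ N * (schwartzNorm N Φ + 1) * (1 + v) ^ N := by
    refine (schwartzNorm_affine_le one_pos (by simp) (by simp) le_rfl hnorm N Φ).trans ?_
    rw [inv_one, one_add_one_eq_two, mul_pow, one_pow, mul_one]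
    calc _ = 2 ^ N * 2 ^ N * schwartzNorm N Φ * (1 + v) ^ N := by ring
      _ ≤ _ := by gcongr; linarith
  have h2 : dilConv f Φ s y = dilConv f Θ s x := by
    unfold dilConv
    congr 2; ext z
    have hs' : -s⁻¹ ≠ 0 := neg_ne_zero.2 (inv_ne_zero hs.ne')
    rw [affine_apply hs', affine_apply hs', hΘ, affine_apply one_ne_zero]
    congr 1; module
  rw [h2, ← conv_dilate f Θ hs]
  exact enorm_conv_dilate_le_grandMaximal (by positivity) h1 f hs x

/-- In the subordination formula the Gaussian has scale s = t/v, so a point of the cone is at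
distance less than t = s v. The loss (1 + v)^N is integrable against exp(-v²). -/
theorem exists_nontangentialMaximal_le (n N : ℕ) : ∃ C : ℝ≥0, 0 < C ∧ ∀ f : 𝓢'(Rn n, ℂ),
    IsBoundedDistribution f → ∀ x, nontangentialMaximal f x ≤ C * grandMaximal N f x := by
  have hΦ := apply_nonneg (schwartzNorm (n := n) N) (gaussian n)
  set c : ℝ := 2 ^ N * 2 ^ N * (schwartzNorm N (gaussian n) + 1) with hc
  have hc0 : 0 < c := by positivity
  set I := ∫⁻ v in Ioi (0 : ℝ), ENNReal.ofReal ((1 + v) ^ N * Real.exp (-v ^ 2)) with hI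
  have hItop : I ≠ ∞ := by
    refine ((lintegral_mono fun v => ?_).trans_lt
      (integrableOn_one_add_pow_mul_exp_neg_sq N).hasFiniteIntegral).ne
    rw [← ofReal_norm]
    exact ENNReal.ofReal_le_ofReal (le_abs_self _)
  set D : ℝ≥0∞ := ENNReal.ofReal (poissonConst n) * (ENNReal.ofReal c * I) with hD
  have hDtop : D ≠ ∞ := ENNReal.mul_ne_top ENNReal.ofReal_ne_top
    (ENNReal.mul_ne_top ENNReal.ofReal_ne_top hItop)
  refine ⟨D.toNNReal + 1, by positivity, fun f hf x => iSup₂_le fun t y => iSup_le fun ⟨ht, hxy⟩ => ?_⟩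
  have h1 : ‖∫ v in Ioi (0 : ℝ), ((Real.exp (-v ^ 2) : ℝ) : ℂ) * dilConv f (gaussian n) (t / v) y‖ₑ ≤
      ENNReal.ofReal c * I * grandMaximal N f x := by
    refine (enorm_integral_le_lintegral_enorm _).trans ?_
    rw [mul_assoc, mul_comm I, ← mul_assoc, hI, ← lintegral_const_mul _ (by fun_prop)]
    · refine setLIntegral_mono' measurableSet_Ioi fun v hv => ?_
      have hv0 : 0 < v := hv
      have h2 := enorm_dilConv_le_grandMaximal N (gaussian n) f (s := t / v) (v := v) (x := x) (y := y)
        (div_pos ht hv0) hv0.le (by rw [div_mul_cancel₀ _ hv0.ne']; exact hxy.le)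
      rw [enorm_mul, ← ofReal_norm, Complex.norm_real, Real.norm_of_nonneg (Real.exp_pos _).le]
      refine (mul_le_mul' le_rfl h2).trans (le_of_eq ?_)
      rw [← hc, ENNReal.ofReal_mul hc0.le, ENNReal.ofReal_mul (p := (1 + v) ^ N) (by positivity)]
      ring
  rw [hf.poissonConv_eq ht, poissonExt, enorm_mul, ← ofReal_norm (poissonConst n : ℂ),
    Complex.norm_real, Real.norm_of_nonneg (poissonConst_pos n).le]
  calc _ ≤ ENNReal.ofReal (poissonConst n) * (ENNReal.ofReal c * I * grandMaximal N f x) :=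
        mul_le_mul' le_rfl h1
    _ = D * grandMaximal N f x := by rw [hD]; ring
    _ ≤ _ := by
        refine mul_le_mul' ?_ le_rfl
        rw [ENNReal.coe_add, ENNReal.coe_toNNReal hDtop]
        exact le_self_add

/-- |f * Φ(x)| is at most a constant times the grand maximal function at every point of the unit
ball about x, and such a lower bound is limited uniformly in x when the norm is finite. -/
theorem IsMP0.isBoundedDistribution {p : Rn n → ℝ} {p₀ : ℝ} (hp : IsMP0 p p₀) {N : ℕ}
    {f : 𝓢'(Rn n, ℂ)} (h : varNorm p (grandMaximal N f) < ∞) : IsBoundedDistribution f := by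
  obtain ⟨A, hA⟩ := hp.exists_le_of_le_on_ball h
  intro Φ
  have hΦ := apply_nonneg (schwartzNorm (n := n) N) Φ
  set c : ℝ := 2 ^ N * 2 ^ N * (schwartzNorm N Φ + 1) * (1 + 1) ^ N with hc
  have hc0 : 0 < c := by positivity
  refine memLp_top_of_bound (continuous_conv f Φ).aestronglyMeasurable
    (ENNReal.ofReal c * A).toReal (Eventually.of_forall fun x => ?_)
  have h1 : ‖conv f Φ x‖ₑ / ENNReal.ofReal c ≤ A := by
    refine hA _ x fun y hy => ENNReal.div_le_of_le_mul' ?_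
    have hd : dilate 1 one_pos Φ = Φ := by ext z; simp
    have h2 := enorm_dilConv_le_grandMaximal N Φ f one_pos one_pos.le (x := y) (y := x)
      (by rw [one_mul, ← dist_eq_norm]; exact (Metric.mem_ball.1 hy).le)
    rwa [← conv_dilate f Φ one_pos, hd] at h2
  rw [ENNReal.div_le_iff (by simpa using hc0) ENNReal.ofReal_ne_top, mul_comm] at h1
  rw [← toReal_enorm]
  exact ENNReal.toReal_mono (ENNReal.mul_ne_top ENNReal.ofReal_ne_top ENNReal.coe_ne_top) h1

theorem integral_gaussian_ne_zero (n : ℕ) : ∫ x, gaussian n x ≠ 0 := by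
  simp only [gaussian_apply]
  rw [integral_complex_ofReal, Complex.ofReal_ne_zero]
  have := GaussianFourier.integral_rexp_neg_mul_sq_norm (V := Rn n) one_pos
  simp only [neg_mul, one_mul] at this
  rw [this]
  positivity

theorem exists_varNorm_radialMaximal_le {p : Rn n → ℝ} (hp : ∀ x, 0 ≤ p x) (N : ℕ)
    (Φ : 𝓢(Rn n, ℂ)) : ∃ C : ℝ≥0, ∀ f : 𝓢'(Rn n, ℂ),
      varNorm p (radialMaximal Φ f) ≤ C * varNorm p (grandMaximal N f) := by
  have hΦ := apply_nonneg (schwartzNorm (n := n) N) Φ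
  exact ⟨(schwartzNorm N Φ + 1).toNNReal, fun f =>
    (varNorm_mono hp (radialMaximal_le_grandMaximal N Φ f)).trans
      (varNorm_const_mul_le (by simp) _)⟩

theorem exists_varNorm_nontangentialMaximal_le {p : Rn n → ℝ} (hp : ∀ x, 0 ≤ p x) (N : ℕ) :
    ∃ C : ℝ≥0, ∀ f : 𝓢'(Rn n, ℂ), IsBoundedDistribution f →
      varNorm p (nontangentialMaximal f) ≤ C * varNorm p (grandMaximal N f) := by
  obtain ⟨C, hC, h⟩ := exists_nontangentialMaximal_le n N
  exact ⟨C, fun f hf => (varNorm_mono hp (h f hf)).trans (varNorm_const_mul_le hC _)⟩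

theorem IsMP0.memVarLp_iff {p : Rn n → ℝ} {p₀ : ℝ} (hp : IsMP0 p p₀) {F : Rn n → ℝ≥0∞}
    (hF : Measurable F) : MemVarLp p F ↔ varNorm p F < ∞ :=
  ⟨hp.varNorm_lt_top, MemVarLp.of_varNorm_lt_top hF.aemeasurable⟩

end

end VarHardy

end

/-! ### Assembly of the equivalences and norm comparisons -/

theorem theorem3p1 (n : ℕ) (hn : 1 ≤ n) (p : VarHardy.Rn n → ℝ) (p₀ : ℝ)
    (hp : VarHardy.IsMP0 p p₀) :
    (∀ f : 𝓢'(VarHardy.Rn n, ℂ), List.TFAE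
      [∃ Φ : 𝓢(VarHardy.Rn n, ℂ), (∫ x, Φ x) ≠ 0 ∧
          VarHardy.MemVarLp p (VarHardy.radialMaximal Φ f),
        ∀ N : ℕ, (n : ℝ) / p₀ + n + 1 < N → VarHardy.MemVarLp p (VarHardy.grandMaximal N f),
        VarHardy.IsBoundedDistribution f ∧
          VarHardy.MemVarLp p (VarHardy.nontangentialMaximal f)]) ∧
    (∀ Φ : 𝓢(VarHardy.Rn n, ℂ), (∫ x, Φ x) ≠ 0 → ∀ N : ℕ, (n : ℝ) / p₀ + n + 1 < N →
      ∃ C : ℝ≥0, ∀ f : 𝓢'(VarHardy.Rn n, ℂ),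
        (VarHardy.varNorm p (VarHardy.radialMaximal Φ f) ≤
            C * VarHardy.varNorm p (VarHardy.grandMaximal N f) ∧
          VarHardy.varNorm p (VarHardy.grandMaximal N f) ≤
            C * VarHardy.varNorm p (VarHardy.radialMaximal Φ f)) ∧
        (VarHardy.IsBoundedDistribution f →
          (VarHardy.varNorm p (VarHardy.nontangentialMaximal f) ≤
              C * VarHardy.varNorm p (VarHardy.grandMaximal N f) ∧
            VarHardy.varNorm p (VarHardy.grandMaximal N f) ≤
              C * VarHardy.varNorm p (VarHardy.nontangentialMaximal f)) ∧
          (VarHardy.varNorm p (VarHardy.nontangentialMaximal f) ≤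
              C * VarHardy.varNorm p (VarHardy.radialMaximal Φ f) ∧
            VarHardy.varNorm p (VarHardy.radialMaximal Φ f) ≤
              C * VarHardy.varNorm p (VarHardy.nontangentialMaximal f)))) := by
  have hp0 : ∀ x, 0 ≤ p x := fun x => (hp.isExponent.pos x).le
  have hmono : ∀ {N : ℕ}, (n : ℝ) / p₀ + n + 1 < N → (n : ℝ) / p₀ + n < N := fun h => by linarith
  have hfin : ∀ {C : ℝ≥0} {a b : ℝ≥0∞}, a ≤ C * b → b < ∞ → a < ∞ := fun h hb =>
    h.trans_lt (ENNReal.mul_lt_top ENNReal.coe_lt_top hb)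
  -- The maximal functions are lower semicontinuous, hence measurable, so membership amounts to
  -- finiteness of the quasi-norm and the equivalences follow from norm inequalities.
  have hR : ∀ Φ f, VarHardy.MemVarLp p (VarHardy.radialMaximal Φ f) ↔ _ := fun Φ f =>
    hp.memVarLp_iff (VarHardy.lowerSemicontinuous_radialMaximal Φ f).measurable
  have hG : ∀ N f, VarHardy.MemVarLp p (VarHardy.grandMaximal N f) ↔ _ := fun N f =>
    hp.memVarLp_iff (VarHardy.lowerSemicontinuous_grandMaximal N f).measurable
  have hT : ∀ f, VarHardy.MemVarLp p (VarHardy.nontangentialMaximal f) ↔ _ := fun f =>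
    hp.memVarLp_iff (VarHardy.lowerSemicontinuous_nontangential (VarHardy.poissonConv f)).measurable
  constructor
  · intro f
    obtain ⟨N, hN⟩ := exists_nat_gt ((n : ℝ) / p₀ + n + 1)
    tfae_have 1 → 2 := by
      rintro ⟨Φ, hΦ, h⟩ M hM
      obtain ⟨C, hC⟩ := hp.exists_varNorm_grandMaximal_le hΦ (hmono hM)
      exact (hG M f).2 (hfin (hC f) ((hR Φ f).1 h))
    tfae_have 2 → 3 := by
      intro h
      have h1 := (hG N f).1 (h N hN)
      have hf := hp.isBoundedDistribution h1
      obtain ⟨C, hC⟩ := VarHardy.exists_varNorm_nontangentialMaximal_le hp0 N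
      exact ⟨hf, (hT f).2 (hfin (hC f hf) h1)⟩
    tfae_have 3 → 1 := by
      rintro ⟨hf, h⟩
      obtain ⟨C, hC⟩ := hp.exists_varNorm_grandMaximal_le_nontangential (hmono hN)
      obtain ⟨C', hC'⟩ := VarHardy.exists_varNorm_radialMaximal_le hp0 N (VarHardy.gaussian n)
      -- Any Φ of nonzero integral would do; the Gaussian is at hand.
      exact ⟨VarHardy.gaussian n, VarHardy.integral_gaussian_ne_zero n,
        (hR _ f).2 (hfin (hC' f) (hfin (hC f hf) ((hT f).1 h)))⟩
    tfae_finish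
  · intro Φ hΦ N hN
    obtain ⟨C₁, h₁⟩ := VarHardy.exists_varNorm_radialMaximal_le hp0 N Φ
    obtain ⟨C₂, h₂⟩ := hp.exists_varNorm_grandMaximal_le hΦ (hmono hN)
    obtain ⟨C₃, h₃⟩ := VarHardy.exists_varNorm_nontangentialMaximal_le hp0 N
    obtain ⟨C₄, h₄⟩ := hp.exists_varNorm_grandMaximal_le_nontangential (hmono hN)
    -- A single constant serves all six inequalities: the sum of the four basic ones and of the two
    -- products arising when the Poisson and radial functions are compared through the grand one.
    have hle : ∀ {D : ℝ≥0} {a b : ℝ≥0∞}, a ≤ D * b → D ≤ C₁ + C₂ + C₃ + C₄ + C₃ * C₂ + C₁ * C₄ →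
        a ≤ ((C₁ + C₂ + C₃ + C₄ + C₃ * C₂ + C₁ * C₄ : ℝ≥0) : ℝ≥0∞) * b := fun h hD =>
      h.trans (mul_le_mul' (ENNReal.coe_le_coe.2 hD) le_rfl)
    have hcomp : ∀ {D E : ℝ≥0} {a b c : ℝ≥0∞}, a ≤ D * b → b ≤ E * c →
        a ≤ ((D * E : ℝ≥0) : ℝ≥0∞) * c := fun h h' => by
      rw [ENNReal.coe_mul, mul_assoc]
      exact h.trans (mul_le_mul' le_rfl h')
    have hD : C₁ ≤ C₁ + C₂ + C₃ + C₄ + C₃ * C₂ + C₁ * C₄ ∧ C₂ ≤ C₁ + C₂ + C₃ + C₄ + C₃ * C₂ + C₁ * C₄ ∧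
        C₃ ≤ C₁ + C₂ + C₃ + C₄ + C₃ * C₂ + C₁ * C₄ ∧ C₄ ≤ C₁ + C₂ + C₃ + C₄ + C₃ * C₂ + C₁ * C₄ ∧
        C₃ * C₂ ≤ C₁ + C₂ + C₃ + C₄ + C₃ * C₂ + C₁ * C₄ ∧
        C₁ * C₄ ≤ C₁ + C₂ + C₃ + C₄ + C₃ * C₂ + C₁ * C₄ := by
      simp only [← NNReal.coe_le_coe]
      push_cast
      refine ⟨?_, ?_, ?_, ?_, ?_, ?_⟩ <;>
        nlinarith [C₁.2, C₂.2, C₃.2, C₄.2, mul_nonneg C₃.2 C₂.2, mul_nonneg C₁.2 C₄.2]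
    obtain ⟨d₁, d₂, d₃, d₄, d₅, d₆⟩ := hD
    exact ⟨_, fun f => ⟨⟨hle (h₁ f) d₁, hle (h₂ f) d₂⟩, fun hf =>
      ⟨⟨hle (h₃ f hf) d₃, hle (h₄ f hf) d₄⟩, hle (hcomp (h₃ f hf) (h₂ f)) d₅,
        hle (hcomp (h₁ f) (h₄ f hf)) d₆⟩⟩⟩
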